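/- **Setting.** Inner products are linear in the second variable. Let $\mathsf H_{\mathbb R}$ be a finite-dimensional real Hilbert space, $(U_t)_{t\in\mathbb R}$ a strongly continuous one-parameter group of orthogonal operators on it, $\mathsf H_{\mathbb R}=\bigoplus_{i\in N}\mathsf H^{(i)}_{\mathbb R}$ ($N$ finite) an orthogonal decomposition into $U_t$-invariant subspaces, and $q(i,j)=q(j,i)\in(-1,1)$ for $i,j\in N$. Extend $U_t$ to the complexification $\mathsf H_{\mathbb C}$, with involution $\overline{x+iy}=x-iy$; let $A$ be the positive invertible operator with $U_t=A^{it}$, and let $\mathsf H_U$ be $\mathsf H_{\mathbb C}$ with the inner product $\langle\xi,\zeta\rangle_U=\langle\xi,2(1+A^{-1})^{-1}\zeta\rangle$. Let $T$ be the operator on $\mathsf H_U\otimes\mathsf H_U$ with $T(\xi\otimes\eta)=q(i,j)\,\eta\otimes\xi$ for $\xi\in\mathsf H^{(i)}_{\mathbb C}$, $\eta\in\mathsf H^{(j)}_{\mathbb C}$, let $T_k$ be $T$ acting on the $k$-th and $(k+1)$-st tensor factors, and $P^{(n)}=\sum_{\sigma\in S_n}\Phi(\sigma)$ with $\Phi$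 the quasi-multiplicative map with $\Phi(1)=I$ and $\Phi((k\ k{+}1))=T_k$. The deformed Fock space $\mathcal F_T$ is the completion of the algebraic Fock space $\mathcal F_{\mathrm{alg}}=\bigoplus_{n\ge0}\mathsf H_U^{\otimes n}$ (with vacuum $\Omega$) for $\langle\xi,\eta\rangle_T=\langle\xi,P^{(n)}\eta\rangle$ on $\mathsf H_U^{\otimes n}$, different degrees being orthogonal. On it consider the bounded operators $$l(\xi)\Omega=0,\quad l(\xi)(\xi_1\otimes\cdots\otimes\xi_n)=\langle\xi,\xi_1\rangle_U\,\xi_2\otimes\cdots\otimes\xi_n,\qquad a^*(\xi)x=\xi\otimes x,$$ $$a(\xi)\Omega=0,\qquad a(\xi)=l(\xi)(1+T_1+T_1T_2+\cdots+T_1\cdots T_{n-1})\ \text{ on } \mathsf H_U^{\otimes n}.$$ Let $\mathsf M_T$ be the von Neumann algebra generated by $a(\xi)+a^*(\xi)$, $\xi\in\mathsf H_{\mathbb R}$, let $\varphi=\langle\Omega,\cdot\,\Omega\rangle_T$, and for $x\in\mathcal F_{\mathrm{alg}}$ let $W(x)$ be the unique element of $\mathsf M_T$ with $W(x)\Omega=x$.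 Fix an orthonormal basis $e_1,\dots,e_d$ of $\mathsf H_U$ with $e_k\in\mathsf H_{\mathbb C}^{(i_k)}$, and put $A_k=W(e_k)$. A *normalized dual system* is a tuple $(D_1,\dots,D_d)$ of unbounded operators on $\mathcal F_T$ with $\mathcal F_{\mathrm{alg}}\subseteq\operatorname{dom}D_k$, $\Omega\in\operatorname{dom}D_k^*$, $D_k\Omega=0$ and $[D_k,A_l]=\langle\bar e_l,e_k\rangle_U P_{\mathbb C\Omega}$ on $\mathcal F_{\mathrm{alg}}$ for all $k,l$. Let $\partial_k$ be the derivation from the unital $*$-algebra $\mathbb C[A_1,\dots,A_d]$ to $\mathsf M_T\otimes\mathsf M_T^{\mathrm{op}}$, $\partial_k(ab)=(a\otimes1)\,\partial_k(b)+(1\otimes b^{\mathrm{op}})\,\partial_k(a)$, with $\partial_k(A_l)=\varphi(A_lA_k)\,1\otimes1$. The *$k$-th conjugate variable* is the vector $\xi_k\in\mathcal F_T$ with $\langle\xi_k,x\Omega\rangle=(\varphi\otimes\varphi^{\mathrm{op}})(\partial_k(x))$ for all $x\in\mathbb C[A_1,\dots,A_d]$. For a word $w=\alpha_n\cdots\alpha_1$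 in the letters $1,\dots,d$ write $|w|=n$, $\bar e_w=\bar e_{\alpha_n}\otimes\cdots\otimes\bar e_{\alpha_1}$ (with $\bar e_w=\Omega$ for the empty word), $i^{(w)}_t=i_{\alpha_t}$, and $L_{w\beta}=l(e_\beta)\,l(e_{\alpha_1})\cdots l(e_{\alpha_n})$ for $1\le\beta\le d$. **Corollary 3.4.** The objects above are well defined: the operators are bounded, each $x\in\mathcal F_{\mathrm{alg}}$ has exactly one $W(x)$, and the $\partial_k$ exist. There is a normalized dual system. For $m\ge1$ and $1\le\alpha\le d$ let $$\xi_{m,\alpha}=\sum_{\beta=1}^d\ \sum_{|w|=m-1}\ \prod_{1\le v<u\le m-1}q\bigl(i^{(w)}_v,i^{(w)}_u\bigr)\prod_{t=1}^{m-1}q\bigl(i_\alpha,i^{(w)}_t\bigr)\,\langle e_\alpha,\bar e_\beta\rangle_U\,L_{w\beta}^*(\bar e_w).$$ Then $\xi_{m,\alpha}\in\mathcal F_{\mathrm{alg}}$, and for every $\alpha$ the series $$\xi_\alpha=\sum_{m=1}^\infty(-1)^{m-1}\xi_{m,\alpha}$$ converges (unconditionally) in $\mathcal F_T$; its sum $\xi_\alpha$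 is the $\alpha$-th conjugate variable, and $\xi_\alpha=D_\alpha^*\Omega$ for every normalized dual system $(D_1,\dots,D_d)$. Moreover $\sum_{m\ge1}(-1)^{m-1}W(\xi_{m,\alpha})$ converges (unconditionally) in operator norm to an element $X\in\mathsf M_T$ with $X\Omega=\xi_\alpha$; in particular $\xi_\alpha\in\mathsf M_T\Omega$. -/

import Mathlib

open scoped TensorProduct ComplexConjugate

noncomputable section

namespace MixedArakiWoods

/-! ### The complexification of a real Hilbert space -/

/-- The complexification `V + iV` of a real vector space `V`; the element `⟨x, y⟩` is `x + iy`. -/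
@[ext]
structure Cplx (V : Type*) where
  /-- the real part -/
  re : V
  /-- the imaginary part -/
  im : V

namespace Cplx

variable {V : Type*} [NormedAddCommGroup V] [InnerProductSpace ℝ V]

set_option linter.unusedSectionVars false

section Construction

/-- The additive group structure, componentwise. -/
abbrev groupAux : AddCommGroup (Cplx V) where
  add z w := ⟨z.re + w.re, z.im + w.im⟩
  zero := ⟨0, 0⟩
  neg z := ⟨-z.re, -z.im⟩
  add_assoc a b c := Cplx.ext (add_assoc _ _ _) (add_assoc _ _ _)
  zero_add a := Cplx.ext (zero_add _) (zero_add _)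
  add_zero a := Cplx.ext (add_zero _) (add_zero _)
  nsmul n z := ⟨n • z.re, n • z.im⟩
  nsmul_zero z := Cplx.ext (zero_nsmul _) (zero_nsmul _)
  nsmul_succ n z := Cplx.ext (succ_nsmul _ _) (succ_nsmul _ _)
  zsmul n z := ⟨n • z.re, n • z.im⟩
  zsmul_zero' z := Cplx.ext (zero_zsmul _) (zero_zsmul _)
  zsmul_succ' n z := Cplx.ext (SubNegMonoid.zsmul_succ' n _) (SubNegMonoid.zsmul_succ' n _)
  zsmul_neg' n z := Cplx.ext (SubNegMonoid.zsmul_neg' n _) (SubNegMonoid.zsmul_neg' n _)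
  neg_add_cancel a := Cplx.ext (neg_add_cancel _) (neg_add_cancel _)
  add_comm a b := Cplx.ext (add_comm _ _) (add_comm _ _)

attribute [local instance] groupAux

/-- Complex scalars act by `(a + ib)(x + iy) = (ax - by) + i(ay + bx)`. -/
abbrev smulAux : SMul ℂ (Cplx V) :=
  ⟨fun c z => ⟨c.re • z.re - c.im • z.im, c.re • z.im + c.im • z.re⟩⟩

attribute [local instance] smulAux

theorem add_re' (z w : Cplx V) : (z + w).re = z.re + w.re := rfl
theorem add_im' (z w : Cplx V) : (z + w).im = z.im + w.im := rfl
theorem smul_re' (c : ℂ) (z : Cplx V) : (c • z).re = c.re • z.re - c.im • z.im := rfl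
theorem smul_im' (c : ℂ) (z : Cplx V) : (c • z).im = c.re • z.im + c.im • z.re := rfl

/-- The complex vector space structure. -/
abbrev moduleAux : Module ℂ (Cplx V) where
  one_smul z := by ext <;> simp [smul_re', smul_im']
  mul_smul a b z := by
    ext
    · simp only [smul_re', smul_im', Complex.mul_re, Complex.mul_im]; module
    · simp only [smul_re', smul_im', Complex.mul_re, Complex.mul_im]; module
  smul_zero a := by
    ext
    · change a.re • (0 : V) - a.im • (0 : V) = 0; simp
    · change a.re • (0 : V) + a.im • (0 : V) = 0; simp
  smul_add a z w := by
    ext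
    · simp only [smul_re', add_re', add_im']; module
    · simp only [smul_im', add_re', add_im']; module
  add_smul a b z := by
    ext
    · simp only [smul_re', add_re', Complex.add_re, Complex.add_im]; module
    · simp only [smul_im', add_im', Complex.add_re, Complex.add_im]; module
  zero_smul z := by
    ext
    · change (0 : ℝ) • z.re - (0 : ℝ) • z.im = 0; simp
    · change (0 : ℝ) • z.im + (0 : ℝ) • z.re = 0; simp

attribute [local instance] moduleAux

/-- The inner product of the complexification, linear in the second variable:
`⟨x + iy, x' + iy'⟩ = ⟨x, x'⟩ + ⟨y, y'⟩ + i (⟨x, y'⟩ - ⟨y, x'⟩)`. -/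
abbrev innerCore : InnerProductSpace.Core ℂ (Cplx V) where
  inner z w := ⟨inner ℝ z.re w.re + inner ℝ z.im w.im, inner ℝ z.re w.im - inner ℝ z.im w.re⟩
  conj_inner_symm z w := by
    apply Complex.ext
    · simp [real_inner_comm]
    · simp [real_inner_comm]
  re_inner_nonneg z := by
    exact add_nonneg real_inner_self_nonneg real_inner_self_nonneg
  add_left x y z := by
    apply Complex.ext
    · simp [inner_add_left, add_re', add_im']; ring
    · simp [inner_add_left, add_re', add_im']; ring
  smul_left x y r := by
    apply Complex.ext
    · simp [inner_add_left, inner_sub_left, real_inner_smul_left, smul_re', smul_im']; ring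
    · simp [inner_add_left, inner_sub_left, real_inner_smul_left, smul_re', smul_im']; ring
  definite z h := by
    have h1 : inner ℝ z.re z.re + inner ℝ z.im z.im = (0 : ℝ) := congrArg Complex.re h
    have h2 : (0 : ℝ) ≤ inner ℝ z.re z.re := real_inner_self_nonneg
    have h3 : (0 : ℝ) ≤ inner ℝ z.im z.im := real_inner_self_nonneg
    apply Cplx.ext
    · exact inner_self_eq_zero.mp (by linarith : inner ℝ z.re z.re = (0 : ℝ))
    · exact inner_self_eq_zero.mp (by linarith : inner ℝ z.im z.im = (0 : ℝ))

instance : NormedAddCommGroup (Cplx V) :=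
  InnerProductSpace.Core.toNormedAddCommGroup (cd := innerCore)

instance : InnerProductSpace ℂ (Cplx V) := InnerProductSpace.ofCore innerCore.toCore

end Construction

@[simp] theorem zero_re : (0 : Cplx V).re = 0 := rfl
@[simp] theorem zero_im : (0 : Cplx V).im = 0 := rfl
@[simp] theorem add_re (z w : Cplx V) : (z + w).re = z.re + w.re := rfl
@[simp] theorem add_im (z w : Cplx V) : (z + w).im = z.im + w.im := rfl
@[simp] theorem smul_re (c : ℂ) (z : Cplx V) : (c • z).re = c.re • z.re - c.im • z.im := rfl
@[simp] theorem smul_im (c : ℂ) (z : Cplx V) : (c • z).im = c.re • z.im + c.im • z.re := rfl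

theorem inner_def (z w : Cplx V) : inner ℂ z w =
    ⟨inner ℝ z.re w.re + inner ℝ z.im w.im, inner ℝ z.re w.im - inner ℝ z.im w.re⟩ := rfl

/-- The canonical involution `x + iy ↦ x - iy`. -/
def bar (z : Cplx V) : Cplx V := ⟨z.re, -z.im⟩

/-- The inclusion of `V` as the real part `V + i0`. -/
def ofReal (x : V) : Cplx V := ⟨x, 0⟩

/-- The complex linear extension of a bounded real operator. -/
def mapCLM (f : V →L[ℝ] V) : Cplx V →L[ℂ] Cplx V :=
  LinearMap.mkContinuous
    { toFun := fun z => ⟨f z.re, f z.im⟩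
      map_add' := fun z w => by ext <;> simp
      map_smul' := fun c z => by ext <;> simp } ‖f‖ (by
    intro z
    have key : ∀ w : Cplx V, ‖w‖ ^ 2 = ‖w.re‖ ^ 2 + ‖w.im‖ ^ 2 := by
      intro w
      rw [norm_sq_eq_re_inner (𝕜 := ℂ) w, ← real_inner_self_eq_norm_sq,
        ← real_inner_self_eq_norm_sq]
      rfl
    refine le_of_sq_le_sq ?_ (by positivity)
    rw [mul_pow, key, key]
    have h1 := pow_le_pow_left₀ (norm_nonneg _) (f.le_opNorm z.re) 2
    have h2 := pow_le_pow_left₀ (norm_nonneg _) (f.le_opNorm z.im) 2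
    rw [mul_pow] at h1 h2
    simp only [LinearMap.coe_mk, AddHom.coe_mk]
    linarith)

end Cplx

/-! ### The analytic generator and the deformed inner product -/

section OneParticle

variable {V : Type*} [NormedAddCommGroup V] [InnerProductSpace ℝ V]

/-- The infinitesimal generator `G = dU_t/dt` at `t = 0`, so that `U_t = exp (t G)`. -/
def infGenerator (U : ℝ → (V ≃ₗᵢ[ℝ] V)) : V →L[ℝ] V :=
  deriv (fun t : ℝ => ((U t).toContinuousLinearEquiv : V →L[ℝ] V)) 0

/-- The analytic generator `A` of `(U_t)`, i.e. the positive invertible operator on the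
complexification with `U_t = A ^ (i t)`: since `U_t = exp (t G)`, it is `A = exp (-i G)`. -/
def analyticGenerator (U : ℝ → (V ≃ₗᵢ[ℝ] V)) : Cplx V →L[ℂ] Cplx V :=
  NormedSpace.exp (-Complex.I • Cplx.mapCLM (infGenerator U))

/-- The deformed inner product `⟨ξ, ζ⟩_U = ⟨ξ, 2 (1 + A⁻¹)⁻¹ ζ⟩`. -/
def innerU (U : ℝ → (V ≃ₗᵢ[ℝ] V)) (ξ ζ : Cplx V) : ℂ :=
  inner ℂ ξ (((2 : ℂ) • Ring.inverse (1 + Ring.inverse (analyticGenerator U))) ζ)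

end OneParticle

/-- The data defining a mixed `q`-Araki-Woods algebra over the real Hilbert space `V`: a strongly
continuous one-parameter group of orthogonal operators, an orthogonal decomposition into invariant
subspaces, and the symmetric matrix of twists. -/
structure AWData (V : Type*) [NormedAddCommGroup V] [InnerProductSpace ℝ V] (N : Type*) where
  /-- the one-parameter group `U_t` -/
  U : ℝ → (V ≃ₗᵢ[ℝ] V)
  U_add : ∀ s t : ℝ, U (s + t) = U s * U t
  U_continuous : ∀ x : V, Continuous fun t : ℝ => U t x
  /-- the summands of the decomposition -/
  comp : N → Submodule ℝ V
  comp_invariant : ∀ (i : N) (t : ℝ), ∀ x ∈ comp i, U t x ∈ comp i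
  comp_orthogonal : ∀ i j : N, i ≠ j → ∀ x ∈ comp i, ∀ y ∈ comp j, inner ℝ x y = (0 : ℝ)
  comp_span : ⨆ i, comp i = ⊤
  /-- the twists `q(i, j)` -/
  q : N → N → ℝ
  q_symm : ∀ i j : N, q i j = q j i
  q_lt : ∀ i j : N, |q i j| < 1

variable {V : Type*} [NormedAddCommGroup V] [InnerProductSpace ℝ V] {N : Type*}

/-- An orthonormal basis `e_1, …, e_d` of `H_U` (the complexification with `⟨·,·⟩_U`), each member
`e_k` of which lies in the complexification of the summand of index `col k`. -/
structure AdaptedBasis (D : AWData V N) (d : ℕ) where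
  /-- the basis vectors -/
  e : Module.Basis (Fin d) ℂ (Cplx V)
  e_orthonormal : ∀ k l : Fin d, innerU D.U (e k) (e l) = if k = l then 1 else 0
  /-- the index of the summand that contains a basis vector -/
  col : Fin d → N
  e_mem : ∀ k : Fin d, (e k).re ∈ D.comp (col k) ∧ (e k).im ∈ D.comp (col k)

variable {D : AWData V N} {d : ℕ}

/-- The twist between two basis vectors, `q(i_k, i_l)` for `e_k ∈ H^(i_k)`, `e_l ∈ H^(i_l)`. -/
def AdaptedBasis.tw (E : AdaptedBasis D d) (k l : Fin d) : ℝ := D.q (E.col k) (E.col l)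

/-! ### The algebraic Fock space and its `T`-inner product -/

/-- The algebraic Fock space, spanned by the finite simple tensors: the tensor algebra of the
complexification. The vacuum vector is its unit. -/
abbrev FockAlg (V : Type*) [NormedAddCommGroup V] [InnerProductSpace ℝ V] : Type _ :=
  TensorAlgebra ℂ (Cplx V)

/-- The simple tensor `ξ_1 ⊗ ⋯ ⊗ ξ_n`; for `n = 0` it is the vacuum. -/
def simpleTensor {n : ℕ} (ξ : Fin n → Cplx V) : FockAlg V :=
  (List.ofFn fun t => TensorAlgebra.ι ℂ (ξ t)).prod

/-- The basis of the algebraic Fock space given by the simple tensors `e_w = e_{w 0} ⊗ e_{w 1} ⊗ ⋯`,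
indexed by the words `w` in the letters `1, …, d`. A word of length `n` is a map on `Fin n`, read
from left to right. -/
def wordBasis (E : AdaptedBasis D d) : Module.Basis (Σ n : ℕ, Fin n → Fin d) ℂ (FockAlg V) :=
  E.e.tensorAlgebra.reindex (FreeMonoid.toList.trans List.equivSigmaTuple)

theorem wordBasis_eq_simpleTensor (E : AdaptedBasis D d) (n : ℕ) (w : Fin n → Fin d) :
    wordBasis E ⟨n, w⟩ = simpleTensor fun t => E.e (w t) := by
  have h : ∀ l : List (Fin d), E.e.tensorAlgebra (FreeMonoid.ofList l) =
      (l.map fun k => TensorAlgebra.ι ℂ (E.e k)).prod := by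
    intro l
    have h1 : FreeAlgebra.basisFreeMonoid ℂ (Fin d) (FreeMonoid.ofList l) =
        (l.map (FreeAlgebra.ι ℂ)).prod := by
      rw [FreeAlgebra.basisFreeMonoid, Module.Basis.map_apply]
      change FreeAlgebra.equivMonoidAlgebraFreeMonoid.symm
        (MonoidAlgebra.of ℂ (FreeMonoid (Fin d)) (FreeMonoid.ofList l)) = _
      change MonoidAlgebra.lift ℂ _ _ (FreeMonoid.lift (FreeAlgebra.ι ℂ))
        (MonoidAlgebra.of ℂ (FreeMonoid (Fin d)) (FreeMonoid.ofList l)) = _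
      rw [MonoidAlgebra.lift_of, FreeMonoid.lift_apply]
      rfl
    rw [Module.Basis.tensorAlgebra, Module.Basis.map_apply, h1]
    change (TensorAlgebra.equivFreeAlgebra E.e).symm (l.map (FreeAlgebra.ι ℂ)).prod = _
    rw [map_list_prod, List.map_map]
    congr 1
    refine List.map_congr_left fun k _ => ?_
    simp
  rw [wordBasis, Module.Basis.reindex_apply]
  change E.e.tensorAlgebra (FreeMonoid.ofList (List.ofFn w)) = _
  rw [h, simpleTensor, List.map_ofFn]
  rfl

/-- The operator `T_{k+1} = I ⊗ ⋯ ⊗ I ⊗ T` (`k` identities), amplified to the tensors of length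
`n ≥ k + 2` and `0` on shorter ones. Since `T (ξ ⊗ η) = q(i, j) η ⊗ ξ` for `ξ` in the `i`-th and `η`
in the `j`-th summand, it interchanges the letters at the positions `k`, `k + 1` (counted from `0`)
of a word and multiplies by their twist. -/
def twist (E : AdaptedBasis D d) (k : ℕ) : Module.End ℂ (FockAlg V) :=
  (wordBasis E).constr ℂ fun w =>
    if h : k + 1 < w.1 then
      (E.tw (w.2 ⟨k, by omega⟩) (w.2 ⟨k + 1, h⟩) : ℂ) •
        wordBasis E ⟨w.1, w.2 ∘ Equiv.swap ⟨k, by omega⟩ ⟨k + 1, h⟩⟩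
    else 0

/-- The product of the twists of a word `w` over the inversions of a permutation `σ`. -/
def invWeight (E : AdaptedBasis D d) {n : ℕ} (σ : Equiv.Perm (Fin n)) (w : Fin n → Fin d) : ℝ :=
  ∏ p : Fin n × Fin n with p.1 < p.2 ∧ σ p.2 < σ p.1, E.tw (w p.1) (w p.2)

/-- The quasi-multiplicative map `Φ` on the symmetric group: `Φ σ` moves the letter at position `u`
to position `σ u`, and multiplies by the twists over the inversions of `σ`. -/
def phi (E : AdaptedBasis D d) {n : ℕ} (σ : Equiv.Perm (Fin n)) : Module.End ℂ (FockAlg V) :=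
  (wordBasis E).constr ℂ fun w =>
    if h : w.1 = n then
      (invWeight E σ (fun t => w.2 (Fin.cast h.symm t)) : ℂ) •
        wordBasis E ⟨n, fun t => w.2 (Fin.cast h.symm (σ.symm t))⟩
    else 0

theorem twist_word (E : AdaptedBasis D d) {n : ℕ} (k : ℕ) (h : k + 1 < n) (w : Fin n → Fin d) :
    twist E k (wordBasis E ⟨n, w⟩) = (E.tw (w ⟨k, by omega⟩) (w ⟨k + 1, h⟩) : ℂ) •
      wordBasis E ⟨n, w ∘ Equiv.swap ⟨k, by omega⟩ ⟨k + 1, h⟩⟩ := by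
  simp [twist, h]

theorem phi_word (E : AdaptedBasis D d) {n : ℕ} (σ : Equiv.Perm (Fin n)) (w : Fin n → Fin d) :
    phi E σ (wordBasis E ⟨n, w⟩) =
      (invWeight E σ w : ℂ) • wordBasis E ⟨n, fun t => w (σ.symm t)⟩ := by
  simp [phi]

theorem phi_word_of_ne (E : AdaptedBasis D d) {n m : ℕ} (σ : Equiv.Perm (Fin n)) (h : m ≠ n)
    (w : Fin m → Fin d) : phi E σ (wordBasis E ⟨m, w⟩) = 0 := by
  simp [phi, h]

/-- `Φ 1 = I`. -/
theorem phi_one (E : AdaptedBasis D d) {n : ℕ} (w : Fin n → Fin d) :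
    phi E (1 : Equiv.Perm (Fin n)) (wordBasis E ⟨n, w⟩) = wordBasis E ⟨n, w⟩ := by
  rw [phi_word]
  have : invWeight E (1 : Equiv.Perm (Fin n)) w = 1 := by
    refine Finset.prod_eq_one fun p hp => ?_
    have hp' := (Finset.mem_filter.mp hp).2
    exact absurd hp'.1 (not_lt.mpr (le_of_lt hp'.2))
  rw [this, Complex.ofReal_one, one_smul]
  rfl

/-- Quasi-multiplicativity: `Φ (τ_k σ) = T_k Φ σ` whenever `τ_k σ` is longer than `σ`. Together with
`Φ 1 = I` this determines `Φ`. -/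
theorem phi_swap_mul (E : AdaptedBasis D d) {n : ℕ} (σ : Equiv.Perm (Fin n)) (k : ℕ)
    (h : k + 1 < n) (hlen : σ.symm ⟨k, by omega⟩ < σ.symm ⟨k + 1, h⟩) (w : Fin n → Fin d) :
    phi E (Equiv.swap ⟨k, by omega⟩ ⟨k + 1, h⟩ * σ) (wordBasis E ⟨n, w⟩) =
      twist E k (phi E σ (wordBasis E ⟨n, w⟩)) := by
  set a : Fin n := ⟨k, by omega⟩ with ha
  set b : Fin n := ⟨k + 1, h⟩ with hb
  have hab : ∀ x y : Fin n, (Equiv.swap a b y < Equiv.swap a b x) ↔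
      ((y < x ∧ ¬ (y = a ∧ x = b)) ∨ (x = a ∧ y = b)) := by
    intro x y
    have h1 : (a : ℕ) = k := rfl
    have h2 : (b : ℕ) = k + 1 := rfl
    clear_value a b
    simp only [Equiv.swap_apply_def, Fin.lt_def, Fin.ext_iff]
    split_ifs <;> omega
  rw [phi_word, phi_word, map_smul, twist_word E k h, smul_smul, ← Complex.ofReal_mul]
  have hw : invWeight E (Equiv.swap a b * σ) w =
      invWeight E σ w * E.tw (w (σ.symm a)) (w (σ.symm b)) := by
    have hset : (Finset.univ.filter fun p : Fin n × Fin n =>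
        p.1 < p.2 ∧ (Equiv.swap a b * σ) p.2 < (Equiv.swap a b * σ) p.1) =
        insert (σ.symm a, σ.symm b)
          (Finset.univ.filter fun p : Fin n × Fin n => p.1 < p.2 ∧ σ p.2 < σ p.1) := by
      ext ⟨u, v⟩
      simp only [Finset.mem_filter, Finset.mem_univ, true_and, Finset.mem_insert, Prod.mk.injEq,
        Equiv.Perm.coe_mul, Function.comp_apply, hab, Equiv.eq_symm_apply]
      constructor
      · rintro ⟨h1, (⟨h2, h3⟩ | h2)⟩
        · exact Or.inr ⟨h1, h2⟩
        · exact Or.inl h2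
      · rintro (⟨h1, h2⟩ | ⟨h1, h2⟩)
        · refine ⟨?_, Or.inr ⟨h1, h2⟩⟩
          rw [← h1, ← h2] at hlen
          simpa using hlen
        · refine ⟨h1, Or.inl ⟨h2, ?_⟩⟩
          rintro ⟨h3, h4⟩
          rw [← h3, ← h4] at hlen
          simp only [Equiv.symm_apply_apply] at hlen
          exact absurd h1 (not_lt.mpr hlen.le)
    have hnot : (σ.symm a, σ.symm b) ∉
        (Finset.univ.filter fun p : Fin n × Fin n => p.1 < p.2 ∧ σ p.2 < σ p.1) := by
      simp only [Finset.mem_filter, Finset.mem_univ, true_and, Equiv.apply_symm_apply, not_and,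
        not_lt]
      intro _
      simp [ha, hb, Fin.le_def]
    rw [invWeight, invWeight, hset, Finset.prod_insert hnot, mul_comm]
  rw [hw]
  rfl

/-- The operator `P = ⨁ P^(n)`, where `P^(n) = ∑ Φ σ` over the permutations `σ` of `n` symbols. -/
def symmetrizer (E : AdaptedBasis D d) : Module.End ℂ (FockAlg V) :=
  (wordBasis E).constr ℂ fun w => ∑ σ : Equiv.Perm (Fin w.1), phi E σ (wordBasis E w)

/-- The undeformed inner product of the full Fock space over `H_U`, for which the tensors `e_w` are
orthonormal. -/
def freeInner (E : AdaptedBasis D d) (x y : FockAlg V) : ℂ :=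
  ((wordBasis E).repr x).sum fun w c => conj c * (wordBasis E).repr y w

/-- The `T`-inner product `⟨x, y⟩_T = ⟨x, P y⟩`. -/
def innerT (E : AdaptedBasis D d) (x y : FockAlg V) : ℂ := freeInner E x (symmetrizer E y)

/-! ### Positivity of the `T`-inner product -/

theorem tw_symm (E : AdaptedBasis D d) (k l : Fin d) : E.tw k l = E.tw l k := D.q_symm _ _

theorem repr_symmetrizer (E : AdaptedBasis D d) (y : FockAlg V) (n : ℕ) (w : Fin n → Fin d) :
    (wordBasis E).repr (symmetrizer E y) ⟨n, w⟩ = ∑ σ : Equiv.Perm (Fin n),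
      (invWeight E σ (fun t => w (σ t)) : ℂ) * (wordBasis E).repr y ⟨n, fun t => w (σ t)⟩ := by
  classical
  let f : FockAlg V →ₗ[ℂ] ℂ :=
    (Finsupp.lapply (⟨n, w⟩ : Σ n : ℕ, Fin n → Fin d)) ∘ₗ
      (wordBasis E).repr.toLinearMap ∘ₗ symmetrizer E
  let g : FockAlg V →ₗ[ℂ] ℂ := ∑ σ : Equiv.Perm (Fin n),
    (invWeight E σ (fun t => w (σ t)) : ℂ) •
      ((Finsupp.lapply (⟨n, fun t => w (σ t)⟩ : Σ n : ℕ, Fin n → Fin d)) ∘ₗ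
        (wordBasis E).repr.toLinearMap)
  have hfg : f = g := by
    refine (wordBasis E).ext ?_
    rintro ⟨m, v⟩
    simp only [f, g, LinearMap.comp_apply, LinearMap.sum_apply, LinearMap.smul_apply,
      LinearEquiv.coe_coe, Finsupp.lapply_apply, Module.Basis.repr_self, symmetrizer,
      Module.Basis.constr_basis, phi_word, map_sum, map_smul,
      smul_eq_mul, Finsupp.single_apply]
    by_cases hmn : m = n
    · subst hmn
      refine Finset.sum_congr rfl fun σ _ => ?_
      simp only [Sigma.mk.injEq, heq_eq_eq, true_and]
      by_cases hv : v = fun t => w (σ t)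
      · have : (fun t => v (σ.symm t)) = w := by subst hv; funext t; simp
        rw [if_pos this, if_pos hv, hv]
      · have : ¬ (fun t => v (σ.symm t)) = w := by
          rintro rfl; exact hv (by funext t; simp)
        rw [if_neg this, if_neg hv, mul_zero, mul_zero]
    · have h1 : ∀ (x : Fin m → Fin d) (y : Fin n → Fin d),
          ¬ ((⟨m, x⟩ : Σ n : ℕ, Fin n → Fin d) = ⟨n, y⟩) := by
        intro x y hxy
        exact hmn (Sigma.mk.inj_iff.mp hxy).1
      simp [h1]
  have := LinearMap.congr_fun hfg y
  simpa [f, g, LinearMap.sum_apply] using this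

/-- The product of the twists over the pairs of positions which are ordered differently by two
permutations. -/
def pairKernel (E : AdaptedBasis D d) {n : ℕ} (w : Fin n → Fin d) (τ ρ : Equiv.Perm (Fin n)) : ℝ :=
  ∏ p : Fin n × Fin n with p.1 < p.2,
    if (τ.symm p.1 < τ.symm p.2 ↔ ρ.symm p.1 < ρ.symm p.2) then 1 else E.tw (w p.1) (w p.2)

theorem invWeight_eq_pairKernel (E : AdaptedBasis D d) {n : ℕ} (w : Fin n → Fin d)
    (τ ρ : Equiv.Perm (Fin n)) :
    invWeight E (τ.symm * ρ) (fun t => w (ρ t)) = pairKernel E w τ ρ := by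
  rw [pairKernel, Finset.prod_ite, Finset.prod_const_one, one_mul, Finset.filter_filter, invWeight]
  refine Finset.prod_bij'
    (fun p _ => if ρ p.1 < ρ p.2 then (ρ p.1, ρ p.2) else (ρ p.2, ρ p.1))
    (fun p _ => if ρ.symm p.1 < ρ.symm p.2 then (ρ.symm p.1, ρ.symm p.2)
      else (ρ.symm p.2, ρ.symm p.1)) ?_ ?_ ?_ ?_ ?_
  · rintro ⟨u, v⟩ h
    replace h := (Finset.mem_filter.mp h).2
    refine Finset.mem_filter.mpr ⟨Finset.mem_univ _, ?_⟩
    simp only [Equiv.Perm.coe_mul, Function.comp_apply] at h ⊢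
    have hne : ρ u ≠ ρ v := fun e => h.1.ne (ρ.injective e)
    by_cases hc : ρ u < ρ v
    · simp [hc, h.1, h.2.le]
    · have hc' : ρ v < ρ u := lt_of_le_of_ne (not_lt.mp hc) hne.symm
      simp [hc, hc', h.1.le, h.2]
  · rintro ⟨a, b⟩ h
    replace h := (Finset.mem_filter.mp h).2
    refine Finset.mem_filter.mpr ⟨Finset.mem_univ _, ?_⟩
    simp only [Equiv.Perm.coe_mul, Function.comp_apply] at h ⊢
    have hne : ρ.symm a ≠ ρ.symm b := fun e => h.1.ne (ρ.symm.injective e)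
    have hne' : τ.symm a ≠ τ.symm b := fun e => h.1.ne (τ.symm.injective e)
    by_cases hc : ρ.symm a < ρ.symm b
    · simp only [hc, iff_true, not_lt] at h
      simpa [hc] using lt_of_le_of_ne h.2 hne'.symm
    · have hc' : ρ.symm b < ρ.symm a := lt_of_le_of_ne (not_lt.mp hc) hne.symm
      simp only [hc, iff_false, not_not] at h
      simpa [hc, hc'] using h.2
  · rintro ⟨u, v⟩ h
    replace h := (Finset.mem_filter.mp h).2
    simp only at h
    by_cases hc : ρ u < ρ v
    · simp [hc, h.1]
    · simp [hc, h.1.le]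
  · rintro ⟨a, b⟩ h
    replace h := (Finset.mem_filter.mp h).2
    simp only at h
    by_cases hc : ρ.symm a < ρ.symm b
    · simp [hc, h.1]
    · simp [hc, h.1.le]
  · rintro ⟨u, v⟩ h
    by_cases hc : ρ u < ρ v
    · simp [hc]
    · simp [hc, tw_symm E (w (ρ u))]

theorem pairKernel_symm (E : AdaptedBasis D d) {n : ℕ} (w : Fin n → Fin d)
    (τ ρ : Equiv.Perm (Fin n)) : pairKernel E w τ ρ = pairKernel E w ρ τ := by
  refine Finset.prod_congr rfl fun p _ => ?_
  simp only [Iff.comm]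

/-- A product of kernels of the form `[[1, q], [q, 1]]` with `|q| ≤ 1` is positive. -/
theorem kernel_nonneg {G ι : Type*} [Fintype G] (ε : ι → G → Prop) [∀ i g, Decidable (ε i g)]
    (q : ι → ℝ) (hq : ∀ i, |q i| ≤ 1) (S : Finset ι) : ∀ f : G → ℂ,
    0 ≤ (∑ τ, ∑ ρ, conj (f τ) * f ρ *
      ((∏ p ∈ S, if (ε p τ ↔ ε p ρ) then 1 else q p : ℝ) : ℂ)).re := by
  classical
  induction S using Finset.induction_on with
  | empty =>
    intro f
    simp only [Finset.prod_empty, Complex.ofReal_one, mul_one, ← Finset.mul_sum, ← Finset.sum_mul,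
      ← map_sum]
    rw [← Complex.normSq_eq_conj_mul_self, Complex.ofReal_re]
    exact Complex.normSq_nonneg _
  | insert i S hi ih =>
    intro f
    let s : G → ℝ := fun g => if ε i g then 1 else -1
    have hk : ∀ τ ρ, (if (ε i τ ↔ ε i ρ) then 1 else q i : ℝ) =
        (1 + q i) / 2 + (1 - q i) / 2 * (s τ * s ρ) := by
      intro τ ρ
      by_cases h1 : ε i τ <;> by_cases h2 : ε i ρ <;> simp [s, h1, h2] <;> ring
    have h1 := ih f
    have h2 := ih fun g => (s g : ℂ) * f g
    have hq' := abs_le.mp (hq i)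
    have hsum : (∑ τ, ∑ ρ, conj (f τ) * f ρ *
        ((∏ p ∈ insert i S, if (ε p τ ↔ ε p ρ) then 1 else q p : ℝ) : ℂ)) =
        (((1 + q i) / 2 : ℝ) : ℂ) * (∑ τ, ∑ ρ, conj (f τ) * f ρ *
          ((∏ p ∈ S, if (ε p τ ↔ ε p ρ) then 1 else q p : ℝ) : ℂ)) +
        (((1 - q i) / 2 : ℝ) : ℂ) * (∑ τ, ∑ ρ, conj ((s τ : ℂ) * f τ) * ((s ρ : ℂ) * f ρ) *
          ((∏ p ∈ S, if (ε p τ ↔ ε p ρ) then 1 else q p : ℝ) : ℂ)) := by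
      simp only [Finset.mul_sum, ← Finset.sum_add_distrib]
      refine Finset.sum_congr rfl fun τ _ => Finset.sum_congr rfl fun ρ _ => ?_
      rw [Finset.prod_insert hi, hk, map_mul, Complex.conj_ofReal]
      push_cast
      ring
    rw [hsum, Complex.add_re, Complex.re_ofReal_mul, Complex.re_ofReal_mul]
    have h3 : 0 ≤ (1 + q i) / 2 := by linarith
    have h4 : 0 ≤ (1 - q i) / 2 := by linarith
    exact add_nonneg (mul_nonneg h3 h1) (mul_nonneg h4 h2)

/-- The `T`-inner product on the words of length `n`, averaged over the rearrangements. -/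
theorem form_average (E : AdaptedBasis D d) {n : ℕ} (c c' : (Fin n → Fin d) → ℂ) :
    (n.factorial : ℂ) * ∑ w, conj (c w) * ∑ σ : Equiv.Perm (Fin n),
      (invWeight E σ (fun t => w (σ t)) : ℂ) * c' (fun t => w (σ t)) =
    ∑ w : Fin n → Fin d, ∑ τ : Equiv.Perm (Fin n), ∑ ρ : Equiv.Perm (Fin n),
      conj (c fun t => w (τ t)) * c' (fun t => w (ρ t)) * (pairKernel E w τ ρ : ℂ) := by
  rw [Finset.sum_comm]
  have : ∀ τ : Equiv.Perm (Fin n), ∑ w : Fin n → Fin d, ∑ ρ : Equiv.Perm (Fin n),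
      conj (c fun t => w (τ t)) * c' (fun t => w (ρ t)) * (pairKernel E w τ ρ : ℂ) =
      ∑ w, conj (c w) * ∑ σ : Equiv.Perm (Fin n),
        (invWeight E σ (fun t => w (σ t)) : ℂ) * c' (fun t => w (σ t)) := by
    intro τ
    refine Eq.symm ?_
    rw [← Equiv.sum_comp (Equiv.arrowCongr τ.symm (Equiv.refl (Fin d)))]
    refine Finset.sum_congr rfl fun w _ => ?_
    rw [Finset.mul_sum, ← Equiv.sum_comp (Equiv.mulLeft τ.symm)]
    refine Finset.sum_congr rfl fun ρ _ => ?_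
    have h1 : (fun t => (Equiv.arrowCongr τ.symm (Equiv.refl (Fin d))) w
        ((Equiv.mulLeft τ.symm ρ : Equiv.Perm (Fin n)) t)) = fun t => w (ρ t) := by
      funext t
      simp [Equiv.arrowCongr]
    have h2 : ((Equiv.arrowCongr τ.symm (Equiv.refl (Fin d))) w) = fun t => w (τ t) := by
      funext t
      simp [Equiv.arrowCongr]
    rw [h1, h2, Equiv.coe_mulLeft, invWeight_eq_pairKernel]
    ring
  simp only [this, Finset.sum_const, Finset.card_univ, Fintype.card_perm, Fintype.card_fin,
    nsmul_eq_mul]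

/-- The `T`-inner product in coordinates, sorted by the length of the words. -/
theorem innerT_eq_sum (E : AdaptedBasis D d) (x y : FockAlg V) (L : Finset ℕ)
    (hL : ∀ w ∈ ((wordBasis E).repr x).support, w.1 ∈ L) :
    innerT E x y = ∑ n ∈ L, ∑ w : Fin n → Fin d, conj ((wordBasis E).repr x ⟨n, w⟩) *
      ∑ σ : Equiv.Perm (Fin n), (invWeight E σ (fun t => w (σ t)) : ℂ) *
        (wordBasis E).repr y ⟨n, fun t => w (σ t)⟩ := by
  rw [innerT, freeInner, Finsupp.sum_of_support_subset (s := L.sigma fun n => Finset.univ) _ _ _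
    (by simp)]
  · rw [Finset.sum_sigma]
    simp only [repr_symmetrizer]
  · intro w hw
    simp [hL w hw]

theorem innerT_self_nonneg (E : AdaptedBasis D d) (x : FockAlg V) : 0 ≤ (innerT E x x).re := by
  classical
  rw [innerT_eq_sum E x x (((wordBasis E).repr x).support.image Sigma.fst)
    (fun w hw => Finset.mem_image_of_mem _ hw), Complex.re_sum]
  refine Finset.sum_nonneg fun n _ => ?_
  set z := ∑ w : Fin n → Fin d, conj ((wordBasis E).repr x ⟨n, w⟩) *
      ∑ σ : Equiv.Perm (Fin n), (invWeight E σ (fun t => w (σ t)) : ℂ) *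
        (wordBasis E).repr x ⟨n, fun t => w (σ t)⟩ with hz
  have h := form_average E (fun w => (wordBasis E).repr x ⟨n, w⟩)
    (fun w => (wordBasis E).repr x ⟨n, w⟩)
  rw [← hz] at h
  have hre : 0 ≤ ((n.factorial : ℂ) * z).re := by
    rw [h, Complex.re_sum]
    refine Finset.sum_nonneg fun w _ => ?_
    exact kernel_nonneg (fun (p : Fin n × Fin n) (τ : Equiv.Perm (Fin n)) =>
      τ.symm p.1 < τ.symm p.2) (fun p => E.tw (w p.1) (w p.2)) (fun p => (D.q_lt _ _).le) _ _
  rw [← Complex.ofReal_natCast, Complex.re_ofReal_mul] at hre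
  exact nonneg_of_mul_nonneg_right hre (by positivity)

theorem innerT_conj_symm (E : AdaptedBasis D d) (x y : FockAlg V) :
    conj (innerT E y x) = innerT E x y := by
  classical
  set L := (((wordBasis E).repr x).support ∪ ((wordBasis E).repr y).support).image Sigma.fst with hL
  rw [innerT_eq_sum E x y L (fun w hw => Finset.mem_image_of_mem _ (Finset.mem_union_left _ hw)),
    innerT_eq_sum E y x L (fun w hw => Finset.mem_image_of_mem _ (Finset.mem_union_right _ hw)),
    map_sum]
  refine Finset.sum_congr rfl fun n _ => ?_
  have h0 : (n.factorial : ℂ) ≠ 0 := by exact_mod_cast n.factorial_ne_zero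
  refine mul_left_cancel₀ h0 ?_
  have h1 := form_average E (fun w => (wordBasis E).repr x ⟨n, w⟩)
    (fun w => (wordBasis E).repr y ⟨n, w⟩)
  have h2 := form_average E (fun w => (wordBasis E).repr y ⟨n, w⟩)
    (fun w => (wordBasis E).repr x ⟨n, w⟩)
  rw [h1, ← Complex.conj_natCast, ← map_mul, h2, map_sum]
  refine Finset.sum_congr rfl fun w _ => ?_
  simp only [map_sum]
  rw [Finset.sum_comm]
  refine Finset.sum_congr rfl fun τ _ => Finset.sum_congr rfl fun ρ _ => ?_
  rw [map_mul, map_mul, Complex.conj_conj, Complex.conj_ofReal, pairKernel_symm E w ρ τ]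
  ring

theorem innerT_add_left (E : AdaptedBasis D d) (x y z : FockAlg V) :
    innerT E (x + y) z = innerT E x z + innerT E y z := by
  rw [innerT, innerT, innerT, freeInner, map_add, Finsupp.sum_add_index']
  · rfl
  · simp
  · intro w a b
    rw [map_add, add_mul]

theorem innerT_smul_left (E : AdaptedBasis D d) (x y : FockAlg V) (r : ℂ) :
    innerT E (r • x) y = conj r * innerT E x y := by
  rw [innerT, innerT, freeInner, map_smul, Finsupp.sum_smul_index (by simp), freeInner,
    Finsupp.mul_sum]
  refine Finsupp.sum_congr fun w _ => ?_
  rw [map_mul, mul_assoc]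

/-! ### The deformed Fock space -/

set_option linter.unusedVariables false in
/-- The algebraic Fock space, endowed with the `T`-inner product. -/
def PreFock (E : AdaptedBasis D d) : Type _ := FockAlg V

section PreFock

variable (E : AdaptedBasis D d)

/-- The additive group structure of the algebraic Fock space. -/
abbrev preFockGroup : AddCommGroup (PreFock E) := inferInstanceAs (AddCommGroup (FockAlg V))

attribute [local instance] preFockGroup

/-- The vector space structure of the algebraic Fock space. -/
abbrev preFockModule : Module ℂ (PreFock E) := inferInstanceAs (Module ℂ (FockAlg V))

attribute [local instance] preFockModule

/-- The `T`-inner product. -/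
abbrev preFockCore : PreInnerProductSpace.Core ℂ (PreFock E) where
  inner x y := innerT E x y
  conj_inner_symm x y := innerT_conj_symm E x y
  re_inner_nonneg x := innerT_self_nonneg E x
  add_left x y z := innerT_add_left E x y z
  smul_left x y r := innerT_smul_left E x y r

instance : SeminormedAddCommGroup (PreFock E) :=
  InnerProductSpace.Core.toSeminormedAddCommGroup (c := preFockCore E)

instance : InnerProductSpace ℂ (PreFock E) := InnerProductSpace.ofCore (preFockCore E)

end PreFock

/-- The `T`-deformed Fock space: the Hilbert space completion of the algebraic Fock space. -/
abbrev Fock (E : AdaptedBasis D d) : Type _ := UniformSpace.Completion (PreFock E)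

/-- The identity map onto the algebraic Fock space with the `T`-inner product. -/
def toPreFock (E : AdaptedBasis D d) : FockAlg V →ₗ[ℂ] PreFock E where
  toFun x := x
  map_add' _ _ := rfl
  map_smul' _ _ := rfl

/-- The canonical map of the algebraic Fock space into the deformed Fock space. -/
def emb (E : AdaptedBasis D d) : FockAlg V →ₗ[ℂ] Fock E :=
  UniformSpace.Completion.toComplₗᵢ.toLinearMap ∘ₗ toPreFock E

theorem inner_emb (E : AdaptedBasis D d) (x y : FockAlg V) :
    inner ℂ (emb E x) (emb E y) = innerT E x y :=
  UniformSpace.Completion.inner_coe (𝕜 := ℂ) (toPreFock E x) (toPreFock E y)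

theorem denseRange_emb (E : AdaptedBasis D d) : DenseRange (emb E) :=
  UniformSpace.Completion.denseRange_coe (α := PreFock E)

/-- The vacuum vector `Ω`. -/
def vac (E : AdaptedBasis D d) : Fock E := emb E 1

/-! ### Creation and annihilation operators -/

/-- The free left annihilation operator `l(ξ)` on the algebraic Fock space:
`l(ξ) Ω = 0` and `l(ξ) ξ_1 ⊗ ⋯ ⊗ ξ_n = ⟨ξ, ξ_1⟩_U ξ_2 ⊗ ⋯ ⊗ ξ_n`. -/
def freeAnn (E : AdaptedBasis D d) (ξ : Cplx V) : Module.End ℂ (FockAlg V) :=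
  (wordBasis E).constr ℂ fun w =>
    match w with
    | ⟨0, _⟩ => 0
    | ⟨n + 1, w⟩ => innerU D.U ξ (E.e (w 0)) • wordBasis E ⟨n, fun t => w t.succ⟩

/-- The left creation operator `a*(ξ)` on the algebraic Fock space, `x ↦ ξ ⊗ x`. -/
def creation (ξ : Cplx V) : Module.End ℂ (FockAlg V) :=
  LinearMap.mulLeft ℂ (TensorAlgebra.ι ℂ ξ)

/-- The product `T_1 T_2 ⋯ T_k`. -/
def twistProd (E : AdaptedBasis D d) (k : ℕ) : Module.End ℂ (FockAlg V) :=
  ((List.range k).map (twist E)).prod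

/-- The left annihilation operator `a(ξ)` on the algebraic Fock space, which on the tensors of
length `n` is `l(ξ) (1 + T_1 + T_1 T_2 + ⋯ + T_1 ⋯ T_{n-1})`. -/
def annihilation (E : AdaptedBasis D d) (ξ : Cplx V) : Module.End ℂ (FockAlg V) :=
  (wordBasis E).constr ℂ fun w =>
    freeAnn E ξ (∑ k ∈ Finset.range w.1, twistProd E k (wordBasis E w))

/-- `L` is the extension of the operator `f` on the algebraic Fock space to a bounded operator on
the deformed Fock space. There is at most one, the algebraic Fock space being dense. -/
def IsExtension (E : AdaptedBasis D d) (f : Module.End ℂ (FockAlg V))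
    (L : Fock E →L[ℂ] Fock E) : Prop :=
  ∀ x : FockAlg V, L (emb E x) = emb E (f x)

open Classical in
/-- The bounded extension of an operator on the algebraic Fock space, if there is one. -/
def extension (E : AdaptedBasis D d) (f : Module.End ℂ (FockAlg V)) : Fock E →L[ℂ] Fock E :=
  if h : ∃ L : Fock E →L[ℂ] Fock E, IsExtension E f L then h.choose else 0

/-! ### The von Neumann algebra -/

/-- The field operator `s(x) = a(x) + a*(x)` for a real vector `x`. -/
def field (E : AdaptedBasis D d) (x : V) : Fock E →L[ℂ] Fock E :=
  extension E (annihilation E (Cplx.ofReal x)) + extension E (creation (Cplx.ofReal x))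

/-- The von Neumann algebra generated by a set of operators: the double commutant of the set and its
adjoints. -/
def vonNeumannGenerated {H : Type*} [NormedAddCommGroup H] [InnerProductSpace ℂ H]
    [CompleteSpace H] (S : Set (H →L[ℂ] H)) : VonNeumannAlgebra H where
  toStarSubalgebra := StarSubalgebra.centralizer ℂ (StarSubalgebra.centralizer ℂ S : Set (H →L[ℂ] H))
  centralizer_centralizer' := by
    change Set.centralizer (Set.centralizer ((StarSubalgebra.centralizer ℂ
      (StarSubalgebra.centralizer ℂ S : Set (H →L[ℂ] H)) : StarSubalgebra ℂ (H →L[ℂ] H)) :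
        Set (H →L[ℂ] H))) = ((StarSubalgebra.centralizer ℂ
      (StarSubalgebra.centralizer ℂ S : Set (H →L[ℂ] H)) : StarSubalgebra ℂ (H →L[ℂ] H)) :
        Set (H →L[ℂ] H))
    rw [StarSubalgebra.coe_centralizer, Set.centralizer_centralizer_centralizer]

/-- The mixed `q`-Araki-Woods von Neumann algebra, generated by the field operators. -/
def awAlgebra (E : AdaptedBasis D d) : VonNeumannAlgebra (Fock E) :=
  vonNeumannGenerated (Set.range (field E))

open Classical in
/-- The Wick operator `W(ξ)`: the element of the von Neumann algebra with `W(ξ) Ω = ξ`, if there is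
one. -/
def wick (E : AdaptedBasis D d) (ξ : Fock E) : Fock E →L[ℂ] Fock E :=
  if h : ∃ X ∈ awAlgebra E, X (vac E) = ξ then h.choose else 0

theorem wick_mem (E : AdaptedBasis D d) (ξ : Fock E) : wick E ξ ∈ awAlgebra E := by
  unfold wick
  split_ifs with h
  · exact h.choose_spec.1
  · exact zero_mem _

/-- The vacuum state `φ(X) = ⟨Ω, X Ω⟩`. -/
def vacState (E : AdaptedBasis D d) : (Fock E →L[ℂ] Fock E) →ₗ[ℂ] ℂ where
  toFun X := inner ℂ (vac E) (X (vac E))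
  map_add' X Y := by simp [inner_add_right]
  map_smul' c X := by simp [inner_smul_right]

/-- The generators `A_k = W(e_k)`. -/
def gen (E : AdaptedBasis D d) (k : Fin d) : Fock E →L[ℂ] Fock E :=
  wick E (emb E (TensorAlgebra.ι ℂ (E.e k)))

/-! ### Dual systems and conjugate variables -/

/-- A normalized dual system for the generators: unbounded operators `D_k`, defined on the algebraic
Fock space, with `Ω` in the domains of their adjoints, `D_k Ω = 0`, and
`[D_k, A_l] = ⟨ē_l, e_k⟩_U P_Ω` on the algebraic Fock space. -/
structure IsDualSystem (E : AdaptedBasis D d) (S : Fin d → (Fock E →ₗ.[ℂ] Fock E)) : Prop where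
  dom : ∀ (k : Fin d) (x : FockAlg V), emb E x ∈ (S k).domain
  vac_mem_adjoint : ∀ k : Fin d, vac E ∈ (S k).adjoint.domain
  vac_eq_zero : ∀ k : Fin d, S k ⟨vac E, dom k 1⟩ = 0
  commutator : ∀ (k l : Fin d) (x : FockAlg V), ∃ h : gen E l (emb E x) ∈ (S k).domain,
    S k ⟨gen E l (emb E x), h⟩ - gen E l (S k ⟨emb E x, dom k x⟩) =
      innerU D.U (E.e l).bar (E.e k) • inner ℂ (vac E) (emb E x) • vac E

/-- The unital `*`-algebra generated by the `A_k`. -/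
def polyAlg (E : AdaptedBasis D d) : StarSubalgebra ℂ (Fock E →L[ℂ] Fock E) :=
  StarAlgebra.adjoin ℂ (Set.range (gen E))

/-- The underlying `*`-algebra of the mixed `q`-Araki-Woods von Neumann algebra. -/
abbrev awStar (E : AdaptedBasis D d) : StarSubalgebra ℂ (Fock E →L[ℂ] Fock E) :=
  (awAlgebra E).toStarSubalgebra

theorem polyAlg_le (E : AdaptedBasis D d) : polyAlg E ≤ awStar E := by
  refine StarAlgebra.adjoin_le ?_
  rintro _ ⟨k, rfl⟩
  exact wick_mem E _

/-- The algebraic tensor product of the von Neumann algebra with its opposite. -/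
abbrev awTensor (E : AdaptedBasis D d) : Type _ := awStar E ⊗[ℂ] (awStar E)ᵐᵒᵖ

/-- `δ` is the `k`-th quasi-free difference quotient: the derivation on the algebra of the `A_l` with
`δ(A_l) = φ(A_l A_k) 1 ⊗ 1`, where `a` acts from the left as `a ⊗ 1` and `b` acts from the right as
`1 ⊗ b^op`. -/
structure IsDifferenceQuotient (E : AdaptedBasis D d) (k : Fin d)
    (δ : polyAlg E →ₗ[ℂ] awTensor E) : Prop where
  leibniz : ∀ a b : polyAlg E, δ (a * b) =
    (StarSubalgebra.inclusion (polyAlg_le E) a ⊗ₜ[ℂ] 1) * δ b +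
      (1 ⊗ₜ[ℂ] MulOpposite.op (StarSubalgebra.inclusion (polyAlg_le E) b)) * δ a
  apply_gen : ∀ (l : Fin d) (h : gen E l ∈ polyAlg E),
    δ ⟨gen E l, h⟩ = vacState E (gen E l * gen E k) • (1 ⊗ₜ[ℂ] 1)

/-- The functional `⟨1 ⊗ 1, y (1 ⊗ 1)⟩ = (φ ⊗ φ^op)(y)`. -/
def tensorState (E : AdaptedBasis D d) : awTensor E →ₗ[ℂ] ℂ :=
  LinearMap.mul' ℂ ℂ ∘ₗ TensorProduct.map
    (vacState E ∘ₗ (awStar E).subtype.toLinearMap)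
    (vacState E ∘ₗ (awStar E).subtype.toLinearMap ∘ₗ
      (MulOpposite.opLinearEquiv ℂ).symm.toLinearMap)

/-- `ξ` is the conjugate variable of index `k`: `⟨ξ, x Ω⟩ = ⟨1 ⊗ 1, ∂_k(x) (1 ⊗ 1)⟩` for all `x` in
the algebra of the `A_l`. -/
def IsConjugateVariable (E : AdaptedBasis D d) (k : Fin d) (ξ : Fock E) : Prop :=
  ∃ δ : polyAlg E →ₗ[ℂ] awTensor E, IsDifferenceQuotient E k δ ∧
    ∀ x : polyAlg E, inner ℂ ξ ((x : Fock E →L[ℂ] Fock E) (vac E)) = tensorState E (δ x)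

/-! ### The explicit vectors -/

/-- The bounded operator `l(e_k)` on the deformed Fock space. -/
def freeAnnOp (E : AdaptedBasis D d) (k : Fin d) : Fock E →L[ℂ] Fock E :=
  extension E (freeAnn E (E.e k))

/-- `L_{wβ} = l(e_β) l(e_{w (n-1)}) ⋯ l(e_{w 0})` for a word `w` of length `n`, read from left to
right. -/
def annWord (E : AdaptedBasis D d) {n : ℕ} (w : Fin n → Fin d) (β : Fin d) :
    Fock E →L[ℂ] Fock E :=
  freeAnnOp E β * (List.ofFn fun t => freeAnnOp E (w t)).reverse.prod

/-- The vector `ē_w = ē_{w 0} ⊗ ē_{w 1} ⊗ ⋯`. -/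
def barWord (E : AdaptedBasis D d) {n : ℕ} (w : Fin n → Fin d) : Fock E :=
  emb E (simpleTensor fun t => (E.e (w t)).bar)

/-- The vector `ξ_{m, α}` for `m = n + 1`, a sum over the letters `β` and the words `w` of length
`m - 1 = n`. -/
def xiTerm (E : AdaptedBasis D d) (n : ℕ) (α : Fin d) : Fock E :=
  ∑ β : Fin d, ∑ w : Fin n → Fin d,
    (((∏ p : Fin n × Fin n with p.1 < p.2, E.tw (w p.1) (w p.2)) * ∏ t, E.tw α (w t) : ℝ) : ℂ) •
      innerU D.U (E.e α) (E.e β).bar • ContinuousLinearMap.adjoint (annWord E w β) (barWord E w)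

end MixedArakiWoods

end

/-!
# Dual systems and conjugate variables of mixed `q`-Araki-Woods algebras

Write `a_k`, `a_k^*` for annihilation and creation by `e_k`, and `A_l = a_l^* + a(ē_l)`.

*Boundedness.* The vectors `x` of degree `n` satisfy `∑_k ‖l(e_k) x‖² = ⟨x, R⁻¹ x⟩_T` for the
operator `R = ∑_k e_k ⊗ a_k(·)` (`cyc`). The factorisation `R (1 - γ) = (1 - T_1 γ) (R ⊗ 1)` with a
twisted cyclic shift `γ` (`cyc_sub_shift`) bounds `R⁻¹`, uniformly in the degree, in the `ℓ¹`-norm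
of the coefficients with respect to the words; since `k ↦ ‖R^{-k} x‖_T` is log-convex, the bound
passes to the `T`-norm (`exists_cyc_eq_norm`). Hence the operators `l(ξ)` are bounded, and `l(e_k)^*`
maps a tensor of degree `n` to one of degree `n + 1`, with control of the `ℓ¹`-norm
(`exists_adjoint_freeAnnOp`). The creation operators are bounded by the relation
`a_k a_j^* = δ_{jk} + q a_j^* a_k`.

*Wick operators.* The right-handed analogues of the `A_l` commute with the `A_l`
(`fieldAlg_rightAlg`), so that `Ω` separates the von Neumann algebra (`eq_of_vac`), while
`W(e_k ⊗ x) = A_k W(x) - W(a(ē_k) x)` constructs Wick operators, with `‖W(x)‖ ≤ K^n ‖x‖₁` in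
degree `n` (`exists_norm_wick_le`).

*The dual operators.* The commutation relations determine a normalized dual system on the algebraic
Fock space, as the `A_l` generate it from `Ω` (`field_induction`, `IsDualSystem.apply_emb`). The
explicit `D_α` is a signed sum, over the factorisations `x' ⊗ e_β ⊗ x''` of a tensor, of weighted
contractions of `x''` against `x'` (`dualTwo`); the commutation relation follows from the identity
`contr_pairDiag_cre` for the contractions. The vacuum coefficient of `D_α x` only sees the full
contractions, which are inner products with the vectors `ē_w`, and this turns it into
`∑_n (-1)^n ⟨ξ_{n+1,α}, x⟩` (`inner_eq_vacCoeff_dual`).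

*Convergence.* The scalar coefficients of `ξ_{n+1,α}` are products of `n (n + 1) / 2` twists, so
that `‖ξ_{n+1,α}‖₁` decays faster than any geometric sequence (`exists_xiTerm_bound`), in particular
against the growth `K^(2n+1)` of the norms of the Wick operators (`exists_hasSum_wick`).

*Conjugate variables.* The `A_k` are algebraically free (`polyHom_injective`), so the difference
quotient exists, and applying `a ⊗ b^op ↦ φ(b) a Ω` to it gives a map with the recursion that
defines the dual operators (`rightContract_diffQuot`). Therefore `⟨ξ_α, p(A) Ω⟩ = ⟨Ω, D_α p(A) Ω⟩`
is `(φ ⊗ φ^op)(∂_α p(A))`.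
-/

noncomputable section

namespace MixedArakiWoods

variable {V : Type*} [NormedAddCommGroup V] [InnerProductSpace ℝ V] {N : Type*} {D : AWData V N}
  {d : ℕ}

/-! ### Words, creation and annihilation on the algebraic Fock space -/

/-- The basis `e_w` of the algebraic Fock space, with the words `w` given as lists of letters. -/
def wordVec (E : AdaptedBasis D d) : Module.Basis (List (Fin d)) ℂ (FockAlg V) :=
  (wordBasis E).reindex List.equivSigmaTuple.symm

/-- The twist of two letters, as a complex scalar. -/
def twc (E : AdaptedBasis D d) (k l : Fin d) : ℂ := (E.tw k l : ℂ)

theorem twc_symm (E : AdaptedBasis D d) (k l : Fin d) : twc E k l = twc E l k := by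
  rw [twc, tw_symm]; rfl

@[simp] theorem conj_twc (E : AdaptedBasis D d) (k l : Fin d) : conj (twc E k l) = twc E k l :=
  Complex.conj_ofReal _

/-- The creation operator `a*(e_k)`. -/
def cre (E : AdaptedBasis D d) (k : Fin d) : Module.End ℂ (FockAlg V) := creation (E.e k)

/-- The annihilation operator `a(e_k)`. -/
def ann (E : AdaptedBasis D d) (k : Fin d) : Module.End ℂ (FockAlg V) := annihilation E (E.e k)

/-- The free annihilation operator `l(e_k)`. -/
def strip (E : AdaptedBasis D d) (k : Fin d) : Module.End ℂ (FockAlg V) := freeAnn E (E.e k)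

theorem cre_apply (E : AdaptedBasis D d) (k : Fin d) (x : FockAlg V) :
    cre E k x = TensorAlgebra.ι ℂ (E.e k) * x := rfl

theorem wordBasis_zero (E : AdaptedBasis D d) (w : Fin 0 → Fin d) :
    wordBasis E ⟨0, w⟩ = 1 := by
  rw [wordBasis_eq_simpleTensor]; simp [simpleTensor]

theorem wordBasis_succ (E : AdaptedBasis D d) {n : ℕ} (w : Fin (n + 1) → Fin d) :
    wordBasis E ⟨n + 1, w⟩ = cre E (w 0) (wordBasis E ⟨n, fun t => w t.succ⟩) := by
  rw [wordBasis_eq_simpleTensor, wordBasis_eq_simpleTensor, simpleTensor, List.ofFn_succ,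
    List.prod_cons]
  rfl

theorem wordVec_ofFn (E : AdaptedBasis D d) {n : ℕ} (w : Fin n → Fin d) :
    wordVec E (List.ofFn w) = wordBasis E ⟨n, w⟩ := by
  rw [wordVec, Module.Basis.reindex_apply]
  congr 1
  exact List.equivSigmaTuple.apply_symm_apply (⟨n, w⟩ : Σ n, Fin n → Fin d)

@[simp] theorem wordVec_nil (E : AdaptedBasis D d) : wordVec E [] = 1 := by
  have := wordVec_ofFn E (Fin.elim0 : Fin 0 → Fin d)
  rwa [wordBasis_zero] at this

theorem wordVec_cons (E : AdaptedBasis D d) (k : Fin d) (l : List (Fin d)) :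
    wordVec E (k :: l) = cre E k (wordVec E l) := by
  have h1 := wordVec_ofFn E (k :: l).get
  have h2 := wordVec_ofFn E l.get
  rw [List.ofFn_get] at h1 h2
  rw [h1, h2]
  exact wordBasis_succ E _

theorem wordVec_append (E : AdaptedBasis D d) (l l' : List (Fin d)) :
    wordVec E (l ++ l') = wordVec E l * wordVec E l' := by
  induction l with
  | nil => simp
  | cons k l ih => rw [List.cons_append, wordVec_cons, wordVec_cons, ih, cre_apply, cre_apply,
      mul_assoc]

/-- Linear maps on the algebraic Fock space agree if they do so on the vacuum and the agreement is
inherited by `e_k ⊗ x` from `x`. -/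
theorem ext_cre (E : AdaptedBasis D d) {M : Type*} [AddCommGroup M] [Module ℂ M]
    {f g : FockAlg V →ₗ[ℂ] M} (h1 : f 1 = g 1)
    (h : ∀ k x, f x = g x → f (cre E k x) = g (cre E k x)) (x : FockAlg V) : f x = g x := by
  have : f = g := by
    refine (wordVec E).ext fun l => ?_
    induction l with
    | nil => simpa using h1
    | cons k l ih => rw [wordVec_cons]; exact h k _ ih
  rw [this]

theorem freeAnn_one (E : AdaptedBasis D d) (ξ : Cplx V) : freeAnn E ξ 1 = 0 := by
  rw [← wordBasis_zero E Fin.elim0, freeAnn, Module.Basis.constr_basis]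

theorem freeAnn_cre (E : AdaptedBasis D d) (ξ : Cplx V) (k : Fin d) (x : FockAlg V) :
    freeAnn E ξ (cre E k x) = innerU D.U ξ (E.e k) • x := by
  have : freeAnn E ξ ∘ₗ cre E k = innerU D.U ξ (E.e k) • LinearMap.id := by
    refine (wordBasis E).ext ?_
    rintro ⟨n, w⟩
    have := wordBasis_succ E (Fin.cons k w : Fin (n + 1) → Fin d)
    simp only [Fin.cons_zero, Fin.cons_succ] at this
    rw [LinearMap.comp_apply, ← this, freeAnn, Module.Basis.constr_basis]
    simp
  exact LinearMap.congr_fun this x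

@[simp] theorem strip_one (E : AdaptedBasis D d) (k : Fin d) : strip E k 1 = 0 := freeAnn_one E _

theorem strip_cre (E : AdaptedBasis D d) (j k : Fin d) (x : FockAlg V) :
    strip E j (cre E k x) = if j = k then x else 0 := by
  rw [strip, freeAnn_cre, E.e_orthonormal]
  split_ifs <;> simp

theorem freeAnn_eq_sum (E : AdaptedBasis D d) (ξ : Cplx V) :
    freeAnn E ξ = ∑ k, innerU D.U ξ (E.e k) • strip E k := by
  refine LinearMap.ext fun x => ext_cre E ?_ (fun k x _ => ?_) x
  · simp [freeAnn_one]
  · simp [freeAnn_cre, strip_cre, LinearMap.sum_apply]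

theorem creation_eq_sum (E : AdaptedBasis D d) (ξ : Cplx V) :
    creation ξ = ∑ k, E.e.repr ξ k • cre E k := by
  refine LinearMap.ext fun x => ?_
  rw [LinearMap.sum_apply]
  conv_lhs => rw [← E.e.sum_repr ξ]
  rw [creation, map_sum, LinearMap.mulLeft_apply, Finset.sum_mul]
  simp [cre, creation]

theorem twist_succ_cre (E : AdaptedBasis D d) (k : ℕ) (j : Fin d) (x : FockAlg V) :
    twist E (k + 1) (cre E j x) = cre E j (twist E k x) := by
  have : twist E (k + 1) ∘ₗ cre E j = cre E j ∘ₗ twist E k := by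
    refine (wordBasis E).ext ?_
    rintro ⟨n, w⟩
    have hc := fun w' => wordBasis_succ E (Fin.cons j w' : Fin (n + 1) → Fin d)
    simp only [Fin.cons_zero, Fin.cons_succ] at hc
    rw [LinearMap.comp_apply, LinearMap.comp_apply, ← hc]
    by_cases h : k + 1 < n
    · rw [twist_word E (k + 1) (by omega), twist_word E k h, map_smul, ← hc]
      congr 2
      congr 1
      funext t
      refine Fin.cases ?_ (fun t => ?_) t
      · simp only [Function.comp_apply]
        rw [Equiv.swap_apply_of_ne_of_ne]
        · rfl
        · simp [Fin.ext_iff]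
        · simp [Fin.ext_iff]
      · simp only [Function.comp_apply, Fin.cons_succ]
        have : Equiv.swap (⟨k + 1, by omega⟩ : Fin (n + 1)) ⟨k + 1 + 1, by omega⟩ t.succ =
            (Equiv.swap (⟨k, by omega⟩ : Fin n) ⟨k + 1, h⟩ t).succ := by
          simp only [Equiv.swap_apply_def, Fin.ext_iff]
          split_ifs <;> simp_all
        rw [this, Fin.cons_succ]
    · have h' : ¬ (k + 1 + 1 < n + 1) := by omega
      simp [twist, h, h']
  exact LinearMap.congr_fun this x

theorem twist_zero_one (E : AdaptedBasis D d) : twist E 0 1 = 0 := by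
  rw [← wordBasis_zero E Fin.elim0]; simp [twist]

theorem twist_zero_cre_one (E : AdaptedBasis D d) (j : Fin d) : twist E 0 (cre E j 1) = 0 := by
  rw [← wordVec_nil, ← wordVec_cons]
  have := wordVec_ofFn E (![j] : Fin 1 → Fin d)
  simp at this
  rw [this]
  simp [twist]

theorem twist_zero_cre_cre (E : AdaptedBasis D d) (j c : Fin d) (x : FockAlg V) :
    twist E 0 (cre E j (cre E c x)) = twc E j c • cre E c (cre E j x) := by
  have : twist E 0 ∘ₗ cre E j ∘ₗ cre E c = twc E j c • cre E c ∘ₗ cre E j := by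
    refine (wordBasis E).ext ?_
    rintro ⟨n, w⟩
    have h1 := fun j c => wordBasis_succ E (Fin.cons j (Fin.cons c w) : Fin (n + 2) → Fin d)
    have h2 := fun c => wordBasis_succ E (Fin.cons c w : Fin (n + 1) → Fin d)
    simp only [Fin.cons_zero, Fin.cons_succ] at h1 h2
    simp only [LinearMap.comp_apply, LinearMap.smul_apply]
    rw [← h2, ← h1, twist_word E 0 (by omega), ← h2, ← h1]
    congr 2
    congr 1
    funext t
    refine Fin.cases ?_ (fun t => ?_) t
    · simp
    · refine Fin.cases ?_ (fun t => ?_) t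
      · have : (1 : Fin (n + 2)) = Fin.succ 0 := rfl
        simp
      · simp only [Function.comp_apply, Fin.cons_succ]
        rw [Equiv.swap_apply_of_ne_of_ne]
        · rfl
        · simp [Fin.ext_iff]
        · simp [Fin.ext_iff]
  exact LinearMap.congr_fun this x

theorem strip_twist_cre (E : AdaptedBasis D d) (k j : Fin d) (x : FockAlg V) :
    strip E k (twist E 0 (cre E j x)) = twc E k j • cre E j (strip E k x) := by
  refine ext_cre E (f := strip E k ∘ₗ twist E 0 ∘ₗ cre E j)
    (g := twc E k j • cre E j ∘ₗ strip E k) ?_ (fun c x _ => ?_) x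
  · simp [twist_zero_cre_one]
  · simp only [LinearMap.comp_apply, LinearMap.smul_apply, twist_zero_cre_cre, map_smul, strip_cre]
    split_ifs with h
    · subst h; rw [twc_symm]
    · simp

theorem twistProd_succ_cre (E : AdaptedBasis D d) (k : ℕ) (j : Fin d) (x : FockAlg V) :
    twistProd E (k + 1) (cre E j x) = twist E 0 (cre E j (twistProd E k x)) := by
  have h : ∀ (L : List ℕ) (x : FockAlg V), ((L.map Nat.succ).map (twist E)).prod (cre E j x) =
      cre E j ((L.map (twist E)).prod x) := by
    intro L
    induction L with
    | nil => simp
    | cons a L ih => intro x; simp only [List.map_cons, List.prod_cons, Module.End.mul_apply, ih,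
        Nat.succ_eq_add_one, twist_succ_cre]
  rw [twistProd, List.range_succ_eq_map, List.map_cons, List.prod_cons, Module.End.mul_apply, h]
  rfl

theorem annihilation_one (E : AdaptedBasis D d) (ξ : Cplx V) : annihilation E ξ 1 = 0 := by
  rw [← wordBasis_zero E Fin.elim0, annihilation, Module.Basis.constr_basis]
  simp

theorem annihilation_eq_sum (E : AdaptedBasis D d) (ξ : Cplx V) :
    annihilation E ξ = ∑ k, innerU D.U ξ (E.e k) • ann E k := by
  refine (wordBasis E).ext fun w => ?_
  rw [annihilation, Module.Basis.constr_basis, freeAnn_eq_sum]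
  simp only [LinearMap.sum_apply, LinearMap.smul_apply, ann, annihilation, strip,
    Module.Basis.constr_basis]

@[simp] theorem ann_one (E : AdaptedBasis D d) (k : Fin d) : ann E k 1 = 0 :=
  annihilation_one E _

/-- The commutation relation `a(e_k) a*(e_j) = δ + q(i_k, i_j) a*(e_j) a(e_k)`. -/
theorem ann_cre (E : AdaptedBasis D d) (k j : Fin d) (x : FockAlg V) :
    ann E k (cre E j x) =
      (if k = j then x else 0) + twc E k j • cre E j (ann E k x) := by
  have : ann E k ∘ₗ cre E j = (if k = j then (1 : ℂ) else 0) • LinearMap.id +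
      twc E k j • cre E j ∘ₗ ann E k := by
    refine (wordBasis E).ext ?_
    rintro ⟨n, w⟩
    have hc := wordBasis_succ E (Fin.cons j w : Fin (n + 1) → Fin d)
    simp only [Fin.cons_zero, Fin.cons_succ] at hc
    have h0 : annihilation E (E.e k) (wordBasis E ⟨n, w⟩) =
      strip E k (∑ m ∈ Finset.range n, twistProd E m (wordBasis E ⟨n, w⟩)) := by
        simp [annihilation, strip]
    rw [LinearMap.comp_apply, ← hc]
    conv_lhs => rw [ann, annihilation, Module.Basis.constr_basis]
    simp only [LinearMap.add_apply, LinearMap.comp_apply, LinearMap.smul_apply, ann, h0]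
    rw [Finset.sum_range_succ', hc, map_add, add_comm]
    congr 1
    · rw [twistProd, List.range_zero, List.map_nil, List.prod_nil, Module.End.one_apply]
      exact (strip_cre E k j _).trans (by simp)
    · simp only [twistProd_succ_cre]
      simp only [map_sum, Finset.smul_sum]
      exact Finset.sum_congr rfl fun m _ => strip_twist_cre E k j _
  have h := LinearMap.congr_fun this x
  simp only [LinearMap.comp_apply, LinearMap.add_apply, LinearMap.smul_apply,
    LinearMap.id_apply] at h
  rw [h]
  split_ifs <;> simp

/-- The coefficient of the vacuum. -/
def vacCoeff (E : AdaptedBasis D d) : FockAlg V →ₗ[ℂ] ℂ := (wordVec E).coord []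

@[simp] theorem vacCoeff_one (E : AdaptedBasis D d) : vacCoeff E 1 = 1 := by
  rw [← wordVec_nil E, vacCoeff, Module.Basis.coord_apply, Module.Basis.repr_self]
  simp

@[simp] theorem vacCoeff_cre (E : AdaptedBasis D d) (k : Fin d) (x : FockAlg V) :
    vacCoeff E (cre E k x) = 0 := by
  refine LinearMap.congr_fun (f := vacCoeff E ∘ₗ cre E k) (g := 0) ?_ x
  refine (wordVec E).ext fun l => ?_
  rw [LinearMap.comp_apply, ← wordVec_cons, vacCoeff, Module.Basis.coord_apply,
    Module.Basis.repr_self]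
  simp

/-- `x = x_∅ Ω + ∑ e_k ⊗ l(e_k) x`. -/
theorem eq_sum_cre_strip (E : AdaptedBasis D d) (x : FockAlg V) :
    x = vacCoeff E x • 1 + ∑ k, cre E k (strip E k x) := by
  have key := ext_cre E (f := LinearMap.id) (g := LinearMap.smulRight (vacCoeff E) 1 +
    ∑ k, cre E k ∘ₗ strip E k) ?_ (fun k x _ => ?_) x
  · simpa [LinearMap.sum_apply] using key
  · simp [LinearMap.sum_apply]
  · simp [LinearMap.sum_apply, strip_cre, apply_ite]

theorem fock_induction (E : AdaptedBasis D d) {p : FockAlg V → Prop} (one : p 1)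
    (cre : ∀ k x, p x → p (cre E k x)) (add : ∀ x y, p x → p y → p (x + y))
    (smul : ∀ (c : ℂ) x, p x → p (c • x)) (x : FockAlg V) : p x := by
  have hw : ∀ l, p (wordVec E l) := by
    intro l
    induction l with
    | nil => simpa using one
    | cons k l ih => rw [wordVec_cons]; exact cre k _ ih
  have hx : x ∈ Submodule.span ℂ (Set.range (wordVec E)) := by
    rw [(wordVec E).span_eq]; trivial
  induction hx using Submodule.span_induction with
  | mem y hy => obtain ⟨l, rfl⟩ := hy; exact hw l
  | zero => simpa using smul 0 1 one
  | add y z _ _ hy hz => exact add y z hy hz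
  | smul c y _ hy => exact smul c y hy

theorem ann_eq_strip_add (E : AdaptedBasis D d) (k : Fin d) (x : FockAlg V) :
    ann E k x = strip E k x + ∑ j, twc E k j • cre E j (ann E k (strip E j x)) := by
  conv_lhs => rw [eq_sum_cre_strip E x]
  simp only [map_add, map_smul, ann_one, smul_zero, zero_add, map_sum, ann_cre,
    Finset.sum_add_distrib]
  simp

/-! ### Adjointness of creation and annihilation -/

theorem repr_cre (E : AdaptedBasis D d) (j : Fin d) (x : FockAlg V) {n : ℕ}
    (v : Fin (n + 1) → Fin d) :
    (wordBasis E).repr (cre E j x) ⟨n + 1, v⟩ =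
      if v 0 = j then (wordBasis E).repr x ⟨n, fun t => v t.succ⟩ else 0 := by
  refine LinearMap.congr_fun (f := (wordBasis E).coord ⟨n + 1, v⟩ ∘ₗ cre E j)
    (g := if v 0 = j then (wordBasis E).coord ⟨n, fun t => v t.succ⟩ else 0) ?_ x |>.trans ?_
  · refine (wordBasis E).ext ?_
    rintro ⟨m, w⟩
    have hc := wordBasis_succ E (Fin.cons j w : Fin (m + 1) → Fin d)
    simp only [Fin.cons_zero, Fin.cons_succ] at hc
    rw [LinearMap.comp_apply, ← hc, Module.Basis.coord_apply, Module.Basis.repr_self,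
      Finsupp.single_apply]
    by_cases hj : v 0 = j
    · rw [if_pos hj, Module.Basis.coord_apply, Module.Basis.repr_self, Finsupp.single_apply]
      congr 1
      simp only [Sigma.mk.injEq, eq_iff_iff, Nat.add_right_cancel_iff]
      refine and_congr_right fun hmn => ?_
      subst hmn
      rw [heq_eq_eq, heq_eq_eq]
      constructor
      · rintro rfl; simp
      · rintro rfl
        funext t
        refine Fin.cases ?_ (fun t => ?_) t <;> simp [hj]
    · rw [if_neg hj, if_neg]
      · rfl
      · intro h
        obtain ⟨hmn, h⟩ := Sigma.mk.inj_iff.mp h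
        obtain rfl : m = n := by omega
        rw [heq_eq_eq] at h
        exact hj (by rw [← h]; simp)
  · split_ifs <;> rfl

theorem repr_cre_zero (E : AdaptedBasis D d) (j : Fin d) (x : FockAlg V) (v : Fin 0 → Fin d) :
    (wordBasis E).repr (cre E j x) ⟨0, v⟩ = 0 := by
  refine LinearMap.congr_fun (f := (wordBasis E).coord ⟨0, v⟩ ∘ₗ cre E j) (g := 0) ?_ x
  refine (wordBasis E).ext ?_
  rintro ⟨m, w⟩
  have hc := wordBasis_succ E (Fin.cons j w : Fin (m + 1) → Fin d)
  simp only [Fin.cons_zero, Fin.cons_succ] at hc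
  rw [LinearMap.comp_apply, ← hc, Module.Basis.coord_apply, Module.Basis.repr_self,
    Finsupp.single_apply, if_neg]
  · rfl
  · intro h
    have := (Sigma.mk.inj_iff.mp h).1
    omega

theorem repr_strip (E : AdaptedBasis D d) (k : Fin d) (x : FockAlg V) {n : ℕ}
    (v : Fin n → Fin d) :
    (wordBasis E).repr (strip E k x) ⟨n, v⟩ = (wordBasis E).repr x ⟨n + 1, Fin.cons k v⟩ := by
  refine ext_cre E (f := (wordBasis E).coord ⟨n, v⟩ ∘ₗ strip E k)
    (g := (wordBasis E).coord ⟨n + 1, Fin.cons k v⟩) ?_ (fun j x _ => ?_) x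
  · rw [← wordBasis_zero E Fin.elim0, Module.Basis.coord_apply, Module.Basis.repr_self,
      wordBasis_zero, Finsupp.single_apply, if_neg]
    · simp
    · intro h
      have := (Sigma.mk.inj_iff.mp h).1
      omega
  · rw [LinearMap.comp_apply, strip_cre, Module.Basis.coord_apply, Module.Basis.coord_apply,
      repr_cre]
    simp only [Fin.cons_zero, Fin.cons_succ]
    split_ifs <;> simp

/-- The annihilation operator in coordinates: the letter `k` is inserted at all positions. -/
theorem repr_ann (E : AdaptedBasis D d) (k : Fin d) {n : ℕ} : ∀ (y : FockAlg V)
    (v : Fin n → Fin d), (wordBasis E).repr (ann E k y) ⟨n, v⟩ = ∑ p : Fin (n + 1),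
      (∏ i : Fin n, if i.castSucc < p then twc E k (v i) else 1) *
        (wordBasis E).repr y ⟨n + 1, p.insertNth k v⟩ := by
  induction n with
  | zero =>
    intro y v
    rw [ann_eq_strip_add, map_add, map_sum, Finsupp.add_apply, repr_strip]
    simp [repr_cre_zero]
  | succ n ih =>
    intro y v
    rw [ann_eq_strip_add, map_add, map_sum, Finsupp.add_apply, repr_strip, Fin.sum_univ_succ]
    congr 1
    · simp
    · rw [Finsupp.finsetSum_apply]
      simp only [map_smul, Finsupp.smul_apply, repr_cre, smul_eq_mul, mul_ite, mul_zero]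
      rw [Finset.sum_ite_eq, if_pos (Finset.mem_univ _), ih, Finset.mul_sum]
      refine Finset.sum_congr rfl fun p _ => ?_
      rw [repr_strip, Fin.prod_univ_succ, ← mul_assoc]
      congr 2
      · simp [Fin.lt_def]
      · congr 1
        refine (Fin.insertNth_eq_iff.mpr ⟨by simp, ?_⟩).symm
        funext t
        refine Fin.cases ?_ (fun t => ?_) t <;> simp [Fin.removeNth]

/-- The permutation that moves position `p` to the front and permutes the others by `τ`. -/
def frontPerm {n : ℕ} (p : Fin (n + 1)) (τ : Equiv.Perm (Fin n)) : Equiv.Perm (Fin (n + 1)) :=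
  (finSuccEquiv' p).trans ((Equiv.optionCongr τ).trans (finSuccEquiv' 0).symm)

@[simp] theorem frontPerm_self {n : ℕ} (p : Fin (n + 1)) (τ : Equiv.Perm (Fin n)) :
    frontPerm p τ p = 0 := by simp [frontPerm]

@[simp] theorem frontPerm_succAbove {n : ℕ} (p : Fin (n + 1)) (τ : Equiv.Perm (Fin n))
    (i : Fin n) : frontPerm p τ (p.succAbove i) = (τ i).succ := by simp [frontPerm]

theorem frontPerm_bijective (n : ℕ) : Function.Bijective
    fun x : Fin (n + 1) × Equiv.Perm (Fin n) => frontPerm x.1 x.2 := by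
  rw [Fintype.bijective_iff_injective_and_card]
  constructor
  · rintro ⟨p, τ⟩ ⟨p', τ'⟩ h
    simp only at h
    have hp : p = p' := by
      have h1 : frontPerm p' τ' p = 0 := by rw [← h]; simp
      exact (frontPerm p' τ').injective (h1.trans (frontPerm_self p' τ').symm)
    subst hp
    have : τ = τ' := by
      ext i
      have h1 : frontPerm p τ (p.succAbove i) = frontPerm p τ' (p.succAbove i) := by rw [h]
      simpa using congrArg Fin.val h1
    rw [this]
  · simp [Fintype.card_perm, Nat.factorial_succ]

theorem invWeight_frontPerm (E : AdaptedBasis D d) {n : ℕ} (p : Fin (n + 1))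
    (τ : Equiv.Perm (Fin n)) (k : Fin d) (v : Fin n → Fin d) :
    (invWeight E (frontPerm p τ) (p.insertNth k v : Fin (n + 1) → Fin d) : ℂ) =
      (∏ i : Fin n, if i.castSucc < p then twc E k (v i) else 1) * (invWeight E τ v : ℂ) := by
  have h : ∀ {m : ℕ} (σ : Equiv.Perm (Fin m)) (w : Fin m → Fin d), (invWeight E σ w : ℂ) =
      ∏ a, ∏ b, if a < b ∧ σ b < σ a then twc E (w a) (w b) else 1 := by
    intro m σ w
    rw [invWeight, Complex.ofReal_prod, Finset.prod_filter, ← Finset.univ_product_univ,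
      Finset.prod_product]
    rfl
  rw [h, h, Fin.prod_univ_succAbove _ p]
  have h1 : (∏ b, if p < b ∧ frontPerm p τ b < frontPerm p τ p then
      twc E ((p.insertNth k v : Fin (n + 1) → Fin d) p)
        ((p.insertNth k v : Fin (n + 1) → Fin d) b) else 1) = 1 :=
    Finset.prod_eq_one fun b _ => by simp
  rw [h1, one_mul, ← Finset.prod_mul_distrib]
  refine Finset.prod_congr rfl fun a _ => ?_
  rw [Fin.prod_univ_succAbove _ p]
  congr 1
  · simp only [frontPerm_self, frontPerm_succAbove, Fin.succ_pos, and_true,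
      Fin.insertNth_apply_same, Fin.insertNth_apply_succAbove]
    simp only [Fin.succAbove_lt_iff_castSucc_lt, twc_symm E k]
  · refine Finset.prod_congr rfl fun b _ => ?_
    simp

/-- `P^(n+1)` factors through `1 ⊗ P^(n)`. -/
theorem strip_symmetrizer (E : AdaptedBasis D d) (k : Fin d) (y : FockAlg V) :
    strip E k (symmetrizer E y) = symmetrizer E (ann E k y) := by
  refine (wordBasis E).repr.injective (Finsupp.ext ?_)
  rintro ⟨n, u⟩
  rw [repr_strip, repr_symmetrizer, repr_symmetrizer,
    ← (frontPerm_bijective n).sum_comp fun σ => (invWeight E σ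
      (fun t => (Fin.cons k u : Fin (n + 1) → Fin d) (σ t)) : ℂ) *
      (wordBasis E).repr y ⟨n + 1, fun t => (Fin.cons k u : Fin (n + 1) → Fin d) (σ t)⟩,
    Fintype.sum_prod_type, Finset.sum_comm]
  refine Finset.sum_congr rfl fun τ _ => ?_
  rw [repr_ann, Finset.mul_sum]
  refine Finset.sum_congr rfl fun p _ => ?_
  have hw : (fun t => (Fin.cons k u : Fin (n + 1) → Fin d) (frontPerm p τ t)) =
      p.insertNth k fun t => u (τ t) := by
    funext t
    refine Fin.succAboveCases p ?_ (fun i => ?_) t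
    · simp
    · simp
  simp only [hw, invWeight_frontPerm]
  ring

theorem freeInner_wordBasis (E : AdaptedBasis D d) (w) (z : FockAlg V) :
    freeInner E (wordBasis E w) z = (wordBasis E).repr z w := by
  simp [freeInner]

theorem freeInner_cre (E : AdaptedBasis D d) (k : Fin d) (x z : FockAlg V) :
    freeInner E (cre E k x) z = freeInner E x (strip E k z) := by
  have hadd : ∀ x y z, freeInner E (x + y) z = freeInner E x z + freeInner E y z := by
    intro x y z
    rw [freeInner, map_add, Finsupp.sum_add_index']
    · rfl
    · simp
    · intro w a b
      rw [map_add, add_mul]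
  have hsmul : ∀ (r : ℂ) x z, freeInner E (r • x) z = conj r * freeInner E x z := by
    intro r x z
    rw [freeInner, map_smul, Finsupp.sum_smul_index (by simp), freeInner, Finsupp.mul_sum]
    refine Finsupp.sum_congr fun w _ => ?_
    rw [map_mul, mul_assoc]
  have hx : x ∈ Submodule.span ℂ (Set.range (wordBasis E)) := by
    rw [(wordBasis E).span_eq]; trivial
  induction hx using Submodule.span_induction with
  | mem y hy =>
    obtain ⟨⟨n, w⟩, rfl⟩ := hy
    have hc := wordBasis_succ E (Fin.cons k w : Fin (n + 1) → Fin d)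
    simp only [Fin.cons_zero, Fin.cons_succ] at hc
    rw [← hc, freeInner_wordBasis, freeInner_wordBasis, repr_strip]
  | zero => simp [freeInner]
  | add y z _ _ hy hz => rw [map_add, hadd, hadd, hy, hz]
  | smul c y _ hy => rw [map_smul, hsmul, hsmul, hy]

/-- The annihilation operator `a(e_k)` is adjoint to `a*(e_k)` for the `T`-inner product. -/
theorem innerT_cre_left (E : AdaptedBasis D d) (k : Fin d) (x y : FockAlg V) :
    innerT E (cre E k x) y = innerT E x (ann E k y) := by
  rw [innerT, innerT, freeInner_cre, strip_symmetrizer]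

theorem innerT_cre_right (E : AdaptedBasis D d) (k : Fin d) (x y : FockAlg V) :
    innerT E x (cre E k y) = innerT E (ann E k x) y := by
  rw [← innerT_conj_symm, innerT_cre_left, innerT_conj_symm]

theorem innerT_add_right (E : AdaptedBasis D d) (x y z : FockAlg V) :
    innerT E x (y + z) = innerT E x y + innerT E x z := by
  rw [← innerT_conj_symm, innerT_add_left, map_add, innerT_conj_symm, innerT_conj_symm]

theorem innerT_smul_right (E : AdaptedBasis D d) (x y : FockAlg V) (r : ℂ) :
    innerT E x (r • y) = r * innerT E x y := by
  rw [← innerT_conj_symm, innerT_smul_left, map_mul, Complex.conj_conj, innerT_conj_symm]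

theorem innerT_one_left (E : AdaptedBasis D d) (x : FockAlg V) :
    innerT E 1 x = vacCoeff E x := by
  induction x using fock_induction E with
  | one =>
    rw [vacCoeff_one, ← wordBasis_zero E Fin.elim0, innerT, freeInner_wordBasis, repr_symmetrizer]
    simp [invWeight]
  | cre k x _ =>
    rw [← innerT_conj_symm, innerT_cre_left, ann_one, ← zero_smul ℂ (1 : FockAlg V),
      innerT_smul_right]
    simp
  | add x y hx hy => rw [innerT_add_right, map_add, hx, hy]
  | smul c x hx => rw [innerT_smul_right, map_smul, hx, smul_eq_mul]

/-! ### Degrees and the `ℓ¹` norm of the coefficients -/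

/-- The span of the words of length `n`. -/
def deg (E : AdaptedBasis D d) (n : ℕ) : Submodule ℂ (FockAlg V) :=
  Submodule.span ℂ (wordVec E '' {l | l.length = n})

theorem wordVec_mem_deg (E : AdaptedBasis D d) (l : List (Fin d)) :
    wordVec E l ∈ deg E l.length := Submodule.subset_span ⟨l, rfl, rfl⟩

theorem one_mem_deg (E : AdaptedBasis D d) : (1 : FockAlg V) ∈ deg E 0 := by
  simpa using wordVec_mem_deg E []

theorem map_mem_of_mem_deg (E : AdaptedBasis D d) {M : Type*} [AddCommGroup M] [Module ℂ M]
    (f : FockAlg V →ₗ[ℂ] M) (S : Submodule ℂ M) {n : ℕ}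
    (h : ∀ l : List (Fin d), l.length = n → f (wordVec E l) ∈ S) {x : FockAlg V}
    (hx : x ∈ deg E n) : f x ∈ S := by
  have : deg E n ≤ S.comap f := by
    rw [deg, Submodule.span_le]
    rintro _ ⟨l, hl, rfl⟩
    exact h l hl
  exact this hx

theorem eq_of_mem_deg (E : AdaptedBasis D d) {M : Type*} [AddCommGroup M] [Module ℂ M]
    (f g : FockAlg V →ₗ[ℂ] M) {n : ℕ}
    (h : ∀ l : List (Fin d), l.length = n → f (wordVec E l) = g (wordVec E l)) {x : FockAlg V}
    (hx : x ∈ deg E n) : f x = g x := by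
  have := map_mem_of_mem_deg E (f - g) ⊥ (fun l hl => by simp [h l hl]) hx
  simpa [sub_eq_zero] using this

theorem finite_words (d n : ℕ) : {l : List (Fin d) | l.length = n}.Finite :=
  List.finite_length_eq (Fin d) n

instance (E : AdaptedBasis D d) (n : ℕ) : FiniteDimensional ℂ (deg E n) :=
  FiniteDimensional.span_of_finite ℂ ((finite_words d n).image _)

theorem cre_mem_deg (E : AdaptedBasis D d) (k : Fin d) {n : ℕ} {x : FockAlg V}
    (hx : x ∈ deg E n) : cre E k x ∈ deg E (n + 1) := by
  refine map_mem_of_mem_deg E (cre E k) _ (fun l hl => ?_) hx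
  rw [← wordVec_cons, ← hl]
  exact wordVec_mem_deg E (k :: l)

theorem exists_cre_of_mem_deg (E : AdaptedBasis D d) {p : FockAlg V → Prop} {n : ℕ}
    (h0 : p 0) (add : ∀ x y, p x → p y → p (x + y)) (smul : ∀ (c : ℂ) x, p x → p (c • x))
    (hp : ∀ k, ∀ x ∈ deg E n, p (cre E k x)) {x : FockAlg V} (hx : x ∈ deg E (n + 1)) : p x := by
  induction hx using Submodule.span_induction with
  | mem y hy =>
    obtain ⟨l, hl, rfl⟩ := hy
    cases l with
    | nil => simp at hl
    | cons k l =>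
      rw [wordVec_cons]
      refine hp k _ ?_
      have := wordVec_mem_deg E l
      simp only [List.length_cons, Set.mem_ofPred_eq, Nat.add_right_cancel_iff] at hl
      rwa [hl] at this
  | zero => exact h0
  | add y z _ _ hy hz => exact add y z hy hz
  | smul c y _ hy => exact smul c y hy

theorem ann_eq_zero_of_mem_deg (E : AdaptedBasis D d) (k : Fin d) {x : FockAlg V}
    (hx : x ∈ deg E 0) : ann E k x = 0 := by
  refine eq_of_mem_deg E (ann E k) 0 (fun l hl => ?_) hx
  rw [List.length_eq_zero_iff.mp hl]; simp

theorem ann_mem_deg (E : AdaptedBasis D d) (k : Fin d) {n : ℕ} : ∀ {x : FockAlg V},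
    x ∈ deg E (n + 1) → ann E k x ∈ deg E n := by
  induction n with
  | zero =>
    intro x hx
    refine exists_cre_of_mem_deg E (p := fun x => ann E k x ∈ deg E 0) (by simp)
      (fun x y hx hy => by rw [map_add]; exact add_mem hx hy)
      (fun c x hx => by rw [map_smul]; exact Submodule.smul_mem _ _ hx) (fun j x hx => ?_) hx
    rw [ann_cre, ann_eq_zero_of_mem_deg E k hx, map_zero, smul_zero, add_zero]
    split_ifs
    exacts [hx, zero_mem _]
  | succ n ih =>
    intro x hx
    refine exists_cre_of_mem_deg E (p := fun x => ann E k x ∈ deg E (n + 1)) (by simp)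
      (fun x y hx hy => by rw [map_add]; exact add_mem hx hy)
      (fun c x hx => by rw [map_smul]; exact Submodule.smul_mem _ _ hx) (fun j x hx => ?_) hx
    rw [ann_cre]
    refine add_mem ?_ (Submodule.smul_mem _ _ (cre_mem_deg E j (ih hx)))
    split_ifs
    exacts [hx, zero_mem _]

/-- The sum of the absolute values of the coefficients of a vector with respect to the words. -/
def wnorm (E : AdaptedBasis D d) : Seminorm ℂ (FockAlg V) :=
  Seminorm.of (fun x => ((wordVec E).repr x).sum fun _ c => ‖c‖)
    (fun x y => by
      classical
      have hs : ∀ z : List (Fin d) →₀ ℂ, z.support ⊆ ((wordVec E).repr x).support ∪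
          ((wordVec E).repr y).support → z.sum (fun _ c => ‖c‖) =
          ∑ l ∈ ((wordVec E).repr x).support ∪ ((wordVec E).repr y).support, ‖z l‖ :=
        fun z hz => Finsupp.sum_of_support_subset _ hz _ (by simp)
      rw [hs ((wordVec E).repr (x + y)) (by rw [map_add]; exact Finsupp.support_add),
        hs _ Finset.subset_union_left, hs _ Finset.subset_union_right, ← Finset.sum_add_distrib]
      refine Finset.sum_le_sum fun l _ => ?_
      rw [map_add]
      exact norm_add_le _ _)
    (fun c x => by
      rw [map_smul, Finsupp.sum_smul_index (by simp), Finsupp.mul_sum]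
      simp)

theorem wnorm_apply (E : AdaptedBasis D d) (x : FockAlg V) :
    wnorm E x = ((wordVec E).repr x).sum fun _ c => ‖c‖ := rfl

@[simp] theorem wnorm_wordVec (E : AdaptedBasis D d) (l : List (Fin d)) :
    wnorm E (wordVec E l) = 1 := by
  rw [wnorm_apply, Module.Basis.repr_self]; simp

theorem eq_zero_of_wnorm_eq_zero (E : AdaptedBasis D d) {x : FockAlg V} (h : wnorm E x = 0) :
    x = 0 := by
  rw [wnorm_apply, Finsupp.sum, Finset.sum_eq_zero_iff_of_nonneg (fun _ _ => norm_nonneg _)] at h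
  refine (wordVec E).repr.map_eq_zero_iff.mp (Finsupp.ext fun l => ?_)
  by_contra hl
  exact hl (norm_eq_zero.mp (h l (Finsupp.mem_support_iff.mpr hl)))

theorem seminorm_sum_le {M ι : Type*} [AddCommGroup M] [Module ℂ M] (p : Seminorm ℂ M)
    (s : Finset ι) (f : ι → M) : p (∑ i ∈ s, f i) ≤ ∑ i ∈ s, p (f i) :=
  Finset.le_sum_of_subadditive p (map_zero p).le (map_add_le_add p) s f

/-- A seminorm which is at most `K` on the words of length `n` is at most `K` times the `ℓ¹` norm
on their span. -/
theorem seminorm_le_wnorm (E : AdaptedBasis D d) (p : Seminorm ℂ (FockAlg V)) {K : ℝ} {n : ℕ}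
    (h : ∀ l : List (Fin d), l.length = n → p (wordVec E l) ≤ K) {x : FockAlg V}
    (hx : x ∈ deg E n) : p x ≤ K * wnorm E x := by
  have hs := ((wordVec E).mem_span_image).mp hx
  conv_lhs => rw [← (wordVec E).linearCombination_repr x, Finsupp.linearCombination_apply,
    Finsupp.sum]
  refine (seminorm_sum_le p _ _).trans ?_
  rw [wnorm_apply, Finsupp.sum, Finset.mul_sum]
  refine Finset.sum_le_sum fun l hl => ?_
  rw [map_smul_eq_mul, mul_comm]
  exact mul_le_mul_of_nonneg_right (h l (hs hl)) (norm_nonneg _)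

theorem wnorm_map_le (E : AdaptedBasis D d) (f : Module.End ℂ (FockAlg V)) {K : ℝ} {n : ℕ}
    (h : ∀ l : List (Fin d), l.length = n → wnorm E (f (wordVec E l)) ≤ K) {x : FockAlg V}
    (hx : x ∈ deg E n) : wnorm E (f x) ≤ K * wnorm E x :=
  seminorm_le_wnorm E ((wnorm E).comp f) h hx

theorem exists_tw_bound (E : AdaptedBasis D d) :
    ∃ q : ℝ, 0 ≤ q ∧ q < 1 ∧ ∀ k l, ‖twc E k l‖ ≤ q := by
  rcases isEmpty_or_nonempty (Fin d) with h | h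
  · exact ⟨0, le_rfl, one_pos, fun k => h.elim k⟩
  · obtain ⟨p, hp⟩ := Finite.exists_max fun p : Fin d × Fin d => ‖twc E p.1 p.2‖
    refine ⟨‖twc E p.1 p.2‖, norm_nonneg _, ?_, fun k l => hp (k, l)⟩
    rw [twc, Complex.norm_real]
    exact D.q_lt _ _

theorem wnorm_cre_le (E : AdaptedBasis D d) (k : Fin d) {n : ℕ} {x : FockAlg V}
    (hx : x ∈ deg E n) : wnorm E (cre E k x) ≤ wnorm E x := by
  have := wnorm_map_le E (cre E k) (K := 1) (n := n)
    (fun l _ => by rw [← wordVec_cons, wnorm_wordVec]) hx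
  rwa [one_mul] at this

/-- Annihilation operators are bounded for the `ℓ¹` norm, the twists being summed as a geometric
series. -/
theorem wnorm_ann_le (E : AdaptedBasis D d) {q : ℝ} (hq0 : 0 ≤ q) (hq1 : q < 1)
    (hq : ∀ k l, ‖twc E k l‖ ≤ q) (k : Fin d) {n : ℕ} {x : FockAlg V} (hx : x ∈ deg E n) :
    wnorm E (ann E k x) ≤ (1 - q)⁻¹ * wnorm E x := by
  have h1 : 0 < 1 - q := by linarith
  have hw : ∀ l : List (Fin d), wnorm E (ann E k (wordVec E l)) ≤ (1 - q)⁻¹ := by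
    intro l
    induction l with
    | nil => simpa using h1.le
    | cons j l ih =>
      rw [wordVec_cons, ann_cre]
      refine (map_add_le_add _ _ _).trans ?_
      have h2 : wnorm E (if k = j then wordVec E l else 0) ≤ 1 := by split_ifs <;> simp
      have h3 : wnorm E (twc E k j • cre E j (ann E k (wordVec E l))) ≤ q * (1 - q)⁻¹ := by
        rw [map_smul_eq_mul]
        refine mul_le_mul (hq k j) (le_trans ?_ ih) (apply_nonneg _ _) hq0
        rcases l with _ | ⟨i, l⟩
        · simp
        · exact wnorm_cre_le E j (ann_mem_deg E k (wordVec_mem_deg E (i :: l)))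
      have h4 : 1 + q * (1 - q)⁻¹ = (1 - q)⁻¹ := by field_simp; ring
      linarith
  exact wnorm_map_le E (ann E k) (fun l _ => hw l) hx

/-! ### Diagonal operators and the last letter -/

/-- The diagonal operator that multiplies a word by the product of the values of `κ` at its
letters. -/
def diag (E : AdaptedBasis D d) (κ : Fin d → ℂ) : Module.End ℂ (FockAlg V) :=
  (wordVec E).constr ℂ fun l => (l.map κ).prod • wordVec E l

theorem diag_wordVec (E : AdaptedBasis D d) (κ : Fin d → ℂ) (l : List (Fin d)) :
    diag E κ (wordVec E l) = (l.map κ).prod • wordVec E l := by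
  rw [diag, Module.Basis.constr_basis]

@[simp] theorem diag_one (E : AdaptedBasis D d) (κ : Fin d → ℂ) : diag E κ 1 = 1 := by
  rw [← wordVec_nil E, diag_wordVec]; simp

theorem diag_cre (E : AdaptedBasis D d) (κ : Fin d → ℂ) (k : Fin d) (x : FockAlg V) :
    diag E κ (cre E k x) = κ k • cre E k (diag E κ x) := by
  refine LinearMap.congr_fun (f := diag E κ ∘ₗ cre E k) (g := κ k • cre E k ∘ₗ diag E κ) ?_ x
  refine (wordVec E).ext fun l => ?_
  simp only [LinearMap.comp_apply, LinearMap.smul_apply, ← wordVec_cons, diag_wordVec, map_smul,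
    List.map_cons, List.prod_cons, smul_smul]

theorem diag_mem_deg (E : AdaptedBasis D d) (κ : Fin d → ℂ) {n : ℕ} {x : FockAlg V}
    (hx : x ∈ deg E n) : diag E κ x ∈ deg E n := by
  refine map_mem_of_mem_deg E _ _ (fun l hl => ?_) hx
  rw [diag_wordVec, ← hl]
  exact Submodule.smul_mem _ _ (wordVec_mem_deg E l)

theorem wnorm_diag_le (E : AdaptedBasis D d) {κ : Fin d → ℂ} {q : ℝ} (hq : ∀ k, ‖κ k‖ ≤ q)
    {n : ℕ} {x : FockAlg V} (hx : x ∈ deg E n) : wnorm E (diag E κ x) ≤ q ^ n * wnorm E x := by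
  refine wnorm_map_le E _ (fun l hl => ?_) hx
  rw [diag_wordVec, map_smul_eq_mul, wnorm_wordVec, mul_one]
  clear hx
  induction l generalizing n with
  | nil => subst hl; simp
  | cons k l ih =>
    subst hl
    rw [List.map_cons, List.prod_cons, norm_mul, List.length_cons, pow_succ']
    exact mul_le_mul (hq k) (ih rfl) (norm_nonneg _) ((norm_nonneg _).trans (hq k))

/-- The annihilation operators commute with the diagonal operators up to the weight of the removed
letter. -/
theorem ann_diag (E : AdaptedBasis D d) (κ : Fin d → ℂ) (k : Fin d) (x : FockAlg V) :
    ann E k (diag E κ x) = κ k • diag E κ (ann E k x) := by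
  refine ext_cre E (f := ann E k ∘ₗ diag E κ) (g := κ k • diag E κ ∘ₗ ann E k) (by simp)
    (fun j x hx => ?_) x
  simp only [LinearMap.comp_apply, LinearMap.smul_apply] at hx ⊢
  simp only [diag_cre, map_smul, ann_cre, hx, map_add, smul_add]
  congr 1
  · split_ifs with h
    · rw [h]
    · simp
  · simp only [smul_smul]
    congr 1
    ring

/-- Right multiplication by `e_k`. -/
def rcre (E : AdaptedBasis D d) (k : Fin d) : Module.End ℂ (FockAlg V) :=
  LinearMap.mulRight ℂ (TensorAlgebra.ι ℂ (E.e k))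

theorem rcre_cre (E : AdaptedBasis D d) (j k : Fin d) (x : FockAlg V) :
    rcre E k (cre E j x) = cre E j (rcre E k x) := by
  simp [rcre, cre_apply, mul_assoc]

theorem rcre_one (E : AdaptedBasis D d) (k : Fin d) : rcre E k 1 = cre E k 1 := by
  simp [rcre, cre_apply]

theorem wordVec_concat (E : AdaptedBasis D d) (l : List (Fin d)) (k : Fin d) :
    wordVec E (l ++ [k]) = rcre E k (wordVec E l) := by
  rw [wordVec_append, wordVec_cons, wordVec_nil, cre_apply, mul_one]; rfl

theorem rcre_mem_deg (E : AdaptedBasis D d) (k : Fin d) {n : ℕ} {x : FockAlg V}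
    (hx : x ∈ deg E n) : rcre E k x ∈ deg E (n + 1) := by
  refine map_mem_of_mem_deg E (rcre E k) _ (fun l hl => ?_) hx
  rw [← wordVec_concat, ← hl]
  simpa using wordVec_mem_deg E (l ++ [k])

theorem wnorm_rcre_le (E : AdaptedBasis D d) (k : Fin d) {n : ℕ} {x : FockAlg V}
    (hx : x ∈ deg E n) : wnorm E (rcre E k x) ≤ wnorm E x := by
  have := wnorm_map_le E (rcre E k) (K := 1) (n := n)
    (fun l _ => by rw [← wordVec_concat, wnorm_wordVec]) hx
  rwa [one_mul] at this

theorem diag_rcre (E : AdaptedBasis D d) (κ : Fin d → ℂ) (k : Fin d) (x : FockAlg V) :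
    diag E κ (rcre E k x) = κ k • rcre E k (diag E κ x) := by
  refine ext_cre E (f := diag E κ ∘ₗ rcre E k) (g := κ k • rcre E k ∘ₗ diag E κ) ?_
    (fun j x hx => ?_) x
  · simp [rcre_one, diag_cre]
  · simp only [LinearMap.comp_apply, LinearMap.smul_apply] at hx ⊢
    simp only [diag_cre, map_smul, rcre_cre, hx, smul_smul]
    rw [mul_comm]

/-- The commutator of an annihilation operator with a right creation operator. -/
theorem ann_rcre (E : AdaptedBasis D d) (j k : Fin d) (x : FockAlg V) :
    ann E j (rcre E k x) =
      rcre E k (ann E j x) + if j = k then diag E (twc E k) x else 0 := by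
  have := ext_cre E (f := ann E j ∘ₗ rcre E k)
    (g := rcre E k ∘ₗ ann E j + if j = k then diag E (twc E k) else 0) ?_ (fun i x hx => ?_) x
  · simp only [LinearMap.comp_apply, LinearMap.add_apply] at this
    rw [this]
    split_ifs <;> rfl
  · simp [rcre_one, ann_cre]
    split_ifs <;> simp
  · simp only [LinearMap.comp_apply, LinearMap.add_apply] at hx ⊢
    rw [rcre_cre, ann_cre, hx, ann_cre, map_add, map_add, map_smul, rcre_cre, smul_add, add_assoc]
    split_ifs with h1 h2 h2 <;> simp_all [diag_cre]

/-- The operator that removes the last letter of a word if it is `c`, and kills the other words. -/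
def rstrip (E : AdaptedBasis D d) (c : Fin d) : Module.End ℂ (FockAlg V) :=
  (wordVec E).constr ℂ fun l => if l.getLast? = some c then wordVec E l.dropLast else 0

theorem rstrip_concat (E : AdaptedBasis D d) (c : Fin d) (l : List (Fin d)) (b : Fin d) :
    rstrip E c (wordVec E (l ++ [b])) = if b = c then wordVec E l else 0 := by
  rw [rstrip, Module.Basis.constr_basis]; simp

theorem rstrip_rcre (E : AdaptedBasis D d) (c b : Fin d) (x : FockAlg V) :
    rstrip E c (rcre E b x) = if b = c then x else 0 := by
  have : rstrip E c ∘ₗ rcre E b = if b = c then LinearMap.id else 0 := by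
    refine (wordVec E).ext fun l => ?_
    rw [LinearMap.comp_apply, ← wordVec_concat, rstrip_concat]
    split_ifs <;> rfl
  refine (LinearMap.congr_fun this x).trans ?_
  split_ifs <;> rfl

theorem exists_concat_of_length_eq {n : ℕ} {l : List (Fin d)} (h : l.length = n + 1) :
    ∃ (l' : List (Fin d)) (c : Fin d), l'.length = n ∧ l = l' ++ [c] := by
  rcases List.eq_nil_or_concat l with rfl | ⟨l', c, rfl⟩
  · simp at h
  · exact ⟨l', c, by simpa using h, by simp⟩

theorem eq_sum_rcre_rstrip (E : AdaptedBasis D d) {n : ℕ} {x : FockAlg V}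
    (hx : x ∈ deg E (n + 1)) : x = ∑ c, rcre E c (rstrip E c x) := by
  have := eq_of_mem_deg E LinearMap.id (∑ c, rcre E c ∘ₗ rstrip E c) (fun l hl => ?_) hx
  · simpa [LinearMap.sum_apply] using this
  · obtain ⟨l, c, -, rfl⟩ := exists_concat_of_length_eq hl
    simp [LinearMap.sum_apply, rstrip_rcre, apply_ite, wordVec_concat]

theorem rstrip_mem_deg (E : AdaptedBasis D d) (c : Fin d) {n : ℕ} {x : FockAlg V}
    (hx : x ∈ deg E (n + 1)) : rstrip E c x ∈ deg E n := by
  refine map_mem_of_mem_deg E _ _ (fun l hl => ?_) hx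
  obtain ⟨l, b, rfl, rfl⟩ := exists_concat_of_length_eq hl
  rw [rstrip_concat]
  split_ifs
  exacts [wordVec_mem_deg E l, zero_mem _]

theorem sum_wnorm_rstrip_le (E : AdaptedBasis D d) {n : ℕ} {x : FockAlg V}
    (hx : x ∈ deg E (n + 1)) : ∑ c, wnorm E (rstrip E c x) ≤ wnorm E x := by
  have := seminorm_le_wnorm E (∑ c, (wnorm E).comp (rstrip E c)) (K := 1) (fun l hl => ?_) hx
  · simpa using this
  · obtain ⟨l, b, -, rfl⟩ := exists_concat_of_length_eq hl
    simp [rstrip_concat, apply_ite]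

/-! ### The operator `1 + T₁ + T₁T₂ + ⋯` -/

/-- The operator `∑ a*(e_k) a(e_k)`, which on words of length `n` is
`1 + T_1 + T_1 T_2 + ⋯ + T_1 ⋯ T_{n-1}`. -/
def cyc (E : AdaptedBasis D d) : Module.End ℂ (FockAlg V) := ∑ k, cre E k ∘ₗ ann E k

theorem cyc_apply (E : AdaptedBasis D d) (x : FockAlg V) :
    cyc E x = ∑ k, cre E k (ann E k x) := by simp [cyc, LinearMap.sum_apply]

theorem strip_cyc (E : AdaptedBasis D d) (k : Fin d) (x : FockAlg V) :
    strip E k (cyc E x) = ann E k x := by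
  simp [cyc_apply, strip_cre]

theorem cyc_mem_deg (E : AdaptedBasis D d) {n : ℕ} {x : FockAlg V} (hx : x ∈ deg E (n + 1)) :
    cyc E x ∈ deg E (n + 1) := by
  rw [cyc_apply]
  exact sum_mem fun k _ => cre_mem_deg E k (ann_mem_deg E k hx)

theorem cyc_cre (E : AdaptedBasis D d) (c : Fin d) (x : FockAlg V) :
    cyc E (cre E c x) = cre E c x + twist E 0 (cre E c (cyc E x)) := by
  simp only [cyc_apply, ann_cre, map_add, Finset.sum_add_distrib, map_sum, twist_zero_cre_cre,
    map_smul]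
  congr 1
  · simp [apply_ite]
  · exact Finset.sum_congr rfl fun k _ => by rw [twc_symm]

theorem cyc_rcre (E : AdaptedBasis D d) (c : Fin d) (x : FockAlg V) :
    cyc E (rcre E c x) = rcre E c (cyc E x) + cre E c (diag E (twc E c) x) := by
  simp only [cyc_apply, ann_rcre, map_add, Finset.sum_add_distrib, map_sum, rcre_cre]
  simp [apply_ite]

/-- The diagonal operators preserve the operator `cyc`. -/
theorem cyc_diag (E : AdaptedBasis D d) (κ : Fin d → ℂ) (x : FockAlg V) :
    cyc E (diag E κ x) = diag E κ (cyc E x) := by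
  simp only [cyc_apply, ann_diag, map_smul, map_sum, diag_cre]

/-- The cyclic shift `T_1 ⋯ T_{n-1}` on words of length `n`, which moves the last letter to the
front. -/
def shift (E : AdaptedBasis D d) : Module.End ℂ (FockAlg V) :=
  ∑ c, cre E c ∘ₗ diag E (twc E c) ∘ₗ rstrip E c

theorem shift_apply (E : AdaptedBasis D d) (x : FockAlg V) :
    shift E x = ∑ c, cre E c (diag E (twc E c) (rstrip E c x)) := by
  simp [shift, LinearMap.sum_apply]

theorem shift_rcre (E : AdaptedBasis D d) (c : Fin d) (x : FockAlg V) :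
    shift E (rcre E c x) = cre E c (diag E (twc E c) x) := by
  simp [shift_apply, rstrip_rcre, apply_ite]

/-- The factorisation `R_n (1 - γ) = (1 - T_1 γ) (R_{n-1} ⊗ 1)` of `R_n = 1 + T_1 + T_1 T_2 + ⋯`,
where `γ = T_1 ⋯ T_{n-1}`. -/
theorem cyc_sub_shift (E : AdaptedBasis D d) {n : ℕ} {x : FockAlg V} (hx : x ∈ deg E (n + 1)) :
    cyc E (x - shift E x) = ∑ c, rcre E c (cyc E (rstrip E c x)) -
      twist E 0 (shift E (∑ c, rcre E c (cyc E (rstrip E c x)))) := by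
  conv_lhs => rw [eq_sum_rcre_rstrip E hx]
  simp only [map_sub, map_sum, shift_rcre, cyc_rcre, cyc_cre, cyc_diag, Finset.sum_add_distrib]
  abel

theorem wnorm_twist_zero_le (E : AdaptedBasis D d) {q : ℝ} (hq0 : 0 ≤ q)
    (hq : ∀ k l, ‖twc E k l‖ ≤ q) {n : ℕ} {x : FockAlg V} (hx : x ∈ deg E n) :
    wnorm E (twist E 0 x) ≤ q * wnorm E x := by
  refine wnorm_map_le E _ (fun l _ => ?_) hx
  match l with
  | [] => simpa [twist_zero_one] using hq0
  | [j] => simpa [wordVec_cons, twist_zero_cre_one] using hq0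
  | j :: k :: l =>
    rw [wordVec_cons, wordVec_cons, twist_zero_cre_cre, ← wordVec_cons, ← wordVec_cons,
      map_smul_eq_mul, wnorm_wordVec, mul_one]
    exact hq j k

theorem shift_mem_deg (E : AdaptedBasis D d) {n : ℕ} {x : FockAlg V} (hx : x ∈ deg E (n + 1)) :
    shift E x ∈ deg E (n + 1) := by
  rw [shift_apply]
  exact sum_mem fun c _ => cre_mem_deg E c (diag_mem_deg E _ (rstrip_mem_deg E c hx))

theorem wnorm_shift_le (E : AdaptedBasis D d) {q : ℝ} (hq0 : 0 ≤ q)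
    (hq : ∀ k l, ‖twc E k l‖ ≤ q) {n : ℕ} {x : FockAlg V} (hx : x ∈ deg E (n + 1)) :
    wnorm E (shift E x) ≤ q ^ n * wnorm E x := by
  rw [shift_apply]
  refine (seminorm_sum_le _ _ _).trans ?_
  calc _ ≤ ∑ c, q ^ n * wnorm E (rstrip E c x) := Finset.sum_le_sum fun c _ =>
        (wnorm_cre_le E c (diag_mem_deg E _ (rstrip_mem_deg E c hx))).trans
          (wnorm_diag_le E (hq c) (rstrip_mem_deg E c hx))
    _ ≤ _ := by
        rw [← Finset.mul_sum]
        exact mul_le_mul_of_nonneg_left (sum_wnorm_rstrip_le E hx) (by positivity)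

theorem one_sub_div_one_add_ge {q : ℝ} (hq0 : 0 ≤ q) (hq1 : q < 1) (n : ℕ) :
    Real.exp (-((1 + (1 - q)⁻¹) * q ^ (n + 1))) * (1 + q ^ (n + 1)) ≤ 1 - q ^ (n + 2) := by
  have h1 : 0 < 1 - q := by linarith
  set s := q ^ (n + 1) with hs
  have hs0 : 0 ≤ s := by positivity
  have ht : q ^ (n + 2) ≤ s := pow_le_pow_of_le_one hq0 hq1.le (by omega)
  have ht' : q ^ (n + 2) ≤ q := by
    simpa using pow_le_pow_of_le_one hq0 hq1.le (show 1 ≤ n + 2 by omega)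
  set t := q ^ (n + 2)
  have ht1 : 0 < 1 - t := by linarith
  have ht0 : 0 ≤ t := by positivity
  have h2 : 1 + s ≤ Real.exp s := by linarith [Real.add_one_le_exp s]
  have h3 : (1 - t)⁻¹ ≤ Real.exp ((1 - q)⁻¹ * s) := by
    have h4 : (1 - t)⁻¹ = 1 + (1 - t)⁻¹ * t := by field_simp; ring
    have h5 : (1 - t)⁻¹ * t ≤ (1 - q)⁻¹ * s :=
      mul_le_mul (inv_anti₀ h1 (by linarith)) ht ht0 (by positivity)
    have h6 := Real.add_one_le_exp ((1 - q)⁻¹ * s)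
    linarith
  have h7 : Real.exp (-((1 + (1 - q)⁻¹) * s)) =
      (Real.exp s)⁻¹ * (Real.exp ((1 - q)⁻¹ * s))⁻¹ := by
    rw [← Real.exp_neg, ← Real.exp_neg, ← Real.exp_add]; congr 1; ring
  have h8 : (Real.exp ((1 - q)⁻¹ * s))⁻¹ ≤ 1 - t := by
    have := inv_anti₀ (by positivity) h3
    rwa [inv_inv] at this
  rw [h7]
  calc (Real.exp s)⁻¹ * (Real.exp ((1 - q)⁻¹ * s))⁻¹ * (1 + s)
      ≤ (Real.exp s)⁻¹ * (1 - t) * Real.exp s := by gcongr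
    _ = 1 - t := by field_simp

theorem exists_sub_shift (E : AdaptedBasis D d) {q : ℝ} (hq0 : 0 ≤ q) (hq1 : q < 1)
    (hq : ∀ k l, ‖twc E k l‖ ≤ q) {n : ℕ} {x : FockAlg V} (hx : x ∈ deg E (n + 2)) :
    ∃ y ∈ deg E (n + 2), y - shift E y = x := by
  have hmaps : ∀ y ∈ deg E (n + 2),
      (LinearMap.id - shift E : Module.End ℂ (FockAlg V)) y ∈ deg E (n + 2) :=
    fun y hy => sub_mem hy (shift_mem_deg E hy)
  have hinj : Set.InjOn (LinearMap.id - shift E : Module.End ℂ (FockAlg V)) (deg E (n + 2)) := by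
    intro y hy z hz h
    rw [← sub_eq_zero, ← map_sub] at h
    have h1 : y - z = shift E (y - z) := sub_eq_zero.mp h
    have h2 := wnorm_shift_le E hq0 hq (sub_mem hy hz)
    rw [← h1] at h2
    have h3 : q ^ (n + 1) < 1 := pow_lt_one₀ hq0 hq1 (by omega)
    have h4 : 0 ≤ wnorm E (y - z) := apply_nonneg _ _
    exact sub_eq_zero.mp (eq_zero_of_wnorm_eq_zero E (by nlinarith))
  obtain ⟨y, hy, h⟩ := (LinearMap.injOn_iff_surjOn hmaps).mp hinj hx
  exact ⟨y, hy, h⟩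

theorem wnorm_cyc_ge_aux (E : AdaptedBasis D d) {q : ℝ} (hq0 : 0 ≤ q) (hq1 : q < 1)
    (hq : ∀ k l, ‖twc E k l‖ ≤ q) (n : ℕ) : ∀ x ∈ deg E (n + 1),
    Real.exp (-((1 + (1 - q)⁻¹) * ∑ k ∈ Finset.range n, q ^ (k + 1))) * wnorm E x ≤
      wnorm E (cyc E x) := by
  induction n with
  | zero =>
    intro x hx
    have : cyc E x = x := by
      refine eq_of_mem_deg E (cyc E) LinearMap.id (fun l hl => ?_) hx
      obtain ⟨c, rfl⟩ := List.length_eq_one_iff.mp hl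
      simp [wordVec_cons, cyc_apply, ann_cre, apply_ite]
    simp [this]
  | succ n ih =>
    intro x hx
    obtain ⟨y, hy, rfl⟩ := exists_sub_shift E hq0 hq1 hq hx
    set z := ∑ c, rcre E c (cyc E (rstrip E c y)) with hz
    have hstrip : ∀ c, rstrip E c y ∈ deg E (n + 1) := fun c => rstrip_mem_deg E c hy
    have hzd : z ∈ deg E (n + 2) :=
      sum_mem fun c _ => rcre_mem_deg E c (cyc_mem_deg E (hstrip c))
    set ε := Real.exp (-((1 + (1 - q)⁻¹) * ∑ k ∈ Finset.range n, q ^ (k + 1))) with hε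
    have h1 : ε * wnorm E y ≤ wnorm E z := by
      calc ε * wnorm E y ≤ ε * ∑ c, wnorm E (rstrip E c y) := by
            refine mul_le_mul_of_nonneg_left ?_ (Real.exp_pos _).le
            conv_lhs => rw [eq_sum_rcre_rstrip E hy]
            exact (seminorm_sum_le _ _ _).trans
              (Finset.sum_le_sum fun c _ => wnorm_rcre_le E c (hstrip c))
        _ ≤ ∑ c, wnorm E (rstrip E c z) := by
            rw [Finset.mul_sum]
            refine Finset.sum_le_sum fun c _ => ?_
            have : rstrip E c z = cyc E (rstrip E c y) := by
              rw [hz, map_sum]; simp [rstrip_rcre]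
            rw [this]
            exact ih _ (hstrip c)
        _ ≤ wnorm E z := sum_wnorm_rstrip_le E hzd
    have h2 : wnorm E (y - shift E y) ≤ (1 + q ^ (n + 1)) * wnorm E y := by
      have := wnorm_shift_le E hq0 hq hy
      have h3 := map_sub_le_add (wnorm E) y (shift E y)
      linarith
    have h3 : (1 - q ^ (n + 2)) * wnorm E z ≤ wnorm E (cyc E (y - shift E y)) := by
      rw [cyc_sub_shift E hy, ← hz]
      have h4 : wnorm E (twist E 0 (shift E z)) ≤ q ^ (n + 2) * wnorm E z := by
        refine (wnorm_twist_zero_le E hq0 hq (shift_mem_deg E hzd)).trans ?_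
        rw [pow_succ' q (n + 1), mul_assoc]
        exact mul_le_mul_of_nonneg_left (wnorm_shift_le E hq0 hq hzd) hq0
      have h5 := map_add_le_add (wnorm E) (z - twist E 0 (shift E z)) (twist E 0 (shift E z))
      rw [sub_add_cancel] at h5
      linarith
    have h4 := one_sub_div_one_add_ge hq0 hq1 n
    have h5 : Real.exp (-((1 + (1 - q)⁻¹) * ∑ k ∈ Finset.range (n + 1), q ^ (k + 1))) =
        ε * Real.exp (-((1 + (1 - q)⁻¹) * q ^ (n + 1))) := by
      rw [hε, ← Real.exp_add, Finset.sum_range_succ]; congr 1; ring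
    rw [h5]
    have hy0 : 0 ≤ wnorm E y := apply_nonneg _ _
    calc _ ≤ ε * Real.exp (-((1 + (1 - q)⁻¹) * q ^ (n + 1))) *
            ((1 + q ^ (n + 1)) * wnorm E y) :=
          mul_le_mul_of_nonneg_left h2 (by positivity)
      _ = ε * (Real.exp (-((1 + (1 - q)⁻¹) * q ^ (n + 1))) * (1 + q ^ (n + 1))) * wnorm E y := by
          ring
      _ ≤ ε * (1 - q ^ (n + 2)) * wnorm E y := by gcongr
      _ = (1 - q ^ (n + 2)) * (ε * wnorm E y) := by ring
      _ ≤ (1 - q ^ (n + 2)) * wnorm E z := by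
          refine mul_le_mul_of_nonneg_left h1 ?_
          have := pow_le_one₀ (n := n + 2) hq0 hq1.le
          linarith
      _ ≤ _ := h3

/-- The operator `1 + T_1 + T_1 T_2 + ⋯` is invertible on each degree, and its inverse is bounded
for the `ℓ¹` norm uniformly in the degree. -/
theorem exists_cyc_eq (E : AdaptedBasis D d) : ∃ C : ℝ, 0 ≤ C ∧ ∀ (n : ℕ), ∀ x ∈ deg E (n + 1),
    ∃ y ∈ deg E (n + 1), cyc E y = x ∧ wnorm E y ≤ C * wnorm E x := by
  obtain ⟨q, hq0, hq1, hq⟩ := exists_tw_bound E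
  have h1 : 0 < 1 - q := by linarith
  -- the lower bounds in the single degrees decrease to a positive limit, since `∑ q ^ k` converges
  set A := (1 + (1 - q)⁻¹) * (1 - q)⁻¹ with hA
  have hlow : ∀ (n : ℕ), ∀ x ∈ deg E (n + 1), Real.exp (-A) * wnorm E x ≤ wnorm E (cyc E x) := by
    intro n x hx
    refine le_trans ?_ (wnorm_cyc_ge_aux E hq0 hq1 hq n x hx)
    refine mul_le_mul_of_nonneg_right (Real.exp_le_exp.mpr (neg_le_neg ?_)) (apply_nonneg _ _)
    refine mul_le_mul_of_nonneg_left ?_ (by positivity)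
    have hs := (summable_geometric_of_lt_one hq0 hq1).sum_le_tsum (Finset.range n)
      (fun i _ => by positivity)
    rw [tsum_geometric_of_lt_one hq0 hq1] at hs
    refine le_trans (Finset.sum_le_sum fun k _ => ?_) hs
    exact pow_le_pow_of_le_one hq0 hq1.le (by omega)
  refine ⟨Real.exp A, (Real.exp_pos _).le, fun n x hx => ?_⟩
  have hinj : Set.InjOn (cyc E) (deg E (n + 1)) := by
    intro y hy z hz h
    rw [← sub_eq_zero, ← map_sub] at h
    have h2 := hlow n _ (sub_mem hy hz)
    rw [h, map_zero] at h2
    have h3 : wnorm E (y - z) ≤ 0 := by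
      by_contra hc
      have : 0 < Real.exp (-A) * wnorm E (y - z) := mul_pos (Real.exp_pos _) (not_le.mp hc)
      linarith
    exact sub_eq_zero.mp (eq_zero_of_wnorm_eq_zero E (le_antisymm h3 (apply_nonneg _ _)))
  obtain ⟨y, hy, rfl⟩ :=
    (LinearMap.injOn_iff_surjOn (fun y hy => cyc_mem_deg E hy)).mp hinj hx
  refine ⟨y, hy, rfl, ?_⟩
  have h2 := mul_le_mul_of_nonneg_left (hlow n y hy) (Real.exp_pos A).le
  rwa [← mul_assoc, ← Real.exp_add, add_neg_cancel, Real.exp_zero, one_mul] at h2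

/-! ### Norm estimates for the `T`-inner product -/

theorem inner_emb_cre_left (E : AdaptedBasis D d) (k : Fin d) (x y : FockAlg V) :
    inner ℂ (emb E (cre E k x)) (emb E y) = inner ℂ (emb E x) (emb E (ann E k y)) := by
  rw [inner_emb, inner_emb, innerT_cre_left]

theorem inner_emb_cre_right (E : AdaptedBasis D d) (k : Fin d) (x y : FockAlg V) :
    inner ℂ (emb E x) (emb E (cre E k y)) = inner ℂ (emb E (ann E k x)) (emb E y) := by
  rw [inner_emb, inner_emb, innerT_cre_right]

theorem inner_vac_emb (E : AdaptedBasis D d) (x : FockAlg V) :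
    inner ℂ (vac E) (emb E x) = vacCoeff E x := by
  rw [vac, inner_emb, innerT_one_left]

theorem inner_emb_cyc (E : AdaptedBasis D d) (x y : FockAlg V) :
    inner ℂ (emb E x) (emb E (cyc E y)) =
      ∑ k, inner ℂ (emb E (ann E k x)) (emb E (ann E k y)) := by
  simp only [cyc_apply, map_sum, inner_sum, inner_emb_cre_right]

theorem inner_cyc_emb (E : AdaptedBasis D d) (x y : FockAlg V) :
    inner ℂ (emb E (cyc E x)) (emb E y) = inner ℂ (emb E x) (emb E (cyc E y)) := by
  rw [inner_emb_cyc]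
  simp only [cyc_apply, map_sum, sum_inner, inner_emb_cre_left]

/-- A log-convex sequence of at most geometric growth of rate `C` satisfies `b₁ ≤ C b₀`. -/
theorem le_mul_of_logConvex {b : ℕ → ℝ} {C K : ℝ} (hb : ∀ k, 0 ≤ b k) (hC : 0 ≤ C)
    (hconv : ∀ k, b (k + 1) ^ 2 ≤ b k * b (k + 2)) (hgrow : ∀ k, b k ≤ K * C ^ k) :
    b 1 ≤ C * b 0 := by
  by_contra! h
  -- the ratio of the first two terms, if larger than `C`, would persist along the sequence
  rcases (hb 0).eq_or_lt with h0 | h0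
  · have h1 := hconv 0
    rw [← h0] at h h1
    nlinarith
  have h1 : 0 < b 1 := lt_of_le_of_lt (by positivity) h
  set r := b 1 / b 0 with hr
  have hrC : C < r := by rw [hr, lt_div_iff₀ h0]; exact h
  have hr0 : 0 < r := by positivity
  have hstep : ∀ k, 0 < b k ∧ r * b k ≤ b (k + 1) := by
    intro k
    induction k with
    | zero => exact ⟨h0, by rw [hr]; field_simp; exact le_rfl⟩
    | succ k ih =>
      obtain ⟨hk, hk'⟩ := ih
      have hpos : 0 < b (k + 1) := lt_of_lt_of_le (by positivity) hk'
      refine ⟨hpos, ?_⟩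
      have h2 := hconv k
      have h3 : b k * (r * b (k + 1)) ≤ b k * b (k + 2) := by nlinarith
      exact le_of_mul_le_mul_left h3 hk
  have hpow : ∀ k, r ^ k * b 0 ≤ b k := by
    intro k
    induction k with
    | zero => simp
    | succ k ih =>
      refine le_trans ?_ (hstep k).2
      rw [pow_succ', mul_assoc]
      exact mul_le_mul_of_nonneg_left ih hr0.le
  rcases hC.eq_or_lt with rfl | hC0
  · have := hgrow 1
    simp at this
    linarith
  · obtain ⟨n, hn⟩ := pow_unbounded_of_one_lt (K / b 0) ((one_lt_div hC0).mpr hrC)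
    have h2 := (hpow n).trans (hgrow n)
    rw [div_pow, div_lt_div_iff₀ h0 (by positivity)] at hn
    linarith

theorem exists_norm_emb_le_wnorm (E : AdaptedBasis D d) (n : ℕ) :
    ∃ K : ℝ, 0 ≤ K ∧ ∀ x ∈ deg E n, ‖emb E x‖ ≤ K * wnorm E x := by
  obtain ⟨K, hK⟩ := ((finite_words d n).image fun l => ‖emb E (wordVec E l)‖).bddAbove
  refine ⟨max K 0, le_max_right _ _, fun x hx => ?_⟩
  exact seminorm_le_wnorm E ((normSeminorm ℂ (Fock E)).comp (emb E))
    (fun l hl => (hK ⟨l, hl, rfl⟩).trans (le_max_left _ _)) hx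

/-- The inverse of `1 + T_1 + T_1 T_2 + ⋯` is bounded uniformly in the degree, both for the `ℓ¹`
norm and for the `T`-norm. It is symmetric for the `T`-inner product, so the norms of the iterated
preimages of a vector form a log-convex sequence, which grows no faster than their `ℓ¹` norms. -/
theorem exists_cyc_eq_norm (E : AdaptedBasis D d) : ∃ C : ℝ, 0 ≤ C ∧
    ∀ (n : ℕ), ∀ x ∈ deg E (n + 1), ∃ y ∈ deg E (n + 1), cyc E y = x ∧
      wnorm E y ≤ C * wnorm E x ∧ ‖emb E y‖ ≤ C * ‖emb E x‖ := by
  obtain ⟨C, hC, h⟩ := exists_cyc_eq E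
  refine ⟨C, hC, fun n x hx => ?_⟩
  choose f hf hcyc hw using h n
  let g : deg E (n + 1) → deg E (n + 1) := fun z => ⟨f z.1 z.2, hf z.1 z.2⟩
  let s : ℕ → deg E (n + 1) := fun k => g^[k] ⟨x, hx⟩
  have hsucc : ∀ k, s (k + 1) = g (s k) := fun k => Function.iterate_succ_apply' g k _
  have hs : ∀ k, cyc E (s (k + 1)).1 = (s k).1 := fun k => by
    rw [hsucc]; exact hcyc (s k).1 (s k).2
  have hsw : ∀ k, wnorm E (s k : FockAlg V) ≤ C ^ k * wnorm E x := by
    intro k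
    induction k with
    | zero => simp [s]
    | succ k ih =>
      rw [hsucc]
      refine (hw (s k).1 (s k).2).trans ?_
      rw [pow_succ', mul_assoc]
      exact mul_le_mul_of_nonneg_left ih hC
  refine ⟨s 1, (s 1).2, hs 0, ?_, ?_⟩
  · simpa using hsw 1
  obtain ⟨K, hK0, hK⟩ := exists_norm_emb_le_wnorm E (n + 1)
  refine le_mul_of_logConvex (b := fun k => ‖emb E (s k)‖) (K := K * wnorm E x)
    (fun k => norm_nonneg _) hC (fun k => ?_) fun k => ?_
  · have h1 : ‖emb E (s (k + 1) : FockAlg V)‖ ^ 2 =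
        RCLike.re (inner ℂ (emb E (s k : FockAlg V)) (emb E (s (k + 2) : FockAlg V))) := by
      rw [← inner_self_eq_norm_sq (𝕜 := ℂ)]
      have h2 := inner_cyc_emb E (s (k + 2) : FockAlg V) (s (k + 1) : FockAlg V)
      rw [hs (k + 1), hs k] at h2
      rw [h2, ← inner_conj_symm, RCLike.conj_re]
    rw [h1]
    exact re_inner_le_norm _ _
  · refine (hK _ (s k).2).trans ?_
    calc K * wnorm E (s k : FockAlg V) ≤ K * (C ^ k * wnorm E x) :=
          mul_le_mul_of_nonneg_left (hsw k) hK0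
      _ = _ := by ring

/-- Different degrees are orthogonal. -/
theorem inner_emb_of_deg_ne (E : AdaptedBasis D d) {n : ℕ} : ∀ {m : ℕ}, n ≠ m →
    ∀ {x y : FockAlg V}, x ∈ deg E n → y ∈ deg E m → inner ℂ (emb E x) (emb E y) = 0 := by
  have hzero : ∀ {m : ℕ} {x y : FockAlg V}, x ∈ deg E 0 → y ∈ deg E (m + 1) →
      inner ℂ (emb E x) (emb E y) = 0 := by
    intro m x y hx hy
    refine exists_cre_of_mem_deg E (p := fun y => inner ℂ (emb E x) (emb E y) = 0) (by simp)
      (fun y z hy hz => by rw [map_add, inner_add_right, hy, hz, add_zero])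
      (fun c y hy => by rw [map_smul, inner_smul_right, hy, mul_zero]) (fun k y _ => ?_) hy
    rw [inner_emb_cre_right, ann_eq_zero_of_mem_deg E k hx, map_zero, inner_zero_left]
  induction n with
  | zero =>
    intro m hm x y hx hy
    obtain ⟨m, rfl⟩ := Nat.exists_eq_succ_of_ne_zero hm.symm
    exact hzero hx hy
  | succ n ih =>
    intro m hm x y hx hy
    rcases m with _ | m
    · rw [← inner_conj_symm, hzero hy hx, map_zero]
    · refine exists_cre_of_mem_deg E (p := fun x => inner ℂ (emb E x) (emb E y) = 0) (by simp)
        (fun x z hx hz => by rw [map_add, inner_add_left, hx, hz, add_zero])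
        (fun c x hx => by rw [map_smul, inner_smul_left, hx, mul_zero]) (fun k x hx => ?_) hx
      rw [inner_emb_cre_left]
      exact ih (by omega) hx (ann_mem_deg E k hy)

theorem iSup_deg (E : AdaptedBasis D d) : ⨆ n, deg E n = ⊤ := by
  rw [eq_top_iff, ← (wordVec E).span_eq, Submodule.span_le]
  rintro _ ⟨l, rfl⟩
  exact Submodule.mem_iSup_of_mem l.length (wordVec_mem_deg E l)

theorem norm_sq_sum_of_orthogonal {H ι : Type*} [NormedAddCommGroup H] [InnerProductSpace ℂ H]
    (s : Finset ι) (v : ι → H) (hv : ∀ i j, i ≠ j → inner ℂ (v i) (v j) = 0) :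
    ‖∑ i ∈ s, v i‖ ^ 2 = ∑ i ∈ s, ‖v i‖ ^ 2 := by
  classical
  rw [← inner_self_eq_norm_sq (𝕜 := ℂ), sum_inner, map_sum]
  refine Finset.sum_congr rfl fun i hi => ?_
  rw [inner_sum, Finset.sum_eq_single_of_mem i hi fun j _ hj => hv i j hj.symm,
    inner_self_eq_norm_sq]

/-- A bound on the single degrees extends to the whole Fock space for an operator that preserves
orthogonality of the degrees. -/
theorem norm_emb_le_of_deg (E : AdaptedBasis D d) (f : Module.End ℂ (FockAlg V)) {C : ℝ}
    (hC : 0 ≤ C) (horth : ∀ n m, n ≠ m → ∀ x ∈ deg E n, ∀ y ∈ deg E m,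
      inner ℂ (emb E (f x)) (emb E (f y)) = 0)
    (hb : ∀ n, ∀ x ∈ deg E n, ‖emb E (f x)‖ ≤ C * ‖emb E x‖) (x : FockAlg V) :
    ‖emb E (f x)‖ ≤ C * ‖emb E x‖ := by
  have hx : x ∈ ⨆ n, deg E n := by rw [iSup_deg]; trivial
  obtain ⟨c, hc, rfl⟩ := (Submodule.mem_iSup_iff_exists_finsupp _ _).mp hx
  refine le_of_sq_le_sq ?_ (by positivity)
  rw [Finsupp.sum, map_sum, map_sum, map_sum, mul_pow,
    norm_sq_sum_of_orthogonal _ _ fun i j hij => horth i j hij _ (hc i) _ (hc j),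
    norm_sq_sum_of_orthogonal _ _ fun i j hij => inner_emb_of_deg_ne E hij (hc i) (hc j),
    Finset.mul_sum]
  refine Finset.sum_le_sum fun i _ => ?_
  rw [← mul_pow]
  exact pow_le_pow_left₀ (norm_nonneg _) (hb i _ (hc i)) 2

/-! ### Bounded operators -/

/-- The operator `f` on the algebraic Fock space extends to a bounded operator. -/
def Extends (E : AdaptedBasis D d) (f : Module.End ℂ (FockAlg V)) : Prop :=
  ∃ L, IsExtension E f L

theorem extends_of_norm_le (E : AdaptedBasis D d) {f : Module.End ℂ (FockAlg V)} (C : ℝ)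
    (h : ∀ x, ‖emb E (f x)‖ ≤ C * ‖emb E x‖) : Extends E f :=
  ⟨(emb E ∘ₗ f).extendOfNorm (emb E), fun x =>
    LinearMap.extendOfNorm_eq (denseRange_emb E) ⟨C, h⟩ x⟩

theorem clm_ext {E : AdaptedBasis D d} {F : Type*} [TopologicalSpace F] [AddCommMonoid F]
    [Module ℂ F] [T2Space F] {L L' : Fock E →L[ℂ] F}
    (h : ∀ x, L (emb E x) = L' (emb E x)) : L = L' :=
  ContinuousLinearMap.ext fun v => congrFun
    ((denseRange_emb E).equalizer L.continuous L'.continuous (funext h)) v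

theorem extension_emb {E : AdaptedBasis D d} {f : Module.End ℂ (FockAlg V)} (h : Extends E f)
    (x : FockAlg V) : extension E f (emb E x) = emb E (f x) := by
  have h' : ∃ L, IsExtension E f L := h
  rw [extension, dif_pos h']
  exact h'.choose_spec x

theorem Extends.add {E : AdaptedBasis D d} {f g : Module.End ℂ (FockAlg V)} (hf : Extends E f)
    (hg : Extends E g) : Extends E (f + g) := by
  obtain ⟨L, hL⟩ := hf
  obtain ⟨L', hL'⟩ := hg
  exact ⟨L + L', fun x => by simp [hL x, hL' x]⟩

theorem Extends.smul {E : AdaptedBasis D d} {f : Module.End ℂ (FockAlg V)} (c : ℂ)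
    (hf : Extends E f) : Extends E (c • f) := by
  obtain ⟨L, hL⟩ := hf
  exact ⟨c • L, fun x => by simp [hL x]⟩

theorem Extends.sum {E : AdaptedBasis D d} {ι : Type*} (s : Finset ι)
    {f : ι → Module.End ℂ (FockAlg V)} (hf : ∀ i, Extends E (f i)) : Extends E (∑ i ∈ s, f i) := by
  choose L hL using hf
  exact ⟨∑ i ∈ s, L i, fun x => by
    simp only [sum_apply, LinearMap.sum_apply, map_sum, hL _ x]⟩

/-- The bound follows from `‖a_k^* x‖² = ‖x‖² + q ‖a_k x‖²` by induction on the degree, `a_k` having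
on degree `n + 1` the norm of its adjoint `a_k^*` on degree `n`. -/
theorem norm_sq_cre_le (E : AdaptedBasis D d) {q : ℝ} (hq0 : 0 ≤ q) (hq1 : q < 1)
    (hq : ∀ k l, ‖twc E k l‖ ≤ q) (k : Fin d) {n : ℕ} : ∀ x ∈ deg E n,
    ‖emb E (cre E k x)‖ ^ 2 ≤ (1 - q)⁻¹ * ‖emb E x‖ ^ 2 := by
  have h1 : 0 < 1 - q := by linarith
  have hid : 1 + q * (1 - q)⁻¹ = (1 - q)⁻¹ := by field_simp; ring
  have hmain : ∀ x, ‖emb E (cre E k x)‖ ^ 2 ≤ ‖emb E x‖ ^ 2 + q * ‖emb E (ann E k x)‖ ^ 2 := by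
    intro x
    rw [← inner_self_eq_norm_sq (𝕜 := ℂ), inner_emb_cre_left, ann_cre, if_pos rfl, map_add,
      inner_add_right, map_smul, inner_smul_right, inner_emb_cre_right, map_add,
      inner_self_eq_norm_sq, inner_self_eq_norm_sq_to_K]
    refine add_le_add_right ?_ _
    refine (Complex.re_le_norm _).trans ?_
    rw [norm_mul, norm_pow]
    simp only [Complex.coe_algebraMap, Complex.norm_real, norm_norm]
    exact mul_le_mul_of_nonneg_right (hq k k) (by positivity)
  induction n with
  | zero =>
    intro x hx
    have h2 := hmain x
    rw [ann_eq_zero_of_mem_deg E k hx, map_zero, norm_zero] at h2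
    have h3 : 1 ≤ (1 - q)⁻¹ := by rw [← hid]; have := mul_nonneg hq0 (inv_pos.mpr h1).le; linarith
    nlinarith [sq_nonneg ‖emb E x‖]
  | succ n ih =>
    intro x hx
    have h2 := hmain x
    have h3 : ‖emb E (ann E k x)‖ ^ 2 ≤ (1 - q)⁻¹ * ‖emb E x‖ ^ 2 := by
      have h4 := ih _ (ann_mem_deg E k hx)
      set u := ‖emb E (ann E k x)‖
      have h5 : u ^ 2 ≤ ‖emb E (cre E k (ann E k x))‖ * ‖emb E x‖ := by
        rw [← inner_self_eq_norm_sq (𝕜 := ℂ), ← inner_emb_cre_left]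
        exact re_inner_le_norm _ _
      have h6 : (u ^ 2) ^ 2 ≤ (1 - q)⁻¹ * u ^ 2 * ‖emb E x‖ ^ 2 := by
        refine (pow_le_pow_left₀ (by positivity) h5 2).trans ?_
        rw [mul_pow]
        exact mul_le_mul_of_nonneg_right h4 (by positivity)
      rcases (sq_nonneg u).eq_or_lt with h7 | h7
      · rw [← h7]; positivity
      · refine le_of_mul_le_mul_left ?_ h7
        nlinarith
    rw [← hid, add_mul, one_mul, mul_assoc]
    exact h2.trans (add_le_add_right (mul_le_mul_of_nonneg_left h3 hq0) _)

theorem extends_cre (E : AdaptedBasis D d) (k : Fin d) : Extends E (cre E k) := by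
  obtain ⟨q, hq0, hq1, hq⟩ := exists_tw_bound E
  have h1 : 0 < 1 - q := by linarith
  refine extends_of_norm_le E √((1 - q)⁻¹) (norm_emb_le_of_deg E _ (by positivity) ?_ ?_)
  · intro n m hnm x hx y hy
    exact inner_emb_of_deg_ne E (by omega) (cre_mem_deg E k hx) (cre_mem_deg E k hy)
  · intro n x hx
    refine le_of_sq_le_sq ?_ (by positivity)
    rw [mul_pow, Real.sq_sqrt (by positivity)]
    exact norm_sq_cre_le E hq0 hq1 hq k x hx

/-- If `f` extends to a bounded operator, so does an adjoint of `f` on the algebraic Fock space. -/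
theorem Extends.of_adjoint {E : AdaptedBasis D d} {f g : Module.End ℂ (FockAlg V)}
    (hf : Extends E f) (h : ∀ x y, inner ℂ (emb E (f x)) (emb E y) =
      inner ℂ (emb E x) (emb E (g y))) : Extends E g := by
  obtain ⟨L, hL⟩ := hf
  refine ⟨ContinuousLinearMap.adjoint L, fun y => ?_⟩
  refine ext_inner_left ℂ fun v => ?_
  rw [ContinuousLinearMap.adjoint_inner_right]
  refine (denseRange_emb E).induction_on (p := fun v => inner ℂ (L v) (emb E y) =
    inner ℂ v (emb E (g y))) v (isClosed_eq (by fun_prop) (by fun_prop)) fun x => ?_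
  rw [hL x, h]

theorem adjoint_extension {E : AdaptedBasis D d} {f g : Module.End ℂ (FockAlg V)}
    (hf : Extends E f) (h : ∀ x y, inner ℂ (emb E (f x)) (emb E y) =
      inner ℂ (emb E x) (emb E (g y))) :
    ContinuousLinearMap.adjoint (extension E f) = extension E g := by
  refine clm_ext fun y => ?_
  rw [extension_emb (hf.of_adjoint h)]
  refine ext_inner_left ℂ fun v => ?_
  rw [ContinuousLinearMap.adjoint_inner_right]
  refine (denseRange_emb E).induction_on (p := fun v => inner ℂ (extension E f v) (emb E y) =
    inner ℂ v (emb E (g y))) v (isClosed_eq (by fun_prop) (by fun_prop)) fun x => ?_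
  rw [extension_emb hf, h]

theorem extends_ann (E : AdaptedBasis D d) (k : Fin d) : Extends E (ann E k) :=
  (extends_cre E k).of_adjoint (inner_emb_cre_left E k)

theorem extends_strip (E : AdaptedBasis D d) (k : Fin d) : Extends E (strip E k) := by
  obtain ⟨C, hC, h⟩ := exists_cyc_eq_norm E
  have hstrip0 : ∀ x ∈ deg E 0, strip E k x = 0 := by
    intro x hx
    refine eq_of_mem_deg E (strip E k) 0 (fun l hl => ?_) hx
    rw [List.length_eq_zero_iff.mp hl]; simp
  refine extends_of_norm_le E √C (norm_emb_le_of_deg E _ (by positivity) ?_ ?_)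
  · intro n m hnm x hx y hy
    rcases n with _ | n
    · rw [hstrip0 x hx]; simp
    rcases m with _ | m
    · rw [hstrip0 y hy]; simp
    obtain ⟨x, hx', rfl, -⟩ := h n x hx
    obtain ⟨y, hy', rfl, -⟩ := h m y hy
    rw [strip_cyc, strip_cyc]
    exact inner_emb_of_deg_ne E (by omega) (ann_mem_deg E k hx') (ann_mem_deg E k hy')
  · intro n x hx
    rcases n with _ | n
    · rw [hstrip0 x hx, map_zero, norm_zero]; positivity
    refine le_of_sq_le_sq ?_ (by positivity)
    obtain ⟨y, hy, rfl, -, hyn⟩ := h n x hx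
    rw [strip_cyc, mul_pow, Real.sq_sqrt hC]
    -- the vector is `cyc y`, and `∑ j, ‖ann j y‖² = ⟨y, cyc y⟩`
    calc ‖emb E (ann E k y)‖ ^ 2 ≤ ∑ j, ‖emb E (ann E j y)‖ ^ 2 :=
          Finset.single_le_sum (f := fun j => ‖emb E (ann E j y)‖ ^ 2)
            (fun j _ => sq_nonneg _) (Finset.mem_univ k)
      _ = RCLike.re (inner ℂ (emb E y) (emb E (cyc E y))) := by
          rw [inner_emb_cyc, map_sum]
          exact Finset.sum_congr rfl fun j _ => (inner_self_eq_norm_sq _).symm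
      _ ≤ ‖emb E y‖ * ‖emb E (cyc E y)‖ := re_inner_le_norm _ _
      _ ≤ C * ‖emb E (cyc E y)‖ * ‖emb E (cyc E y)‖ :=
          mul_le_mul_of_nonneg_right hyn (norm_nonneg _)
      _ = _ := by ring

theorem coord_cons (E : AdaptedBasis D d) (k : Fin d) (l : List (Fin d)) (x : FockAlg V) :
    (wordVec E).repr x (k :: l) = (wordVec E).repr (strip E k x) l := by
  refine LinearMap.congr_fun (f := (wordVec E).coord (k :: l))
    (g := (wordVec E).coord l ∘ₗ strip E k) ?_ x
  refine (wordVec E).ext fun l' => ?_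
  rcases l' with _ | ⟨j, l'⟩
  · rw [LinearMap.comp_apply, Module.Basis.coord_apply, Module.Basis.repr_self]
    simp
  · rw [LinearMap.comp_apply, Module.Basis.coord_apply, Module.Basis.repr_self, wordVec_cons,
      strip_cre, Module.Basis.coord_apply, Finsupp.single_apply]
    by_cases h : k = j
    · subst h; simp [Finsupp.single_apply]
    · have : ¬ (j = k) := fun e => h e.symm
      simp [h, this]

/-- The `T`-inner product is definite: the coefficients of `x` are the vacuum coefficients of
vectors obtained from `x` by the operators `l(e_k)`, which are bounded for the `T`-norm. -/
theorem emb_injective (E : AdaptedBasis D d) : Function.Injective (emb E) := by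
  rw [← LinearMap.ker_eq_bot, LinearMap.ker_eq_bot']
  have : ∀ (l : List (Fin d)) (x : FockAlg V), emb E x = 0 → (wordVec E).repr x l = 0 := by
    intro l
    induction l with
    | nil =>
      intro x hx
      have := inner_vac_emb E x
      rw [hx, inner_zero_right] at this
      exact this.symm
    | cons k l ih =>
      intro x hx
      rw [coord_cons]
      refine ih _ ?_
      rw [← extension_emb (extends_strip E k), hx, map_zero]
  intro x hx
  exact (wordVec E).repr.map_eq_zero_iff.mp (Finsupp.ext fun l => this l x hx)

/-! ### The deformed one-particle inner product -/

theorem commute_ringInverse {R : Type*} [Ring R] {a b : R} (h : Commute a b) :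
    Commute a (Ring.inverse b) := by
  by_cases hb : IsUnit b
  · obtain ⟨u, rfl⟩ := hb
    rw [Ring.inverse_unit]
    exact h.units_inv_right
  · rw [Ring.inverse_non_unit _ hb]
    exact Commute.zero_right a

theorem AWData.U_zero (D : AWData V N) : D.U 0 = 1 := by
  have := D.U_add 0 0
  rw [add_zero] at this
  exact left_eq_mul.mp this

theorem AWData.inner_U_left (D : AWData V N) (t : ℝ) (x y : V) :
    inner ℝ (D.U t x) y = inner ℝ x (D.U (-t) y) := by
  rw [← (D.U (-t)).inner_map_map (D.U t x) y]
  have : D.U (-t) (D.U t x) = x := by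
    have h := D.U_add (-t) t
    rw [neg_add_cancel, D.U_zero] at h
    exact (DFunLike.congr_fun h x).symm
  rw [this]

theorem hasDerivAt_U_apply (U : ℝ → (V ≃ₗᵢ[ℝ] V))
    (h : DifferentiableAt ℝ (fun t : ℝ => ((U t).toContinuousLinearEquiv : V →L[ℝ] V)) 0) (x : V) :
    HasDerivAt (fun t => U t x) (infGenerator U x) 0 :=
  h.hasDerivAt.clm_apply (hasDerivAt_const 0 x) |>.congr_deriv (by simp [infGenerator])

/-- The infinitesimal generator is skew-symmetric. No differentiability is needed, since `0`, the
value of `deriv` at a point where it does not exist, is skew-symmetric as well. -/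
theorem inner_infGenerator (D : AWData V N) (x y : V) :
    inner ℝ (infGenerator D.U x) y = -inner ℝ x (infGenerator D.U y) := by
  by_cases h : DifferentiableAt ℝ
    (fun t : ℝ => ((D.U t).toContinuousLinearEquiv : V →L[ℝ] V)) 0
  · have h1 := (hasDerivAt_U_apply D.U h x).inner ℝ (hasDerivAt_U_apply D.U h y)
    have h2 : (fun t => inner ℝ (D.U t x) (D.U t y)) = fun _ => inner ℝ x y := by
      funext t; exact (D.U t).inner_map_map x y
    rw [h2, D.U_zero] at h1
    have h3 := h1.unique (hasDerivAt_const (0 : ℝ) (inner ℝ x y))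
    simp only [LinearIsometryEquiv.coe_one, id_eq] at h3
    linarith
  · simp [infGenerator, deriv_zero_of_not_differentiableAt h]

theorem infGenerator_comm (D : AWData V N) (p : V →L[ℝ] V)
    (hp : ∀ t x, p (D.U t x) = D.U t (p x)) (x : V) :
    p (infGenerator D.U x) = infGenerator D.U (p x) := by
  by_cases h : DifferentiableAt ℝ
    (fun t : ℝ => ((D.U t).toContinuousLinearEquiv : V →L[ℝ] V)) 0
  · have h1 := p.hasFDerivAt.comp_hasDerivAt (0 : ℝ) (hasDerivAt_U_apply D.U h x)
    refine h1.unique ((hasDerivAt_U_apply D.U h (p x)).congr_of_eventuallyEq ?_)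
    exact Filter.Eventually.of_forall fun t => hp t x
  · simp [infGenerator, deriv_zero_of_not_differentiableAt h]

@[simp] theorem mapCLM_re (f : V →L[ℝ] V) (z : Cplx V) : (Cplx.mapCLM f z).re = f z.re := rfl

@[simp] theorem mapCLM_im (f : V →L[ℝ] V) (z : Cplx V) : (Cplx.mapCLM f z).im = f z.im := rfl

theorem Cplx.neg_re (z : Cplx V) : (-z).re = -z.re := rfl

theorem Cplx.neg_im (z : Cplx V) : (-z).im = -z.im := rfl

theorem AdaptedBasis.completeSpace (E : AdaptedBasis D d) : CompleteSpace (Cplx V) :=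
  have : FiniteDimensional ℂ (Cplx V) := E.e.finiteDimensional_of_finite
  FiniteDimensional.complete ℂ (Cplx V)

/-- The operator `2 (1 + A⁻¹)⁻¹` of the deformed inner product. -/
def deformOp (D : AWData V N) : Cplx V →L[ℂ] Cplx V :=
  (2 : ℂ) • Ring.inverse (1 + Ring.inverse (analyticGenerator D.U))

theorem innerU_eq (D : AWData V N) (x y : Cplx V) :
    innerU D.U x y = inner ℂ x (deformOp D y) := rfl

/-- The scalar `⟨ē_l, e_k⟩_U`. -/
def conjMat (E : AdaptedBasis D d) (l k : Fin d) : ℂ := innerU D.U (E.e l).bar (E.e k)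

theorem conjMat_def (E : AdaptedBasis D d) (l k : Fin d) :
    conjMat E l k = innerU D.U (E.e l).bar (E.e k) := rfl

theorem twc_congr (E : AdaptedBasis D d) {j j' : Fin d} (h : E.col j = E.col j') :
    twc E j = twc E j' := by
  funext k; rw [twc, twc, AdaptedBasis.tw, AdaptedBasis.tw, h]

/-- The orthogonal projection onto a summand of the decomposition. -/
def compProj [FiniteDimensional ℝ V] (D : AWData V N) (i : N) : V →L[ℝ] V :=
    (D.comp i).starProjection

theorem compProj_U [FiniteDimensional ℝ V] (D : AWData V N) (i : N) (t : ℝ) (x : V) :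
    compProj D i (D.U t x) = D.U t (compProj D i x) := by
  refine (Submodule.eq_starProjection_of_mem_orthogonal ?_ ?_)
  · exact D.comp_invariant i t _ (Submodule.starProjection_apply_mem _ x)
  · rw [← map_sub, Submodule.mem_orthogonal']
    intro y hy
    rw [D.inner_U_left]
    have := Submodule.sub_starProjection_mem_orthogonal (K := D.comp i) x
    rw [Submodule.mem_orthogonal'] at this
    exact this _ (D.comp_invariant i (-t) y hy)

theorem compProj_eq_self [FiniteDimensional ℝ V] (D : AWData V N) {i : N} {x : V}
    (hx : x ∈ D.comp i) :
    compProj D i x = x := Submodule.starProjection_eq_self_iff.mpr hx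

theorem compProj_eq_zero [FiniteDimensional ℝ V] (D : AWData V N) {i j : N} (hij : i ≠ j) {x : V}
    (hx : x ∈ D.comp j) :
    compProj D i x = 0 := by
  refine (D.comp i).starProjection_apply_eq_zero_iff.mpr ?_
  rw [Submodule.mem_orthogonal]
  exact fun y hy => D.comp_orthogonal i j hij y hy x hx

theorem isSelfAdjoint_deformOp [CompleteSpace (Cplx V)] (D : AWData V N) :
    IsSelfAdjoint (deformOp D) := by
  have h1 : IsSelfAdjoint (-Complex.I • Cplx.mapCLM (infGenerator D.U)) := by
    rw [ContinuousLinearMap.isSelfAdjoint_iff_isSymmetric]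
    intro z w
    simp only [ContinuousLinearMap.coe_coe, smul_apply, Cplx.inner_def]
    apply Complex.ext
    · simp [inner_infGenerator, Cplx.neg_re, Cplx.neg_im]; ring
    · simp [inner_infGenerator, Cplx.neg_re, Cplx.neg_im]; ring
  have h2 : IsSelfAdjoint (analyticGenerator D.U) := h1.exp
  have h3 : IsSelfAdjoint (1 + Ring.inverse (analyticGenerator D.U)) :=
    (IsSelfAdjoint.one _).add h2.ringInverse
  have h4 : IsSelfAdjoint (2 : ℂ) := by simp
  exact h4.smul h3.ringInverse

theorem conj_innerU (E : AdaptedBasis D d) (x y : Cplx V) :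
    conj (innerU D.U x y) = innerU D.U y x := by
  have := E.completeSpace
  rw [innerU_eq, innerU_eq, inner_conj_symm]
  exact (ContinuousLinearMap.isSelfAdjoint_iff_isSymmetric.mp (isSelfAdjoint_deformOp D)) y x

theorem commute_deformOp [FiniteDimensional ℝ V] [CompleteSpace (Cplx V)] (D : AWData V N) (i : N) :
    Commute (Cplx.mapCLM (compProj D i)) (deformOp D) := by
  have h1 : Commute (Cplx.mapCLM (compProj D i))
      (-Complex.I • Cplx.mapCLM (infGenerator D.U)) := by
    refine Commute.smul_right ?_ _
    refine ContinuousLinearMap.ext fun z => ?_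
    ext
    · exact infGenerator_comm D _ (compProj_U D i) z.re
    · exact infGenerator_comm D _ (compProj_U D i) z.im
  have h2 : Commute (Cplx.mapCLM (compProj D i)) (analyticGenerator D.U) := h1.exp_right
  exact (commute_ringInverse ((Commute.one_right _).add_right
    (commute_ringInverse h2))).smul_right _

/-- Different summands are orthogonal for the deformed inner product. -/
theorem innerU_eq_zero [FiniteDimensional ℝ V] (E : AdaptedBasis D d) {i j : N} (hij : i ≠ j)
    {x y : Cplx V}
    (hx : x.re ∈ D.comp i ∧ x.im ∈ D.comp i) (hy : y.re ∈ D.comp j ∧ y.im ∈ D.comp j) :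
    innerU D.U x y = 0 := by
  have := E.completeSpace
  have h1 : Cplx.mapCLM (compProj D i) x = x := by
    ext
    · exact compProj_eq_self D hx.1
    · exact compProj_eq_self D hx.2
  have h2 : Cplx.mapCLM (compProj D i) y = 0 := by
    ext
    · exact compProj_eq_zero D hij hy.1
    · exact compProj_eq_zero D hij hy.2
  have h3 : ∀ z w, inner ℂ (Cplx.mapCLM (compProj D i) z) w =
      inner ℂ z (Cplx.mapCLM (compProj D i) w) := by
    have hs : ∀ u v : V, inner ℝ (compProj D i u) v = inner ℝ u (compProj D i v) :=
      (D.comp i).starProjection_isSymmetric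
    intro z w
    simp only [Cplx.inner_def, mapCLM_re, mapCLM_im, hs]
  have h4 : Cplx.mapCLM (compProj D i) (deformOp D y) =
      deformOp D (Cplx.mapCLM (compProj D i) y) :=
    DFunLike.congr_fun (commute_deformOp D i).eq y
  rw [innerU_eq, ← h1, h3, h4, h2, map_zero, inner_zero_right]

theorem col_eq_of_conjMat_ne_zero [FiniteDimensional ℝ V] (E : AdaptedBasis D d) {l k : Fin d}
    (h : conjMat E l k ≠ 0) : E.col l = E.col k := by
  by_contra hc
  refine h (innerU_eq_zero E hc ⟨(E.e_mem l).1, ?_⟩ (E.e_mem k))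
  exact neg_mem (E.e_mem l).2

/-! ### Right annihilation operators and the reversal of words -/

/-- The values of the right annihilation operator on words. -/
def rannWord (E : AdaptedBasis D d) (k : Fin d) : List (Fin d) → FockAlg V
  | [] => 0
  | j :: l => cre E j (rannWord E k l) + if j = k then diag E (twc E k) (wordVec E l) else 0

/-- The right annihilation operator, which removes a letter `k` from a word with the weight of the
letters to its right; the adjoint of right multiplication by `e_k`. -/
def rann (E : AdaptedBasis D d) (k : Fin d) : Module.End ℂ (FockAlg V) :=
  (wordVec E).constr ℂ (rannWord E k)

@[simp] theorem rann_one (E : AdaptedBasis D d) (k : Fin d) : rann E k 1 = 0 := by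
  rw [← wordVec_nil E, rann, Module.Basis.constr_basis, rannWord]

theorem rann_cre (E : AdaptedBasis D d) (k j : Fin d) (x : FockAlg V) :
    rann E k (cre E j x) = cre E j (rann E k x) + if j = k then diag E (twc E k) x else 0 := by
  have : rann E k ∘ₗ cre E j = cre E j ∘ₗ rann E k +
      if j = k then diag E (twc E k) else 0 := by
    refine (wordVec E).ext fun l => ?_
    rw [LinearMap.comp_apply, ← wordVec_cons, LinearMap.add_apply, LinearMap.comp_apply, rann,
      Module.Basis.constr_basis, Module.Basis.constr_basis, rannWord]
    split_ifs <;> rfl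
  refine (LinearMap.congr_fun this x).trans ?_
  rw [LinearMap.add_apply]
  split_ifs <;> rfl

theorem rann_diag (E : AdaptedBasis D d) (κ : Fin d → ℂ) (k : Fin d) (x : FockAlg V) :
    rann E k (diag E κ x) = κ k • diag E κ (rann E k x) := by
  have hcomm : ∀ κ κ' (x : FockAlg V), diag E κ (diag E κ' x) = diag E κ' (diag E κ x) := by
    intro κ κ' x
    refine LinearMap.congr_fun (f := diag E κ ∘ₗ diag E κ') (g := diag E κ' ∘ₗ diag E κ) ?_ x
    refine (wordVec E).ext fun l => ?_
    simp only [LinearMap.comp_apply, diag_wordVec, map_smul, smul_smul]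
    rw [mul_comm]
  refine ext_cre E (f := rann E k ∘ₗ diag E κ) (g := κ k • diag E κ ∘ₗ rann E k) (by simp)
    (fun j x hx => ?_) x
  simp only [LinearMap.comp_apply, LinearMap.smul_apply] at hx ⊢
  rw [diag_cre, map_smul, rann_cre, hx, rann_cre, map_add, diag_cre, smul_add, smul_add, map_smul,
    smul_smul, smul_smul, mul_comm]
  congr 1
  split_ifs with h
  · rw [h, hcomm]
  · simp

/-- Left and right annihilation operators commute. -/
theorem ann_rann (E : AdaptedBasis D d) (l k : Fin d) (x : FockAlg V) :
    ann E l (rann E k x) = rann E k (ann E l x) := by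
  refine ext_cre E (f := ann E l ∘ₗ rann E k) (g := rann E k ∘ₗ ann E l) (by simp)
    (fun j x hx => ?_) x
  simp only [LinearMap.comp_apply] at hx ⊢
  rw [rann_cre, ann_cre, map_add, ann_cre, map_add, map_smul, rann_cre, smul_add, hx]
  rw [← add_assoc]
  have h1 : rann E k (if l = j then x else 0) = if l = j then rann E k x else 0 := by
    split_ifs <;> simp
  rw [h1]
  congr 1
  split_ifs with h
  · rw [ann_diag, h, twc_symm]
  · simp

theorem rann_rcre (E : AdaptedBasis D d) (k j : Fin d) (x : FockAlg V) :
    rann E k (rcre E j x) =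
      (if k = j then x else 0) + twc E k j • rcre E j (rann E k x) := by
  have := ext_cre E (f := rann E k ∘ₗ rcre E j) (g := (if k = j then LinearMap.id else 0) +
    twc E k j • rcre E j ∘ₗ rann E k) ?_ (fun i x hx => ?_) x
  · simp only [LinearMap.comp_apply, LinearMap.add_apply, LinearMap.smul_apply] at this
    rw [this]
    split_ifs <;> rfl
  · simp only [LinearMap.comp_apply, LinearMap.add_apply, LinearMap.smul_apply, rcre_one, rann_cre,
      rann_one, map_zero, smul_zero, add_zero, zero_add, diag_one]
    by_cases h : k = j
    · simp [h]
    · simp [h, Ne.symm h]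
  · simp only [LinearMap.comp_apply, LinearMap.add_apply, LinearMap.smul_apply] at hx ⊢
    rw [rcre_cre, rann_cre, hx, rann_cre, map_add, map_add, map_smul, rcre_cre, smul_add,
      ← add_assoc]
    congr 1
    · congr 1
      split_ifs <;> simp
    · split_ifs
      · rw [diag_rcre]
      · simp

theorem vacCoeff_diag (E : AdaptedBasis D d) (κ : Fin d → ℂ) (x : FockAlg V) :
    vacCoeff E (diag E κ x) = vacCoeff E x :=
  ext_cre E (f := vacCoeff E ∘ₗ diag E κ) (g := vacCoeff E) (by simp)
    (fun k x _ => by simp [diag_cre]) x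

theorem vacCoeff_rann (E : AdaptedBasis D d) (k : Fin d) (x : FockAlg V) :
    vacCoeff E (rann E k x) = vacCoeff E (ann E k x) := by
  refine ext_cre E (f := vacCoeff E ∘ₗ rann E k) (g := vacCoeff E ∘ₗ ann E k) (by simp)
    (fun j x _ => ?_) x
  simp only [LinearMap.comp_apply, rann_cre, ann_cre, map_add, vacCoeff_cre, map_smul, smul_zero,
    zero_add, add_zero]
  by_cases h : k = j
  · simp [h, vacCoeff_diag]
  · simp [h, Ne.symm h]

theorem inner_emb_rcre_left (E : AdaptedBasis D d) (k : Fin d) (x y : FockAlg V) :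
    inner ℂ (emb E (rcre E k x)) (emb E y) = inner ℂ (emb E x) (emb E (rann E k y)) := by
  induction x using fock_induction E generalizing y with
  | one =>
    have h := fun z => inner_vac_emb E z
    simp only [vac] at h
    rw [rcre_one, inner_emb_cre_left, h, h, vacCoeff_rann]
  | cre j x ih => rw [rcre_cre, inner_emb_cre_left, ih, inner_emb_cre_left, ann_rann]
  | add x z hx hz => simp only [map_add, inner_add_left, hx, hz]
  | smul c x hx => simp only [map_smul, inner_smul_left, hx]

/-- The reversal of words. -/
def rev (E : AdaptedBasis D d) : Module.End ℂ (FockAlg V) :=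
  (wordVec E).constr ℂ fun l => wordVec E l.reverse

theorem rev_wordVec (E : AdaptedBasis D d) (l : List (Fin d)) :
    rev E (wordVec E l) = wordVec E l.reverse := by
  rw [rev, Module.Basis.constr_basis]

@[simp] theorem rev_one (E : AdaptedBasis D d) : rev E 1 = 1 := by
  rw [← wordVec_nil E, rev_wordVec, List.reverse_nil]

theorem rev_cre (E : AdaptedBasis D d) (k : Fin d) (x : FockAlg V) :
    rev E (cre E k x) = rcre E k (rev E x) := by
  refine LinearMap.congr_fun (f := rev E ∘ₗ cre E k) (g := rcre E k ∘ₗ rev E) ?_ x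
  refine (wordVec E).ext fun l => ?_
  rw [LinearMap.comp_apply, ← wordVec_cons, rev_wordVec, List.reverse_cons, wordVec_concat,
    LinearMap.comp_apply, rev_wordVec]

theorem rev_rev (E : AdaptedBasis D d) (x : FockAlg V) : rev E (rev E x) = x := by
  refine LinearMap.congr_fun (f := rev E ∘ₗ rev E) (g := LinearMap.id) ?_ x
  refine (wordVec E).ext fun l => ?_
  rw [LinearMap.comp_apply, rev_wordVec, rev_wordVec, List.reverse_reverse]; rfl

theorem rev_mem_deg (E : AdaptedBasis D d) {n : ℕ} {x : FockAlg V} (hx : x ∈ deg E n) :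
    rev E x ∈ deg E n := by
  refine map_mem_of_mem_deg E _ _ (fun l hl => ?_) hx
  rw [rev_wordVec, ← hl, ← List.length_reverse]
  exact wordVec_mem_deg E _

theorem rann_rev (E : AdaptedBasis D d) (k : Fin d) (x : FockAlg V) :
    rann E k (rev E x) = rev E (ann E k x) := by
  refine ext_cre E (f := rann E k ∘ₗ rev E) (g := rev E ∘ₗ ann E k) (by simp)
    (fun j x hx => ?_) x
  simp only [LinearMap.comp_apply] at hx ⊢
  rw [rev_cre, rann_rcre, hx, ann_cre, map_add, map_smul, rev_cre]
  congr 1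
  split_ifs <;> simp

theorem rann_eq_rev (E : AdaptedBasis D d) (k : Fin d) (x : FockAlg V) :
    rann E k x = rev E (ann E k (rev E x)) := by
  rw [← rann_rev, rev_rev]

theorem rann_mem_deg (E : AdaptedBasis D d) (k : Fin d) {n : ℕ} {x : FockAlg V}
    (hx : x ∈ deg E (n + 1)) : rann E k x ∈ deg E n := by
  rw [rann_eq_rev]
  exact rev_mem_deg E (ann_mem_deg E k (rev_mem_deg E hx))

/-- The reversal of words is isometric for the `T`-inner product. -/
theorem inner_emb_rev (E : AdaptedBasis D d) (x y : FockAlg V) :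
    inner ℂ (emb E (rev E x)) (emb E (rev E y)) = inner ℂ (emb E x) (emb E y) := by
  induction x using fock_induction E generalizing y with
  | one =>
    have h := fun z => inner_vac_emb E z
    simp only [vac] at h
    rw [rev_one, h, h]
    exact ext_cre E (f := vacCoeff E ∘ₗ rev E) (g := vacCoeff E) (by simp) (fun k x _ => by
      rw [LinearMap.comp_apply, rev_cre, vacCoeff_cre, ← h, ← inner_conj_symm,
        inner_emb_rcre_left, rann_one, map_zero, inner_zero_right, map_zero]) y
  | cre j x ih => rw [rev_cre, inner_emb_rcre_left, rann_rev, ih, inner_emb_cre_left]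
  | add x z hx hz => simp only [map_add, inner_add_left, hx, hz]
  | smul c x hx => simp only [map_smul, inner_smul_left, hx]

theorem extends_rev (E : AdaptedBasis D d) : Extends E (rev E) := by
  refine extends_of_norm_le E 1 fun x => ?_
  rw [one_mul]
  refine le_of_sq_le_sq ?_ (norm_nonneg _)
  rw [← inner_self_eq_norm_sq (𝕜 := ℂ), inner_emb_rev, inner_self_eq_norm_sq]

theorem Extends.comp {E : AdaptedBasis D d} {f g : Module.End ℂ (FockAlg V)} (hf : Extends E f)
    (hg : Extends E g) : Extends E (f ∘ₗ g) := by
  obtain ⟨L, hL⟩ := hf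
  obtain ⟨L', hL'⟩ := hg
  exact ⟨L ∘L L', fun x => by simp [hL _, hL' x]⟩

theorem extends_rcre (E : AdaptedBasis D d) (k : Fin d) : Extends E (rcre E k) := by
  have : rcre E k = rev E ∘ₗ cre E k ∘ₗ rev E := by
    refine LinearMap.ext fun x => ?_
    rw [LinearMap.comp_apply, LinearMap.comp_apply, rev_cre, rev_rev]
  rw [this]
  exact (extends_rev E).comp ((extends_cre E k).comp (extends_rev E))

theorem extends_rann (E : AdaptedBasis D d) (k : Fin d) : Extends E (rann E k) :=
  (extends_rcre E k).of_adjoint (inner_emb_rcre_left E k)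

/-! ### Left and right field operators -/

/-- The operator `a(ē_l)`. -/
def annBar (E : AdaptedBasis D d) (l : Fin d) : Module.End ℂ (FockAlg V) :=
  ∑ k, conjMat E l k • ann E k

theorem annBar_apply (E : AdaptedBasis D d) (l : Fin d) (x : FockAlg V) :
    annBar E l x = ∑ k, conjMat E l k • ann E k x := by simp [annBar, LinearMap.sum_apply]

/-- The operator `a*(e_l) + a(ē_l)`. -/
def fieldAlg (E : AdaptedBasis D d) (l : Fin d) : Module.End ℂ (FockAlg V) := cre E l + annBar E l

theorem fieldAlg_apply (E : AdaptedBasis D d) (l : Fin d) (x : FockAlg V) :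
    fieldAlg E l x = cre E l x + annBar E l x := rfl

/-- The right annihilation operator whose commutator with `a*(e_l)` has the scalar
`⟨ē_l, e_c⟩_U`. -/
def rannBar (E : AdaptedBasis D d) (c : Fin d) : Module.End ℂ (FockAlg V) :=
  ∑ l, conjMat E l c • rann E l

theorem rannBar_apply (E : AdaptedBasis D d) (c : Fin d) (x : FockAlg V) :
    rannBar E c x = ∑ l, conjMat E l c • rann E l x := by simp [rannBar, LinearMap.sum_apply]

/-- The right field operators, which commute with the left field operators. -/
def rightAlg (E : AdaptedBasis D d) (c : Fin d) : Module.End ℂ (FockAlg V) :=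
  rcre E c + rannBar E c

theorem extends_annBar (E : AdaptedBasis D d) (l : Fin d) : Extends E (annBar E l) :=
  Extends.sum _ fun k => (extends_ann E k).smul _

theorem extends_fieldAlg (E : AdaptedBasis D d) (l : Fin d) : Extends E (fieldAlg E l) :=
  (extends_cre E l).add (extends_annBar E l)

theorem extends_rightAlg (E : AdaptedBasis D d) (c : Fin d) : Extends E (rightAlg E c) :=
  (extends_rcre E c).add (Extends.sum _ fun k => (extends_rann E k).smul _)

@[simp] theorem annBar_one (E : AdaptedBasis D d) (l : Fin d) : annBar E l 1 = 0 := by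
  simp [annBar_apply]

@[simp] theorem rannBar_one (E : AdaptedBasis D d) (l : Fin d) : rannBar E l 1 = 0 := by
  simp [rannBar_apply]

theorem annBar_rannBar (E : AdaptedBasis D d) (l c : Fin d) (x : FockAlg V) :
    annBar E l (rannBar E c x) = rannBar E c (annBar E l x) := by
  simp only [annBar_apply, rannBar_apply, map_sum, map_smul, ann_rann, Finset.smul_sum]
  rw [Finset.sum_comm]
  refine Finset.sum_congr rfl fun i _ => Finset.sum_congr rfl fun j _ => smul_comm _ _ _

theorem rannBar_cre (E : AdaptedBasis D d) (c l : Fin d) (x : FockAlg V) :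
    rannBar E c (cre E l x) = cre E l (rannBar E c x) + conjMat E l c • diag E (twc E l) x := by
  simp [rannBar_apply, rann_cre, Finset.sum_add_distrib]

/-- Since `⟨ē_l, e_k⟩_U = 0` for vectors of different summands, a quantity that depends only on the
summand of a basis vector may be moved from one index of this scalar to the other. -/
theorem conjMat_smul_eq [FiniteDimensional ℝ V] (E : AdaptedBasis D d) (l k : Fin d) {M : Type*}
    [AddCommGroup M]
    [Module ℂ M] {f : Fin d → M} (hf : ∀ j j', E.col j = E.col j' → f j = f j') :
    conjMat E l k • f l = conjMat E l k • f k := by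
  by_cases h : conjMat E l k = 0
  · simp [h]
  · rw [hf l k (col_eq_of_conjMat_ne_zero E h)]

theorem annBar_cre [FiniteDimensional ℝ V] (E : AdaptedBasis D d) (l j : Fin d) (x : FockAlg V) :
    annBar E l (cre E j x) = conjMat E l j • x + twc E l j • cre E j (annBar E l x) := by
  simp only [annBar_apply, ann_cre, smul_add, Finset.sum_add_distrib, map_sum, map_smul]
  congr 1
  · simp
  · rw [Finset.smul_sum]
    refine Finset.sum_congr rfl fun k _ => ?_
    rw [smul_comm (twc E l j)]
    exact (conjMat_smul_eq E l k (f := fun i => twc E i j • cre E j (ann E k x))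
      fun i i' h => by rw [twc_congr E h]).symm

theorem annBar_rcre [FiniteDimensional ℝ V] (E : AdaptedBasis D d) (l c : Fin d) (x : FockAlg V) :
    annBar E l (rcre E c x) = rcre E c (annBar E l x) + conjMat E l c • diag E (twc E l) x := by
  rw [conjMat_smul_eq E l c (f := fun i => diag E (twc E i) x) fun i i' h => by rw [twc_congr E h]]
  simp [annBar_apply, ann_rcre, Finset.sum_add_distrib]

/-- The left and the right field operators commute. -/
theorem fieldAlg_rightAlg [FiniteDimensional ℝ V] (E : AdaptedBasis D d) (l c : Fin d)
    (x : FockAlg V) :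
    fieldAlg E l (rightAlg E c x) = rightAlg E c (fieldAlg E l x) := by
  simp only [fieldAlg, rightAlg, LinearMap.add_apply, map_add, rcre_cre, annBar_rcre, rannBar_cre,
    annBar_rannBar]
  abel

theorem rannBar_diag [FiniteDimensional ℝ V] (E : AdaptedBasis D d) {κ : Fin d → ℂ}
    (hκ : ∀ j j', E.col j = E.col j' → κ j = κ j') (c : Fin d) (x : FockAlg V) :
    rannBar E c (diag E κ x) = κ c • diag E κ (rannBar E c x) := by
  simp only [rannBar_apply, rann_diag, map_sum, map_smul, Finset.smul_sum]
  refine Finset.sum_congr rfl fun l _ => ?_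
  rw [smul_comm (κ c)]
  exact conjMat_smul_eq E l c (f := fun i => κ i • diag E κ (rann E l x))
    fun i i' h => by rw [hκ _ _ h]

theorem annBar_diag [FiniteDimensional ℝ V] (E : AdaptedBasis D d) {κ : Fin d → ℂ}
    (hκ : ∀ j j', E.col j = E.col j' → κ j = κ j') (l : Fin d) (x : FockAlg V) :
    annBar E l (diag E κ x) = κ l • diag E κ (annBar E l x) := by
  simp only [annBar_apply, ann_diag, map_sum, map_smul, Finset.smul_sum]
  refine Finset.sum_congr rfl fun k _ => ?_
  rw [smul_comm (κ l)]
  exact (conjMat_smul_eq E l k (f := fun i => κ i • diag E κ (ann E k x))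
    fun i i' h => by rw [hκ _ _ h]).symm

/-! ### Field operators and the von Neumann algebra -/

theorem Cplx.bar_add (z w : Cplx V) : (z + w).bar = z.bar + w.bar := by
  ext <;> simp [Cplx.bar, add_comm]

theorem Cplx.bar_smul (c : ℂ) (z : Cplx V) : (c • z).bar = conj c • z.bar := by
  ext <;> simp [Cplx.bar]; abel

theorem Cplx.bar_ofReal {W : Type*} [NormedAddCommGroup W] (x : W) :
    (Cplx.ofReal x).bar = Cplx.ofReal x := by
  ext <;> simp [Cplx.bar, Cplx.ofReal]

theorem Cplx.eq_re_add_im (z : Cplx V) :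
    z = Cplx.ofReal z.re + Complex.I • Cplx.ofReal z.im := by
  ext <;> simp [Cplx.ofReal]

theorem innerU_add_left (U : ℝ → (V ≃ₗᵢ[ℝ] V)) (x y z : Cplx V) :
    innerU U (x + y) z = innerU U x z + innerU U y z := inner_add_left _ _ _

theorem innerU_smul_left (U : ℝ → (V ≃ₗᵢ[ℝ] V)) (c : ℂ) (x z : Cplx V) :
    innerU U (c • x) z = conj c * innerU U x z := inner_smul_left _ _ _

theorem innerU_basis_left (E : AdaptedBasis D d) (k : Fin d) (z : Cplx V) :
    innerU D.U (E.e k) z = E.e.repr z k := by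
  conv_lhs => rw [← E.e.sum_repr z]
  rw [innerU_eq, map_sum, inner_sum]
  have : ∀ j, inner ℂ (E.e k) (deformOp D (E.e.repr z j • E.e j)) =
      if k = j then E.e.repr z j else 0 := by
    intro j
    rw [map_smul, inner_smul_right, ← innerU_eq, E.e_orthonormal]
    simp
  simp only [this]
  simp

theorem innerU_bar (E : AdaptedBasis D d) (z : Cplx V) (k : Fin d) :
    innerU D.U z.bar (E.e k) = ∑ l, E.e.repr z l * conjMat E l k := by
  have h0 : (0 : Cplx V).bar = 0 := by simpa using Cplx.bar_smul 0 (0 : Cplx V)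
  have hs : ∀ (s : Finset (Fin d)) (c : Fin d → ℂ), innerU D.U (∑ l ∈ s, c l • E.e l).bar (E.e k) =
      ∑ l ∈ s, c l * conjMat E l k := by
    intro s c
    induction s using Finset.cons_induction with
    | empty => rw [Finset.sum_empty, h0]; exact inner_zero_left _
    | cons a s ha ih =>
      rw [Finset.sum_cons, Finset.sum_cons, Cplx.bar_add, innerU_add_left, ih, Cplx.bar_smul,
        innerU_smul_left, Complex.conj_conj, conjMat_def]
  rw [← hs, E.e.sum_repr]

/-- The operator `a*(z) + a(z̄)` as a combination of those for the basis vectors. -/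
theorem creation_add_annihilation_bar (E : AdaptedBasis D d) (z : Cplx V) :
    creation z + annihilation E z.bar = ∑ l, E.e.repr z l • fieldAlg E l := by
  rw [creation_eq_sum E, annihilation_eq_sum]
  simp only [innerU_bar, fieldAlg, smul_add, Finset.sum_add_distrib, annBar, Finset.smul_sum,
    Finset.sum_smul, smul_smul]
  rw [Finset.sum_comm]

/-- The bounded operator `a*(e_l) + a(ē_l)`. -/
def fieldOp (E : AdaptedBasis D d) (l : Fin d) : Fock E →L[ℂ] Fock E := extension E (fieldAlg E l)

theorem fieldOp_emb (E : AdaptedBasis D d) (l : Fin d) (x : FockAlg V) :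
    fieldOp E l (emb E x) = emb E (fieldAlg E l x) := extension_emb (extends_fieldAlg E l) x

theorem extends_creation (E : AdaptedBasis D d) (ξ : Cplx V) : Extends E (creation ξ) := by
  rw [creation_eq_sum E]
  exact Extends.sum _ fun k => (extends_cre E k).smul _

theorem extends_annihilation (E : AdaptedBasis D d) (ξ : Cplx V) :
    Extends E (annihilation E ξ) := by
  rw [annihilation_eq_sum E]
  exact Extends.sum _ fun k => (extends_ann E k).smul _

theorem extends_freeAnn (E : AdaptedBasis D d) (ξ : Cplx V) : Extends E (freeAnn E ξ) := by
  rw [freeAnn_eq_sum E]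
  exact Extends.sum _ fun k => (extends_strip E k).smul _

theorem field_eq_sum (E : AdaptedBasis D d) (x : V) :
    field E x = ∑ l, E.e.repr (Cplx.ofReal x) l • fieldOp E l := by
  refine clm_ext fun y => ?_
  have h := LinearMap.congr_fun (creation_add_annihilation_bar E (Cplx.ofReal x)) y
  rw [Cplx.bar_ofReal, LinearMap.add_apply] at h
  simp only [field, add_apply, extension_emb (extends_annihilation E _),
    extension_emb (extends_creation E _), sum_apply, smul_apply, fieldOp_emb]
  rw [← map_add, add_comm, h]
  simp [LinearMap.sum_apply]

theorem fieldOp_eq_field (E : AdaptedBasis D d) (l : Fin d) :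
    fieldOp E l = field E (E.e l).re + Complex.I • field E (E.e l).im := by
  rw [field_eq_sum, field_eq_sum, Finset.smul_sum, ← Finset.sum_add_distrib]
  have : ∀ k, E.e.repr (Cplx.ofReal (E.e l).re) k • fieldOp E k +
      Complex.I • E.e.repr (Cplx.ofReal (E.e l).im) k • fieldOp E k =
      (if l = k then (1 : ℂ) else 0) • fieldOp E k := by
    intro k
    rw [smul_smul, ← add_smul]
    congr 1
    have h := congrArg (fun z => E.e.repr z k) (Cplx.eq_re_add_im (E.e l))
    simp only [map_add, map_smul, Finsupp.add_apply, Finsupp.smul_apply, smul_eq_mul,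
      Module.Basis.repr_self, Finsupp.single_apply] at h
    rw [h]
  simp [this]

theorem inner_creation (E : AdaptedBasis D d) (ξ : Cplx V) (x y : FockAlg V) :
    inner ℂ (emb E (creation ξ x)) (emb E y) = inner ℂ (emb E x) (emb E (annihilation E ξ y)) := by
  rw [creation_eq_sum E, annihilation_eq_sum E]
  simp only [LinearMap.sum_apply, map_sum, sum_inner, inner_sum, LinearMap.smul_apply, map_smul,
    inner_smul_left, inner_smul_right, inner_emb_cre_left]
  refine Finset.sum_congr rfl fun k _ => ?_
  rw [← innerU_basis_left E, conj_innerU E]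

theorem star_field (E : AdaptedBasis D d) (x : V) : star (field E x) = field E x := by
  have h1 := adjoint_extension (extends_creation E (Cplx.ofReal x))
    (inner_creation E (Cplx.ofReal x))
  rw [field, star_add, ContinuousLinearMap.star_eq_adjoint, ContinuousLinearMap.star_eq_adjoint,
    h1, ← h1, ContinuousLinearMap.adjoint_adjoint, add_comm]

theorem star_fieldOp (E : AdaptedBasis D d) (l : Fin d) :
    ∃ c : Fin d → ℂ, star (fieldOp E l) = ∑ k, c k • fieldOp E k := by
  refine ⟨fun k => E.e.repr (Cplx.ofReal (E.e l).re) k +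
    -Complex.I * E.e.repr (Cplx.ofReal (E.e l).im) k, ?_⟩
  rw [fieldOp_eq_field, star_add, star_smul, star_field, star_field, field_eq_sum, field_eq_sum,
    Finset.smul_sum, ← Finset.sum_add_distrib]
  refine Finset.sum_congr rfl fun k _ => ?_
  rw [add_smul, mul_smul]
  simp

theorem subset_vonNeumannGenerated {H : Type*} [NormedAddCommGroup H] [InnerProductSpace ℂ H]
    [CompleteSpace H] (S : Set (H →L[ℂ] H)) {X : H →L[ℂ] H} (hX : X ∈ S) :
    X ∈ vonNeumannGenerated S := by
  change X ∈ StarSubalgebra.centralizer ℂ (StarSubalgebra.centralizer ℂ S : Set (H →L[ℂ] H))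
  rw [StarSubalgebra.mem_centralizer_iff]
  intro g hg
  have h := (StarSubalgebra.mem_centralizer_iff ℂ).mp hg X hX
  refine ⟨h.1.symm, ?_⟩
  have := congrArg star h.2
  simpa using this

theorem fieldOp_mem (E : AdaptedBasis D d) (l : Fin d) : fieldOp E l ∈ awAlgebra E := by
  have h : ∀ x, field E x ∈ awStar E := fun x => subset_vonNeumannGenerated _ ⟨x, rfl⟩
  rw [fieldOp_eq_field]
  exact add_mem (h _) ((awStar E).smul_mem (h _) _)

/-- The bounded right field operators. -/
def rightOp (E : AdaptedBasis D d) (c : Fin d) : Fock E →L[ℂ] Fock E := extension E (rightAlg E c)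

theorem rightOp_emb (E : AdaptedBasis D d) (c : Fin d) (x : FockAlg V) :
    rightOp E c (emb E x) = emb E (rightAlg E c x) := extension_emb (extends_rightAlg E c) x

theorem commute_rightOp [FiniteDimensional ℝ V] (E : AdaptedBasis D d) {X : Fock E →L[ℂ] Fock E}
    (hX : X ∈ awAlgebra E)
    (c : Fin d) : X * rightOp E c = rightOp E c * X := by
  have h1 : ∀ l, fieldOp E l * rightOp E c = rightOp E c * fieldOp E l := by
    intro l
    refine clm_ext fun x => ?_
    simp only [mul_apply_eq_comp, rightOp_emb, fieldOp_emb, fieldAlg_rightAlg]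
  have h2 : ∀ x, field E x * rightOp E c = rightOp E c * field E x := by
    intro x
    rw [field_eq_sum, Finset.sum_mul, Finset.mul_sum]
    refine Finset.sum_congr rfl fun l _ => ?_
    rw [smul_mul_assoc, mul_smul_comm, h1]
  have h3 : rightOp E c ∈ StarSubalgebra.centralizer ℂ (Set.range (field E)) := by
    rw [StarSubalgebra.mem_centralizer_iff]
    rintro _ ⟨x, rfl⟩
    rw [star_field]
    exact ⟨h2 x, h2 x⟩
  exact ((StarSubalgebra.mem_centralizer_iff ℂ).mp hX _ h3).1.symm

/-- The vacuum is separating for the von Neumann algebra. -/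
theorem eq_zero_of_vac [FiniteDimensional ℝ V] (E : AdaptedBasis D d) {X : Fock E →L[ℂ] Fock E}
    (hX : X ∈ awAlgebra E)
    (h : X (vac E) = 0) : X = 0 := by
  have key : ∀ n, ∀ x ∈ deg E n, X (emb E x) = 0 := by
    intro n
    induction n using Nat.strong_induction_on with
    | _ n ih =>
      intro x hx
      refine eq_of_mem_deg E (X.toLinearMap ∘ₗ emb E) 0 (fun l hl => ?_) hx
      rcases n with _ | n
      · rw [List.length_eq_zero_iff.mp hl, wordVec_nil]
        exact h
      · obtain ⟨l, c, rfl, rfl⟩ := exists_concat_of_length_eq hl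
        have h1 : rcre E c (wordVec E l) = rightAlg E c (wordVec E l) -
            ∑ k, conjMat E k c • rann E k (wordVec E l) := by
          rw [rightAlg, LinearMap.add_apply, rannBar_apply, add_sub_cancel_right]
        have h2 : ∀ k, X (emb E (rann E k (wordVec E l))) = 0 := by
          intro k
          rcases l with _ | ⟨j, l⟩
          · simp
          · exact ih l.length (by simp) _ (rann_mem_deg E k (wordVec_mem_deg E (j :: l)))
        have h3 : X (emb E (rightAlg E c (wordVec E l))) = 0 := by
          rw [← rightOp_emb, ← mul_apply_eq_comp, commute_rightOp E hX,
            mul_apply_eq_comp, ih _ (by simp) _ (wordVec_mem_deg E l), map_zero]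
        rw [wordVec_concat, h1]
        simp [h2, h3]
  refine clm_ext fun x => ?_
  have hx : x ∈ ⨆ n, deg E n := by rw [iSup_deg]; trivial
  obtain ⟨c, hc, rfl⟩ := (Submodule.mem_iSup_iff_exists_finsupp _ _).mp hx
  rw [Finsupp.sum, map_sum, map_sum]
  exact Finset.sum_eq_zero fun i _ => key i _ (hc i)

theorem eq_of_vac [FiniteDimensional ℝ V] (E : AdaptedBasis D d) {X Y : Fock E →L[ℂ] Fock E}
    (hX : X ∈ awAlgebra E)
    (hY : Y ∈ awAlgebra E) (h : X (vac E) = Y (vac E)) : X = Y := by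
  have := eq_zero_of_vac E (sub_mem hX hY) (by rw [sub_apply, h, sub_self])
  exact sub_eq_zero.mp this

/-! ### Wick operators -/

/-- Wick operators exist on the algebraic Fock space, with norms that grow at most exponentially in
the degree when compared with the `ℓ¹` norm. They are found recursively from
`W(e_k ⊗ x) = A_k W(x) - W(a(ē_k) x)`. -/
theorem exists_wick_deg (E : AdaptedBasis D d) : ∃ K : ℝ, 1 ≤ K ∧ ∀ n, ∀ x ∈ deg E n,
    ∃ X ∈ awAlgebra E, X (vac E) = emb E x ∧ ‖X‖ ≤ K ^ n * wnorm E x := by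
  obtain ⟨q, hq0, hq1, hq⟩ := exists_tw_bound E
  have h1 : 0 < 1 - q := by linarith
  set c := ∑ k, ‖fieldOp E k‖ with hc
  set m := ∑ k, ∑ l, ‖conjMat E k l‖ with hm
  have hc0 : 0 ≤ c := by positivity
  have hm0 : 0 ≤ m := by positivity
  set K := 1 + c + m * (1 - q)⁻¹ with hK
  have hmq : 0 ≤ m * (1 - q)⁻¹ := by positivity
  have hK1 : 1 ≤ K := by linarith
  refine ⟨K, hK1, fun n => ?_⟩
  induction n using Nat.strong_induction_on with
  | _ n ih =>
    have hw : ∀ l : List (Fin d), ∃ X ∈ awAlgebra E, l.length = n →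
        X (vac E) = emb E (wordVec E l) ∧ ‖X‖ ≤ K ^ n := by
      intro l
      by_cases hl : l.length = n
      swap
      · exact ⟨0, zero_mem _, fun h => absurd h hl⟩
      rcases l with _ | ⟨k, l⟩
      · refine ⟨1, one_mem _, fun _ => ⟨by simp [vac], ?_⟩⟩
        exact ContinuousLinearMap.norm_id_le.trans (one_le_pow₀ hK1)
      obtain rfl : n = l.length + 1 := by rw [← hl, List.length_cons]
      obtain ⟨X, hX, hXv, hXn⟩ := ih l.length (by simp) _ (wordVec_mem_deg E l)
      have hY : ∀ j, ∃ Y ∈ awAlgebra E, Y (vac E) = emb E (ann E j (wordVec E l)) ∧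
          ‖Y‖ ≤ K ^ l.length * (1 - q)⁻¹ := by
        intro j
        have h2 := wnorm_ann_le E hq0 hq1 hq j (wordVec_mem_deg E l)
        rw [wnorm_wordVec, mul_one] at h2
        rcases l with _ | ⟨i, l⟩
        · exact ⟨0, zero_mem _, by simp, by rw [norm_zero]; positivity⟩
        · obtain ⟨Y, hY, hYv, hYn⟩ := ih l.length (by simp) _
            (ann_mem_deg E j (wordVec_mem_deg E (i :: l)))
          refine ⟨Y, hY, hYv, hYn.trans ?_⟩
          exact mul_le_mul (pow_le_pow_right₀ hK1 (by simp)) h2 (apply_nonneg _ _) (by positivity)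
      choose Y hY hYv hYn using hY
      refine ⟨fieldOp E k * X - ∑ j, conjMat E k j • Y j, sub_mem (mul_mem (fieldOp_mem E k) hX)
        (sum_mem fun j _ => (awStar E).smul_mem (hY j) _), fun _ => ⟨?_, ?_⟩⟩
      · rw [sub_apply, mul_apply_eq_comp, hXv, fieldOp_emb, sum_apply, wordVec_cons,
          fieldAlg_apply, annBar_apply, map_add, map_sum]
        simp only [smul_apply, hYv, map_smul, add_sub_cancel_right]
      · rw [wnorm_wordVec, mul_one] at hXn
        have h2 : ‖fieldOp E k * X‖ ≤ c * K ^ l.length := by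
          refine (norm_mul_le _ _).trans (mul_le_mul ?_ hXn (norm_nonneg _) hc0)
          exact Finset.single_le_sum (f := fun k => ‖fieldOp E k‖) (fun _ _ => norm_nonneg _)
            (Finset.mem_univ k)
        have h3 : ‖∑ j, conjMat E k j • Y j‖ ≤ m * (K ^ l.length * (1 - q)⁻¹) := by
          refine (norm_sum_le _ _).trans ?_
          calc _ ≤ ∑ j, ‖conjMat E k j‖ * (K ^ l.length * (1 - q)⁻¹) :=
                Finset.sum_le_sum fun j _ => by
                  rw [norm_smul]; exact mul_le_mul_of_nonneg_left (hYn j) (norm_nonneg _)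
            _ ≤ _ := by
                rw [← Finset.sum_mul]
                refine mul_le_mul_of_nonneg_right ?_ (by positivity)
                exact Finset.single_le_sum (f := fun k => ∑ l, ‖conjMat E k l‖)
                  (fun _ _ => by positivity) (Finset.mem_univ k)
        refine (norm_sub_le _ _).trans ((add_le_add h2 h3).trans ?_)
        rw [pow_succ]
        have : 0 ≤ K ^ l.length := by positivity
        nlinarith
    choose f hf hf' using hw
    intro x hx
    let W : FockAlg V →ₗ[ℂ] (Fock E →L[ℂ] Fock E) := (wordVec E).constr ℂ f
    have hW : ∀ l, W (wordVec E l) = f l := fun l => Module.Basis.constr_basis _ _ _ _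
    refine ⟨W x, ?_, ?_, ?_⟩
    · exact map_mem_of_mem_deg E W (awStar E).toSubalgebra.toSubmodule
        (fun l _ => by rw [hW]; exact hf l) hx
    · refine eq_of_mem_deg E ((ContinuousLinearMap.apply ℂ (Fock E) (vac E)).toLinearMap ∘ₗ W)
        (emb E) (fun l hl => ?_) hx
      rw [LinearMap.comp_apply, hW]
      exact (hf' l hl).1
    · exact seminorm_le_wnorm E ((normSeminorm ℂ (Fock E →L[ℂ] Fock E)).comp W)
        (fun l hl => by
          change ‖W (wordVec E l)‖ ≤ _
          rw [hW]; exact (hf' l hl).2) hx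

theorem existsUnique_wick [FiniteDimensional ℝ V] (E : AdaptedBasis D d) (x : FockAlg V) :
    ∃! X : Fock E →L[ℂ] Fock E, X ∈ awAlgebra E ∧ X (vac E) = emb E x := by
  obtain ⟨K, -, h⟩ := exists_wick_deg E
  have hex : ∃ X ∈ awAlgebra E, X (vac E) = emb E x := by
    have hx : x ∈ ⨆ n, deg E n := by rw [iSup_deg]; trivial
    obtain ⟨c, hc, rfl⟩ := (Submodule.mem_iSup_iff_exists_finsupp _ _).mp hx
    choose X hX hXv _ using fun i => h i (c i) (hc i)
    refine ⟨∑ i ∈ c.support, X i, sum_mem fun i _ => hX i, ?_⟩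
    rw [sum_apply, Finsupp.sum, map_sum]
    exact Finset.sum_congr rfl fun i _ => hXv i
  obtain ⟨X, hX, hXv⟩ := hex
  exact ⟨X, ⟨hX, hXv⟩, fun Y hY => eq_of_vac E hY.1 hX (hY.2.trans hXv.symm)⟩

theorem wick_eq [FiniteDimensional ℝ V] (E : AdaptedBasis D d) {ξ : Fock E}
    {X : Fock E →L[ℂ] Fock E}
    (hX : X ∈ awAlgebra E) (h : X (vac E) = ξ) : wick E ξ = X := by
  have hex : ∃ X ∈ awAlgebra E, X (vac E) = ξ := ⟨X, hX, h⟩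
  rw [wick, dif_pos hex]
  exact eq_of_vac E hex.choose_spec.1 hX (hex.choose_spec.2.trans h.symm)

theorem exists_norm_wick_le [FiniteDimensional ℝ V] (E : AdaptedBasis D d) :
    ∃ K : ℝ, 1 ≤ K ∧ ∀ n, ∀ x ∈ deg E n,
    wick E (emb E x) (vac E) = emb E x ∧ ‖wick E (emb E x)‖ ≤ K ^ n * wnorm E x := by
  obtain ⟨K, hK, h⟩ := exists_wick_deg E
  refine ⟨K, hK, fun n x hx => ?_⟩
  obtain ⟨X, hX, hXv, hXn⟩ := h n x hx
  rw [wick_eq E hX hXv]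
  exact ⟨hXv, hXn⟩

theorem gen_eq_fieldOp [FiniteDimensional ℝ V] (E : AdaptedBasis D d) (l : Fin d) :
    gen E l = fieldOp E l := by
  refine wick_eq E (fieldOp_mem E l) ?_
  rw [vac, fieldOp_emb, fieldAlg_apply, annBar_one, add_zero, cre_apply, mul_one]

theorem gen_emb [FiniteDimensional ℝ V] (E : AdaptedBasis D d) (l : Fin d) (x : FockAlg V) :
    gen E l (emb E x) = emb E (fieldAlg E l x) := by
  rw [gen_eq_fieldOp, fieldOp_emb]

theorem isClosed_awAlgebra (E : AdaptedBasis D d) :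
    IsClosed {X : Fock E →L[ℂ] Fock E | X ∈ awAlgebra E} := by
  have : {X : Fock E →L[ℂ] Fock E | X ∈ awAlgebra E} = ⋂ g ∈ StarSubalgebra.centralizer ℂ
      (Set.range (field E)), {X | g * X = X * g ∧ star g * X = X * star g} := by
    ext X
    simp only [Set.mem_iInter]
    exact StarSubalgebra.mem_centralizer_iff ℂ
  rw [this]
  refine isClosed_biInter fun g _ => IsClosed.inter ?_ ?_
  · exact isClosed_eq (by fun_prop) (by fun_prop)
  · exact isClosed_eq (by fun_prop) (by fun_prop)

/-! ### Contractions and weights -/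

/-- The representation of the tensor algebra by right annihilation operators,
`e_{z_1} ⊗ ⋯ ⊗ e_{z_n} ↦ r(z_1) ⋯ r(z_n)`. -/
def contr (E : AdaptedBasis D d) : FockAlg V →ₐ[ℂ] Module.End ℂ (FockAlg V) :=
  TensorAlgebra.lift ℂ (E.e.constr ℂ (rannBar E))

theorem contr_one (E : AdaptedBasis D d) (y : FockAlg V) : contr E 1 y = y := by
  rw [map_one]; rfl

theorem contr_cre (E : AdaptedBasis D d) (c : Fin d) (z y : FockAlg V) :
    contr E (cre E c z) y = rannBar E c (contr E z y) := by
  rw [cre_apply, map_mul, contr, TensorAlgebra.lift_ι_apply, Module.Basis.constr_basis]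
  rfl

/-- The product of the values of `κ` at the letters of a word and of the twists of its pairs of
letters. -/
def pairWeight (E : AdaptedBasis D d) (κ : Fin d → ℂ) : List (Fin d) → ℂ
  | [] => 1
  | c :: l => κ c * (l.map (twc E c)).prod * pairWeight E κ l

/-- The diagonal operator with the eigenvalues `pairWeight`. -/
def pairDiag (E : AdaptedBasis D d) (κ : Fin d → ℂ) : Module.End ℂ (FockAlg V) :=
  (wordVec E).constr ℂ fun l => pairWeight E κ l • wordVec E l

theorem pairDiag_wordVec (E : AdaptedBasis D d) (κ : Fin d → ℂ) (l : List (Fin d)) :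
    pairDiag E κ (wordVec E l) = pairWeight E κ l • wordVec E l := by
  rw [pairDiag, Module.Basis.constr_basis]

@[simp] theorem pairDiag_one (E : AdaptedBasis D d) (κ : Fin d → ℂ) : pairDiag E κ 1 = 1 := by
  rw [← wordVec_nil E, pairDiag_wordVec, pairWeight, one_smul]

theorem pairWeight_mul (E : AdaptedBasis D d) (κ κ' : Fin d → ℂ) (l : List (Fin d)) :
    pairWeight E (κ * κ') l = (l.map κ').prod * pairWeight E κ l := by
  induction l with
  | nil => simp [pairWeight]
  | cons c l ih => simp only [pairWeight, ih, List.map_cons, List.prod_cons, Pi.mul_apply]; ring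

theorem diag_pairDiag (E : AdaptedBasis D d) (κ κ' : Fin d → ℂ) (x : FockAlg V) :
    diag E κ' (pairDiag E κ x) = pairDiag E (κ * κ') x := by
  refine LinearMap.congr_fun (f := diag E κ' ∘ₗ pairDiag E κ) (g := pairDiag E (κ * κ')) ?_ x
  refine (wordVec E).ext fun l => ?_
  rw [LinearMap.comp_apply, pairDiag_wordVec, pairDiag_wordVec, map_smul, diag_wordVec, smul_smul,
    pairWeight_mul, mul_comm]

theorem pairDiag_cre (E : AdaptedBasis D d) (κ : Fin d → ℂ) (c : Fin d) (x : FockAlg V) :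
    pairDiag E κ (cre E c x) = κ c • cre E c (pairDiag E (κ * twc E c) x) := by
  refine LinearMap.congr_fun (f := pairDiag E κ ∘ₗ cre E c)
    (g := κ c • cre E c ∘ₗ pairDiag E (κ * twc E c)) ?_ x
  refine (wordVec E).ext fun l => ?_
  simp only [LinearMap.comp_apply, LinearMap.smul_apply, ← wordVec_cons, pairDiag_wordVec,
    pairWeight, map_smul, smul_smul, pairWeight_mul, mul_assoc]

theorem vacCoeff_pairDiag (E : AdaptedBasis D d) (κ : Fin d → ℂ) (x : FockAlg V) :
    vacCoeff E (pairDiag E κ x) = vacCoeff E x := by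
  refine ext_cre E (f := vacCoeff E ∘ₗ pairDiag E κ) (g := vacCoeff E) (by simp)
    (fun k x _ => ?_) x
  simp [pairDiag_cre]

theorem contr_apply_one (E : AdaptedBasis D d) (z : FockAlg V) :
    contr E z 1 = vacCoeff E z • 1 := by
  induction z using fock_induction E with
  | one => simp
  | cre c z ih => rw [contr_cre, ih]; simp
  | add x y hx hy => rw [map_add, LinearMap.add_apply, hx, hy, map_add, add_smul]
  | smul c x hx => rw [map_smul, LinearMap.smul_apply, hx, map_smul, smul_smul, smul_eq_mul]

theorem annBar_contr (E : AdaptedBasis D d) (l : Fin d) (z y : FockAlg V) :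
    annBar E l (contr E z y) = contr E z (annBar E l y) := by
  induction z using fock_induction E with
  | one => rw [contr_one, contr_one]
  | cre c z ih => rw [contr_cre, contr_cre, annBar_rannBar, ih]
  | add x z hx hz => simp only [map_add, LinearMap.add_apply, hx, hz]
  | smul c x hx => simp only [map_smul, LinearMap.smul_apply, hx]

/-- The parity operator. -/
def parity (E : AdaptedBasis D d) : Module.End ℂ (FockAlg V) := diag E fun _ => -1

theorem contr_diag [FiniteDimensional ℝ V] (E : AdaptedBasis D d) {κ : Fin d → ℂ}
    (hκ : ∀ j j', E.col j = E.col j' → κ j = κ j') (z y : FockAlg V) :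
    contr E z (diag E κ y) = diag E κ (contr E (diag E κ z) y) := by
  induction z using fock_induction E with
  | one => simp
  | cre c z ih =>
    rw [contr_cre, ih, diag_cre, map_smul, LinearMap.smul_apply, contr_cre, map_smul,
      rannBar_diag E hκ]
  | add x z hx hz => simp only [map_add, LinearMap.add_apply, hx, hz]
  | smul c x hx => simp only [map_smul, LinearMap.smul_apply, hx]

theorem col_twc (E : AdaptedBasis D d) (i : Fin d) :
    ∀ j j', E.col j = E.col j' → twc E i j = twc E i j' := fun j j' h => by
  rw [twc_symm, twc_congr E h, twc_symm]

/-- Contracting a word against `e_l ⊗ y`: either `e_l` is not contracted, or it is paired with a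
letter of the word, which the operator `a(ē_l)` removes. The weights `pairDiag` are chosen so that
the twists picked up on the two sides agree. -/
theorem contr_pairDiag_cre [FiniteDimensional ℝ V] (E : AdaptedBasis D d) {κ : Fin d → ℂ}
    (hκ : ∀ j j', E.col j = E.col j' → κ j = κ j') (l : Fin d) (z y : FockAlg V) :
    contr E (pairDiag E κ z) (cre E l y) = cre E l (contr E (pairDiag E κ z) y) +
      κ l • contr E (pairDiag E κ (annBar E l z)) (diag E (twc E l) y) := by
  induction z using fock_induction E generalizing κ y with
  | one => simp
  | cre c z ih =>
    have hκc : ∀ j j', E.col j = E.col j' → (κ * twc E c) j = (κ * twc E c) j' :=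
      fun j j' h => by rw [Pi.mul_apply, Pi.mul_apply, hκ j j' h, col_twc E c j j' h]
    rw [pairDiag_cre, map_smul, LinearMap.smul_apply, contr_cre, ih hκc, map_add, rannBar_cre,
      annBar_cre]
    simp only [map_add, map_smul, pairDiag_cre, LinearMap.add_apply, LinearMap.smul_apply, smul_add,
      contr_cre, Pi.mul_apply]
    -- the pairing of `e_l` with the removed letter `e_c`, which have the same twists
    have hpair : κ c • conjMat E l c • diag E (twc E l) (contr E (pairDiag E (κ * twc E c) z) y) =
        κ l • conjMat E l c • contr E (pairDiag E κ z) (diag E (twc E l) y) := by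
      rw [contr_diag E (col_twc E l), diag_pairDiag, smul_comm (κ c), smul_comm (κ l)]
      exact (conjMat_smul_eq E l c (f := fun i => κ i • diag E (twc E l)
        (contr E (pairDiag E (κ * twc E i) z) y)) fun i i' h => by
          rw [hκ i i' h, twc_congr E h]).symm
    rw [hpair, add_assoc]
    congr 2
    simp only [smul_smul]
    rw [twc_symm E c l]
    congr 1
    ring
  | add x z hx hz =>
    simp only [map_add, LinearMap.add_apply, hx hκ, hz hκ, smul_add]
    abel
  | smul c x hx =>
    simp only [map_smul, LinearMap.smul_apply, hx hκ, smul_add]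
    rw [smul_comm]

theorem annBar_parity [FiniteDimensional ℝ V] (E : AdaptedBasis D d) (l : Fin d) (x : FockAlg V) :
    annBar E l (parity E x) = -parity E (annBar E l x) := by
  rw [parity, annBar_diag E (fun _ _ _ => rfl), neg_one_smul]

/-! ### The dual operators on the algebraic Fock space -/

/-- The values on words of `dualTwo`. -/
def dualWord (E : AdaptedBasis D d) (α : Fin d) : List (Fin d) → Module.End ℂ (FockAlg V)
  | [] => 0
  | β :: l => dualWord E α l ∘ₗ rcre E β +
      conjMat E β α • contr E (pairDiag E (twc E α) (parity E (wordVec E l)))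

/-- The map `dualTwo x y` is the sum over the factorisations `x = x' ⊗ e_β ⊗ x''`, with the scalar
`⟨ē_β, e_α⟩_U` and the sign `(-1)^|x''|`, of the weighted contractions of `x''` against
`y ⊗ x'`. -/
def dualTwo (E : AdaptedBasis D d) (α : Fin d) : FockAlg V →ₗ[ℂ] Module.End ℂ (FockAlg V) :=
  (wordVec E).constr ℂ (dualWord E α)

theorem dualTwo_one (E : AdaptedBasis D d) (α : Fin d) : dualTwo E α 1 = 0 := by
  rw [← wordVec_nil E, dualTwo, Module.Basis.constr_basis, dualWord]

theorem dualTwo_cre (E : AdaptedBasis D d) (α β : Fin d) (x y : FockAlg V) :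
    dualTwo E α (cre E β x) y = dualTwo E α x (rcre E β y) +
      conjMat E β α • contr E (pairDiag E (twc E α) (parity E x)) y := by
  have : dualTwo E α ∘ₗ cre E β = (LinearMap.lcomp ℂ (FockAlg V) (rcre E β)) ∘ₗ dualTwo E α +
      conjMat E β α • (contr E).toLinearMap ∘ₗ pairDiag E (twc E α) ∘ₗ parity E := by
    refine (wordVec E).ext fun l => ?_
    rw [LinearMap.comp_apply, ← wordVec_cons, dualTwo, Module.Basis.constr_basis, dualWord,
      LinearMap.add_apply, LinearMap.comp_apply, Module.Basis.constr_basis]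
    rfl
  exact LinearMap.congr_fun (LinearMap.congr_fun this x) y

/-- The commutation relation of `dualTwo`, where both arguments are moved past `A_l`. -/
theorem dualTwo_field [FiniteDimensional ℝ V] (E : AdaptedBasis D d) (α l : Fin d)
    (x y : FockAlg V) :
    dualTwo E α x (cre E l y) + dualTwo E α x (annBar E l y) +
      dualTwo E α (annBar E l x) (diag E (twc E l) y) = fieldAlg E l (dualTwo E α x y) := by
  induction x using fock_induction E generalizing y with
  | one => simp [dualTwo_one]
  | cre β x ih =>
    have h1 := ih (rcre E β y)
    rw [annBar_rcre, diag_rcre] at h1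
    have h2 := contr_pairDiag_cre E (col_twc E α) l (parity E x) y
    rw [annBar_parity] at h2
    -- the letters `β` and `α` have the same twists wherever `⟨ē_β, e_α⟩_U ≠ 0`
    have h3 : ∀ z : FockAlg V, conjMat E β α • twc E α l • z = conjMat E β α • twc E l β • z := by
      intro z
      rw [twc_symm E l β]
      exact (conjMat_smul_eq E β α (f := fun i => twc E i l • z) fun i i' h => by
        rw [twc_congr E h]).symm
    rw [dualTwo_cre, dualTwo_cre, annBar_cre, map_add, LinearMap.add_apply, map_smul, map_smul,
      LinearMap.smul_apply, LinearMap.smul_apply, dualTwo_cre, dualTwo_cre, h2, map_add, ← h1,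
      rcre_cre, fieldAlg_apply]
    simp only [annBar_contr, map_add, map_neg, LinearMap.neg_apply, smul_neg, map_smul,
      smul_add, h3]
    rw [smul_comm (twc E l β) (conjMat E β α)]
    abel
  | add x z hx hz =>
    simp only [map_add, LinearMap.add_apply, ← hx, ← hz]
    abel
  | smul c x hx => simp only [map_smul, LinearMap.smul_apply, ← hx, smul_add]

/-- The dual operator `D_α` on the algebraic Fock space. -/
def dual (E : AdaptedBasis D d) (α : Fin d) : Module.End ℂ (FockAlg V) :=
  (dualTwo E α).flip 1

theorem dual_apply (E : AdaptedBasis D d) (α : Fin d) (x : FockAlg V) :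
    dual E α x = dualTwo E α x 1 := rfl

theorem dual_one (E : AdaptedBasis D d) (α : Fin d) : dual E α 1 = 0 := by
  rw [dual_apply, dualTwo_one]; rfl

/-- The commutator relation `[D_α, A_l] = ⟨ē_l, e_α⟩_U P_Ω`. -/
theorem dual_fieldAlg [FiniteDimensional ℝ V] (E : AdaptedBasis D d) (α l : Fin d) (x : FockAlg V) :
    dual E α (fieldAlg E l x) =
      fieldAlg E l (dual E α x) + conjMat E l α • vacCoeff E x • 1 := by
  have h := dualTwo_field E α l x 1
  rw [annBar_one, map_zero, add_zero, diag_one] at h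
  rw [fieldAlg_apply, map_add, dual_apply, dual_apply, dual_apply, dualTwo_cre, ← h, rcre_one,
    contr_apply_one, vacCoeff_pairDiag, parity, vacCoeff_diag]
  abel

/-! ### The vacuum functional of the dual operators -/

/-- The operator `l(e_{c_n}) ⋯ l(e_{c_1})` for a word `c_1 ⋯ c_n`. -/
def stripList (E : AdaptedBasis D d) : List (Fin d) → Module.End ℂ (FockAlg V)
  | [] => LinearMap.id
  | c :: l => stripList E l ∘ₗ strip E c

theorem rcre_mul_wordVec (E : AdaptedBasis D d) (c : Fin d) (y : FockAlg V) (l : List (Fin d)) :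
    rcre E c y * wordVec E l = y * wordVec E (c :: l) := by
  rw [wordVec_cons, cre_apply, ← mul_assoc]
  rfl

/-- The vacuum coefficient of `dualTwo x y`, sorted by the length of the word in front of the
removed letter. -/
theorem hasSum_vacCoeff_dualTwo (E : AdaptedBasis D d) (α : Fin d) (x y : FockAlg V) :
    HasSum (fun n : ℕ => ∑ β, ∑ w : Fin n → Fin d, conjMat E β α *
      vacCoeff E (contr E (pairDiag E (twc E α)
        (parity E (strip E β (stripList E (List.ofFn w) x)))) (y * wordVec E (List.ofFn w))))
      (vacCoeff E (dualTwo E α x y)) := by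
  induction x using fock_induction E generalizing y with
  | one =>
    have h : ∀ (l : List (Fin d)) β, strip E β (stripList E l 1) = 0 := by
      intro l β
      rcases l with _ | ⟨c, l⟩
      · simp [stripList]
      · simp [stripList]
    simp [h, dualTwo_one]
  | cre c x ih =>
    have h0 : (∑ β, ∑ w : Fin 0 → Fin d, conjMat E β α *
        vacCoeff E (contr E (pairDiag E (twc E α) (parity E (strip E β
          (stripList E (List.ofFn w) (cre E c x))))) (y * wordVec E (List.ofFn w)))) =
        conjMat E c α * vacCoeff E (contr E (pairDiag E (twc E α) (parity E x)) y) := by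
      rw [Finset.sum_eq_single c]
      · simp [stripList, strip_cre]
      · intro β _ hβ
        simp [stripList, strip_cre, hβ]
      · simp
    rw [dualTwo_cre, map_add, map_smul, smul_eq_mul, ← h0]
    refine (hasSum_nat_add_iff' 1).mp ?_
    rw [Finset.sum_range_one, add_sub_cancel_right]
    refine HasSum.congr_fun (ih (rcre E c y)) fun n => ?_
    refine Finset.sum_congr rfl fun β _ => ?_
    rw [← (Fin.consEquiv fun _ : Fin (n + 1) => Fin d).sum_comp, Fintype.sum_prod_type,
      Finset.sum_eq_single c]
    · refine Finset.sum_congr rfl fun w _ => ?_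
      have hw : List.ofFn (Fin.consEquiv (fun _ : Fin (n + 1) => Fin d) (c, w)) =
          c :: List.ofFn w := List.ofFn_cons c w
      simp only [hw, stripList, LinearMap.comp_apply, strip_cre,
        if_true, rcre_mul_wordVec]
    · intro b _ hb
      refine Finset.sum_eq_zero fun w _ => ?_
      simp [stripList, strip_cre, hb]
    · simp
  | add x z hx hz =>
    simp only [map_add, LinearMap.add_apply, mul_add, Finset.sum_add_distrib]
    exact (hx y).add (hz y)
  | smul r x hx =>
    rw [map_smul, LinearMap.smul_apply, map_smul, smul_eq_mul]
    refine HasSum.congr_fun ((hx y).mul_left r) fun n => ?_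
    simp only [map_smul, LinearMap.smul_apply, smul_eq_mul, Finset.mul_sum, mul_left_comm _ r]

/-- The tensor `ē_{c_1} ⊗ ⋯ ⊗ ē_{c_n}`. -/
def barVec (E : AdaptedBasis D d) : List (Fin d) → FockAlg V
  | [] => 1
  | c :: l => creation (E.e c).bar (barVec E l)

/-- The vacuum coefficient of a contraction against a word sees the full contractions only, and is
an inner product with the conjugate word. -/
theorem vacCoeff_contr_wordVec [FiniteDimensional ℝ V] (E : AdaptedBasis D d) {κ : Fin d → ℂ}
    (hκ : ∀ j j', E.col j = E.col j' → κ j = κ j') (w : List (Fin d)) (z : FockAlg V) :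
    vacCoeff E (contr E (pairDiag E κ z) (wordVec E w)) =
      pairWeight E κ w * inner ℂ (emb E (barVec E w)) (emb E z) := by
  induction w generalizing z with
  | nil =>
    rw [wordVec_nil, contr_apply_one, map_smul, vacCoeff_pairDiag, vacCoeff_one, smul_eq_mul,
      mul_one, pairWeight, one_mul, ← inner_vac_emb]
    rfl
  | cons l w ih =>
    rw [wordVec_cons, contr_pairDiag_cre E hκ, map_add, vacCoeff_cre, zero_add, map_smul,
      diag_wordVec, map_smul, map_smul, ih, barVec, inner_creation, pairWeight]
    have : annihilation E (E.e l).bar = annBar E l := annihilation_eq_sum E _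
    rw [this, smul_eq_mul, smul_eq_mul]
    ring

theorem inner_barVec_parity [FiniteDimensional ℝ V] (E : AdaptedBasis D d) (w : List (Fin d))
    (z : FockAlg V) :
    inner ℂ (emb E (barVec E w)) (emb E (parity E z)) =
      (-1) ^ w.length * inner ℂ (emb E (barVec E w)) (emb E z) := by
  induction w generalizing z with
  | nil =>
    have h := fun z => inner_vac_emb E z
    simp only [vac] at h
    rw [barVec, h, h, parity, vacCoeff_diag]; simp
  | cons l w ih =>
    have : annihilation E (E.e l).bar = annBar E l := annihilation_eq_sum E _
    rw [barVec, inner_creation, inner_creation, this, annBar_parity, map_neg, inner_neg_right, ih,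
      List.length_cons, pow_succ]
    ring

/-- The vacuum functional of `D_α` as a series of the vectors `L_{wβ}^* ē_w`. -/
theorem hasSum_vacCoeff_dual [FiniteDimensional ℝ V] (E : AdaptedBasis D d) (α : Fin d)
    (x : FockAlg V) :
    HasSum (fun n : ℕ => (-1) ^ n * ∑ β, ∑ w : Fin n → Fin d, conjMat E β α *
      (pairWeight E (twc E α) (List.ofFn w) * inner ℂ (emb E (barVec E (List.ofFn w)))
        (emb E (strip E β (stripList E (List.ofFn w) x))))) (vacCoeff E (dual E α x)) := by
  have h := hasSum_vacCoeff_dualTwo E α x 1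
  simp only [one_mul, vacCoeff_contr_wordVec E (col_twc E α), inner_barVec_parity,
    List.length_ofFn] at h
  refine HasSum.congr_fun h fun n => ?_
  simp only [Finset.mul_sum]
  refine Finset.sum_congr rfl fun β _ => Finset.sum_congr rfl fun w _ => ?_
  ring

/-! ### The adjoints of the free annihilation operators -/

theorem freeAnnOp_emb (E : AdaptedBasis D d) (k : Fin d) (x : FockAlg V) :
    freeAnnOp E k (emb E x) = emb E (strip E k x) := extension_emb (extends_strip E k) x

theorem vacCoeff_eq_zero_of_mem_deg (E : AdaptedBasis D d) {n : ℕ} {x : FockAlg V}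
    (hx : x ∈ deg E (n + 1)) : vacCoeff E x = 0 := by
  refine exists_cre_of_mem_deg E (p := fun x => vacCoeff E x = 0) (map_zero _)
    (fun x y h h' => ?_) (fun c x h => ?_)
    (fun k x _ => vacCoeff_cre E k x) hx
  · rw [map_add, h, h', add_zero]
  · rw [map_smul, h, smul_zero]

/-- The adjoint of `l(e_k)` maps `x` to the solution `z` of `∑_j e_j ⊗ a(e_j) z = e_k ⊗ x`. -/
theorem adjoint_freeAnnOp_emb (E : AdaptedBasis D d) (k : Fin d) {n : ℕ} {x z : FockAlg V}
    (hz : z ∈ deg E (n + 1)) (h : cyc E z = cre E k x) :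
    ContinuousLinearMap.adjoint (freeAnnOp E k) (emb E x) = emb E z := by
  have hann : ∀ j, ann E j z = if j = k then x else 0 := fun j => by
    rw [← strip_cyc, h, strip_cre]
  have key : ∀ y, inner ℂ (emb E x) (emb E (strip E k y)) = inner ℂ (emb E z) (emb E y) := by
    intro y
    induction y using fock_induction E with
    | one =>
      have : inner ℂ (emb E 1) (emb E z) = vacCoeff E z := inner_vac_emb E z
      rw [strip_one, map_zero, inner_zero_right, ← inner_conj_symm, this,
        vacCoeff_eq_zero_of_mem_deg E hz, map_zero]
    | cre j y _ =>
      rw [inner_emb_cre_right, hann, strip_cre]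
      by_cases hjk : j = k
      · subst hjk; simp
      · simp [hjk, Ne.symm hjk]
    | add y y' h h' => simp only [map_add, inner_add_right, h, h']
    | smul c y h => simp only [map_smul, inner_smul_right, h]
  refine ext_inner_right ℂ fun v => ?_
  rw [ContinuousLinearMap.adjoint_inner_left]
  induction v using (denseRange_emb E).induction_on with
  | hp => 
    exact isClosed_eq (by fun_prop) (by fun_prop)
  | ih y => rw [freeAnnOp_emb, key]

/-- The adjoints of the free annihilation operators raise the degree by one and are bounded for the
`ℓ¹` norm. -/
theorem exists_adjoint_freeAnnOp (E : AdaptedBasis D d) : ∃ C : ℝ, 0 ≤ C ∧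
    ∀ (k : Fin d) (n : ℕ), ∀ x ∈ deg E n, ∃ z ∈ deg E (n + 1),
      ContinuousLinearMap.adjoint (freeAnnOp E k) (emb E x) = emb E z ∧
        wnorm E z ≤ C * wnorm E x := by
  obtain ⟨C, hC0, hC⟩ := exists_cyc_eq_norm E
  refine ⟨C, hC0, fun k n x hx => ?_⟩
  obtain ⟨z, hz, h, hn, -⟩ := hC n _ (cre_mem_deg E k hx)
  exact ⟨z, hz, adjoint_freeAnnOp_emb E k hz h,
    hn.trans (mul_le_mul_of_nonneg_left (wnorm_cre_le E k hx) hC0)⟩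

theorem exists_adjoint_prod_freeAnnOp (E : AdaptedBasis D d) {C : ℝ} (hC0 : 0 ≤ C)
    (hC : ∀ (k : Fin d) (n : ℕ), ∀ x ∈ deg E n, ∃ z ∈ deg E (n + 1),
      ContinuousLinearMap.adjoint (freeAnnOp E k) (emb E x) = emb E z ∧
        wnorm E z ≤ C * wnorm E x) (l : List (Fin d)) {n : ℕ} {x : FockAlg V}
    (hx : x ∈ deg E n) : ∃ z ∈ deg E (n + l.length),
      ContinuousLinearMap.adjoint (l.map (freeAnnOp E)).reverse.prod (emb E x) = emb E z ∧
        wnorm E z ≤ C ^ l.length * wnorm E x := by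
  induction l with
  | nil =>
    refine ⟨x, hx, ?_, by simp⟩
    simp [← ContinuousLinearMap.star_eq_adjoint]
  | cons c l ih =>
    obtain ⟨z, hz, h, hn⟩ := ih
    obtain ⟨z', hz', h', hn'⟩ := hC c _ z hz
    refine ⟨z', hz', ?_, ?_⟩
    · rw [List.map_cons, List.reverse_cons, List.prod_append, List.prod_singleton,
        ← ContinuousLinearMap.star_eq_adjoint, star_mul, ContinuousLinearMap.star_eq_adjoint,
        ContinuousLinearMap.star_eq_adjoint, mul_apply_eq_comp, h, h']
    · refine hn'.trans ((mul_le_mul_of_nonneg_left hn hC0).trans_eq ?_)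
      rw [List.length_cons, pow_succ]
      ring

/-! ### The vectors of the series -/

theorem prod_freeAnnOp_emb (E : AdaptedBasis D d) (l : List (Fin d)) (x : FockAlg V) :
    (l.map (freeAnnOp E)).reverse.prod (emb E x) = emb E (stripList E l x) := by
  induction l generalizing x with
  | nil => rfl
  | cons c l ih =>
    rw [List.map_cons, List.reverse_cons, List.prod_append, List.prod_singleton,
      mul_apply_eq_comp, freeAnnOp_emb, ih]
    rfl

theorem annWord_eq (E : AdaptedBasis D d) {n : ℕ} (w : Fin n → Fin d) (β : Fin d) :
    annWord E w β = freeAnnOp E β * ((List.ofFn w).map (freeAnnOp E)).reverse.prod := by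
  rw [annWord, List.map_ofFn]
  rfl

theorem annWord_emb (E : AdaptedBasis D d) {n : ℕ} (w : Fin n → Fin d) (β : Fin d)
    (x : FockAlg V) :
    annWord E w β (emb E x) = emb E (strip E β (stripList E (List.ofFn w) x)) := by
  rw [annWord_eq, mul_apply_eq_comp, prod_freeAnnOp_emb, freeAnnOp_emb]

theorem barVec_eq_prod (E : AdaptedBasis D d) (l : List (Fin d)) :
    barVec E l = (l.map fun c => TensorAlgebra.ι ℂ (E.e c).bar).prod := by
  induction l with
  | nil => rfl
  | cons c l ih => rw [barVec, ih, List.map_cons, List.prod_cons]; rfl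

theorem barWord_eq (E : AdaptedBasis D d) {n : ℕ} (w : Fin n → Fin d) :
    barWord E w = emb E (barVec E (List.ofFn w)) := by
  rw [barWord, simpleTensor, barVec_eq_prod, List.map_ofFn]
  rfl

theorem exists_barVec_bound (E : AdaptedBasis D d) : ∃ b : ℝ, 0 ≤ b ∧ ∀ l : List (Fin d),
    barVec E l ∈ deg E l.length ∧ wnorm E (barVec E l) ≤ b ^ l.length := by
  refine ⟨∑ c, ∑ k, ‖E.e.repr (E.e c).bar k‖, by positivity, fun l => ?_⟩
  set b := ∑ c, ∑ k, ‖E.e.repr (E.e c).bar k‖ with hb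
  have hb0 : 0 ≤ b := by positivity
  induction l with
  | nil =>
    refine ⟨one_mem_deg E, ?_⟩
    rw [barVec, ← wordVec_nil E, wnorm_wordVec]
    simp
  | cons c l ih =>
    obtain ⟨hm, hn⟩ := ih
    have h : barVec E (c :: l) = ∑ k, E.e.repr (E.e c).bar k • cre E k (barVec E l) := by
      rw [barVec, creation_eq_sum E]
      simp [LinearMap.sum_apply]
    rw [h]
    refine ⟨Submodule.sum_mem _ fun k _ => Submodule.smul_mem _ _ (cre_mem_deg E k hm), ?_⟩
    calc wnorm E (∑ k, E.e.repr (E.e c).bar k • cre E k (barVec E l))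
        ≤ ∑ k, ‖E.e.repr (E.e c).bar k‖ * wnorm E (barVec E l) := by
          refine (seminorm_sum_le _ _ _).trans (Finset.sum_le_sum fun k _ => ?_)
          rw [map_smul_eq_mul]
          exact mul_le_mul_of_nonneg_left (wnorm_cre_le E k hm) (norm_nonneg _)
      _ ≤ b * b ^ l.length := by
          rw [← Finset.sum_mul]
          refine mul_le_mul ?_ hn (apply_nonneg _ _) hb0
          exact Finset.single_le_sum (f := fun c => ∑ k, ‖E.e.repr (E.e c).bar k‖)
            (fun _ _ => by positivity) (Finset.mem_univ c)
      _ = b ^ (c :: l).length := by rw [List.length_cons, pow_succ, mul_comm]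

theorem pairWeight_ofFn (E : AdaptedBasis D d) (κ : Fin d → ℂ) {n : ℕ} (w : Fin n → Fin d) :
    pairWeight E κ (List.ofFn w) =
      (∏ p : Fin n × Fin n with p.1 < p.2, twc E (w p.1) (w p.2)) * ∏ t, κ (w t) := by
  induction n with
  | zero => simp [pairWeight]
  | succ n ih =>
    rw [List.ofFn_succ, pairWeight, ih, Finset.prod_filter, Finset.prod_filter,
      Fintype.prod_prod_type, Fintype.prod_prod_type, Fin.prod_univ_succ, Fin.prod_univ_succ,
      List.map_ofFn, List.prod_ofFn, Fin.prod_univ_succ]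
    simp only [Fin.prod_univ_succ (fun j : Fin (n + 1) => ite _ _ _), Fin.succ_pos, lt_irrefl,
      Fin.not_lt_zero, if_true, if_false, one_mul, Fin.succ_lt_succ_iff, Function.comp_apply]
    ring

theorem norm_pairWeight_le (E : AdaptedBasis D d) {q : ℝ} (hq0 : 0 ≤ q)
    (hq : ∀ k l, ‖twc E k l‖ ≤ q) {κ : Fin d → ℂ} (hκ : ∀ k, ‖κ k‖ ≤ q) (l : List (Fin d)) :
    ‖pairWeight E κ l‖ ≤ ∏ k ∈ Finset.range l.length, q ^ (k + 1) := by
  induction l with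
  | nil => simp [pairWeight]
  | cons c l ih =>
    have h : ‖(l.map (twc E c)).prod‖ ≤ q ^ l.length := by
      clear ih
      induction l with
      | nil => simp
      | cons j l ih =>
        rw [List.map_cons, List.prod_cons, norm_mul, List.length_cons, pow_succ']
        exact mul_le_mul (hq c j) ih (norm_nonneg _) hq0
    rw [pairWeight, norm_mul, norm_mul, List.length_cons, Finset.prod_range_succ, mul_comm,
      pow_succ']
    exact mul_le_mul ih (mul_le_mul (hκ c) h (norm_nonneg _) hq0) (by positivity)
      (Finset.prod_nonneg fun _ _ => by positivity)

theorem xiTerm_eq (E : AdaptedBasis D d) (n : ℕ) (α : Fin d) :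
    xiTerm E n α = ∑ β : Fin d, ∑ w : Fin n → Fin d, pairWeight E (twc E α) (List.ofFn w) •
      innerU D.U (E.e α) (E.e β).bar •
        ContinuousLinearMap.adjoint (annWord E w β) (emb E (barVec E (List.ofFn w))) := by
  rw [xiTerm]
  refine Finset.sum_congr rfl fun β _ => Finset.sum_congr rfl fun w _ => ?_
  rw [pairWeight_ofFn, barWord_eq]
  push_cast
  rfl

theorem conj_pairWeight (E : AdaptedBasis D d) {κ : Fin d → ℂ} (hκ : ∀ k, conj (κ k) = κ k)
    (l : List (Fin d)) : conj (pairWeight E κ l) = pairWeight E κ l := by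
  induction l with
  | nil => simp [pairWeight]
  | cons c l ih =>
    rw [pairWeight, map_mul, map_mul, ih, hκ, map_list_prod, List.map_map]
    congr 3
    exact List.map_congr_left fun j _ => conj_twc E c j

/-- The vectors `ξ_{n+1,α}` are tensors of degree `2n + 1` and superexponentially small. -/
theorem exists_xiTerm_bound (E : AdaptedBasis D d) (α : Fin d) : ∃ q S R : ℝ, 0 ≤ q ∧ q < 1 ∧
    0 ≤ R ∧ ∀ n, ∃ z ∈ deg E (2 * n + 1), emb E z = xiTerm E n α ∧
      wnorm E z ≤ S * (R ^ n * ∏ k ∈ Finset.range n, q ^ (k + 1)) := by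
  obtain ⟨q, hq0, hq1, hq⟩ := exists_tw_bound E
  obtain ⟨C, hC0, hC⟩ := exists_adjoint_freeAnnOp E
  obtain ⟨b, hb0, hb⟩ := exists_barVec_bound E
  refine ⟨q, (∑ β, ‖innerU D.U (E.e α) (E.e β).bar‖) * C, d * (C * b), hq0, hq1,
    by positivity, fun n => ?_⟩
  have hz : ∀ (β : Fin d) (w : Fin n → Fin d), ∃ z ∈ deg E (2 * n + 1),
      ContinuousLinearMap.adjoint (annWord E w β) (emb E (barVec E (List.ofFn w))) = emb E z ∧
        wnorm E z ≤ C * (C * b) ^ n := by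
    intro β w
    obtain ⟨hm, hn⟩ := hb (List.ofFn w)
    obtain ⟨y, hy, h1, h2⟩ := hC β _ _ hm
    obtain ⟨z, hz, h3, h4⟩ := exists_adjoint_prod_freeAnnOp E hC0 hC (List.ofFn w) hy
    rw [List.length_ofFn] at hz hn h4
    refine ⟨z, by convert hz using 2; ring, ?_, ?_⟩
    · rw [annWord_eq, ← ContinuousLinearMap.star_eq_adjoint, star_mul,
        ContinuousLinearMap.star_eq_adjoint, ContinuousLinearMap.star_eq_adjoint,
        mul_apply_eq_comp, h1, h3]
    · calc wnorm E z ≤ C ^ n * (C * b ^ n) :=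
            h4.trans (mul_le_mul_of_nonneg_left
              (h2.trans (mul_le_mul_of_nonneg_left hn hC0)) (by positivity))
        _ = C * (C * b) ^ n := by rw [mul_pow]; ring
  choose z hzm hz hzn using hz
  refine ⟨∑ β, ∑ w : Fin n → Fin d, pairWeight E (twc E α) (List.ofFn w) •
      innerU D.U (E.e α) (E.e β).bar • z β w,
    Submodule.sum_mem _ fun β _ => Submodule.sum_mem _ fun w _ =>
      Submodule.smul_mem _ _ (Submodule.smul_mem _ _ (hzm β w)), ?_, ?_⟩
  · simp only [xiTerm_eq, hz, map_sum, map_smul]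
  · have hle : ∀ β w, wnorm E (pairWeight E (twc E α) (List.ofFn w) •
        innerU D.U (E.e α) (E.e β).bar • z β w) ≤
        (∏ k ∈ Finset.range n, q ^ (k + 1)) *
          (‖innerU D.U (E.e α) (E.e β).bar‖ * (C * (C * b) ^ n)) := by
      intro β w
      rw [map_smul_eq_mul, map_smul_eq_mul]
      -- there are `n (n + 1) / 2` twists in the weight of a word of length `n`
      have := norm_pairWeight_le E hq0 hq (hq α) (List.ofFn w)
      rw [List.length_ofFn] at this
      exact mul_le_mul this (mul_le_mul_of_nonneg_left (hzn β w) (norm_nonneg _))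
        (by positivity) (Finset.prod_nonneg fun _ _ => by positivity)
    calc _ ≤ ∑ β : Fin d, ∑ _w : Fin n → Fin d, (∏ k ∈ Finset.range n, q ^ (k + 1)) *
          (‖innerU D.U (E.e α) (E.e β).bar‖ * (C * (C * b) ^ n)) :=
          (seminorm_sum_le _ _ _).trans (Finset.sum_le_sum fun β _ =>
            (seminorm_sum_le _ _ _).trans (Finset.sum_le_sum fun w _ => hle β w))
      _ = _ := by
          simp only [Finset.sum_const, Finset.card_univ, Fintype.card_pi, Fintype.card_fin,
            Finset.prod_const, nsmul_eq_mul, ← Finset.mul_sum, ← Finset.sum_mul]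
          push_cast
          ring

theorem summable_pow_mul_prod (S R q : ℝ) (hR : 0 ≤ R) (hq0 : 0 ≤ q) (hq1 : q < 1) :
    Summable fun n : ℕ => S * (R ^ n * ∏ k ∈ Finset.range n, q ^ (k + 1)) := by
  refine Summable.mul_left S ?_
  have hlim : Filter.Tendsto (fun n : ℕ => R * q ^ (n + 1)) Filter.atTop (nhds 0) := by
    simpa using ((tendsto_pow_atTop_nhds_zero_of_lt_one hq0 hq1).comp
      (Filter.tendsto_add_atTop_nat 1)).const_mul R
  refine summable_of_ratio_norm_eventually_le (r := 1 / 2) (by norm_num) ?_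
  filter_upwards [hlim.eventually_le_const (show (0 : ℝ) < 1 / 2 by norm_num)] with n hn
  have hp : 0 ≤ R ^ n * ∏ k ∈ Finset.range n, q ^ (k + 1) :=
    mul_nonneg (by positivity) (Finset.prod_nonneg fun _ _ => by positivity)
  have : R ^ (n + 1) * ∏ k ∈ Finset.range (n + 1), q ^ (k + 1) =
      (R * q ^ (n + 1)) * (R ^ n * ∏ k ∈ Finset.range n, q ^ (k + 1)) := by
    rw [Finset.prod_range_succ, pow_succ]; ring
  rw [this, norm_mul, Real.norm_of_nonneg (by positivity : 0 ≤ R * q ^ (n + 1))]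
  exact mul_le_mul_of_nonneg_right hn (norm_nonneg _)

/-- The series of Wick operators converges in norm; its sum applied to the vacuum is the sum of
the vectors. -/
theorem exists_hasSum_wick [FiniteDimensional ℝ V] (E : AdaptedBasis D d) (α : Fin d) :
    ∃ X ∈ awAlgebra E,
    HasSum (fun n : ℕ => (-1 : ℂ) ^ n • wick E (xiTerm E n α)) X ∧
      HasSum (fun n : ℕ => (-1 : ℂ) ^ n • xiTerm E n α) (X (vac E)) := by
  obtain ⟨q, S, R, hq0, hq1, hR, h⟩ := exists_xiTerm_bound E α
  obtain ⟨K, hK1, hK⟩ := exists_norm_wick_le E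
  choose z hzm hz hzn using h
  have hsum : Summable fun n : ℕ => (-1 : ℂ) ^ n • wick E (xiTerm E n α) := by
    refine Summable.of_norm_bounded (summable_pow_mul_prod (K * S) (K ^ 2 * R) q (by positivity) hq0
      hq1) fun n => ?_
    rw [norm_smul, norm_pow, norm_neg, norm_one, one_pow, one_mul, ← hz]
    calc _ ≤ K ^ (2 * n + 1) * wnorm E (z n) := (hK _ _ (hzm n)).2
      _ ≤ K ^ (2 * n + 1) * (S * (R ^ n * ∏ k ∈ Finset.range n, q ^ (k + 1))) :=
          mul_le_mul_of_nonneg_left (hzn n) (by positivity)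
      _ = _ := by rw [mul_pow, ← pow_mul, pow_succ]; ring
  refine ⟨_, ?_, hsum.hasSum, ?_⟩
  · refine (isClosed_awAlgebra E).mem_of_tendsto hsum.hasSum
      (Filter.Eventually.of_forall fun s => ?_)
    exact sum_mem fun n _ => (awAlgebra E).toStarSubalgebra.smul_mem (wick_mem E _) _
  · have := (ContinuousLinearMap.apply ℂ (Fock E) (vac E)).hasSum hsum.hasSum
    refine HasSum.congr_fun this fun n => ?_
    rw [ContinuousLinearMap.apply_apply, smul_apply, ← hz, (hK _ _ (hzm n)).1]

/-- The sum of the series represents the vacuum functional of the dual operator. -/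
theorem inner_eq_vacCoeff_dual [FiniteDimensional ℝ V] (E : AdaptedBasis D d) (α : Fin d)
    {ξ : Fock E}
    (hξ : HasSum (fun n : ℕ => (-1 : ℂ) ^ n • xiTerm E n α) ξ) (x : FockAlg V) :
    inner ℂ ξ (emb E x) = vacCoeff E (dual E α x) := by
  have h1 := hasSum_vacCoeff_dual E α x
  have h2 : HasSum (fun n : ℕ => inner ℂ ((-1 : ℂ) ^ n • xiTerm E n α) (emb E x))
      (inner ℂ ξ (emb E x)) :=
    hξ.map ((innerSLFlip ℂ (emb E x)).toLinearMap.toAddMonoidHom)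
      (innerSLFlip ℂ (emb E x)).continuous
  refine h2.unique (HasSum.congr_fun h1 fun n => ?_)
  have hconj : ∀ k, conj (twc E α k) = twc E α k := conj_twc E α
  rw [inner_smul_left, map_pow, map_neg, map_one, xiTerm_eq, sum_inner]
  congr 1
  refine Finset.sum_congr rfl fun β _ => ?_
  rw [sum_inner]
  refine Finset.sum_congr rfl fun w _ => ?_
  rw [inner_smul_left, inner_smul_left, ContinuousLinearMap.adjoint_inner_left, annWord_emb,
    conj_pairWeight E hconj, conj_innerU E, ← conjMat_def]
  ring

/-! ### The polynomials in the generators -/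

/-- The tensors of degree less than `n`. -/
def lowDeg (E : AdaptedBasis D d) (n : ℕ) : Submodule ℂ (FockAlg V) :=
  Submodule.span ℂ {x | ∃ l : List (Fin d), l.length < n ∧ wordVec E l = x}

theorem lowDeg_mono (E : AdaptedBasis D d) {m n : ℕ} (h : m ≤ n) : lowDeg E m ≤ lowDeg E n :=
  Submodule.span_mono fun _ ⟨l, hl, hx⟩ => ⟨l, hl.trans_le h, hx⟩

theorem deg_le_lowDeg (E : AdaptedBasis D d) {m n : ℕ} (h : m < n) : deg E m ≤ lowDeg E n := by
  intro x hx
  exact map_mem_of_mem_deg E LinearMap.id (lowDeg E n)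
    (fun l hl => Submodule.subset_span ⟨l, hl.trans_lt h, rfl⟩) hx

theorem map_mem_of_mem_lowDeg (E : AdaptedBasis D d) (f : Module.End ℂ (FockAlg V))
    {S : Submodule ℂ (FockAlg V)} {n : ℕ}
    (h : ∀ l : List (Fin d), l.length < n → f (wordVec E l) ∈ S) {x : FockAlg V}
    (hx : x ∈ lowDeg E n) : f x ∈ S := by
  have : lowDeg E n ≤ S.comap f := by
    refine Submodule.span_le.mpr ?_
    rintro _ ⟨l, hl, rfl⟩
    exact h l hl
  exact this hx

theorem cre_mem_lowDeg (E : AdaptedBasis D d) (k : Fin d) {n : ℕ} {x : FockAlg V}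
    (hx : x ∈ lowDeg E n) : cre E k x ∈ lowDeg E (n + 1) :=
  map_mem_of_mem_lowDeg E (cre E k) (fun l hl => by
    rw [← wordVec_cons]
    exact Submodule.subset_span ⟨k :: l, by simpa using hl, rfl⟩) hx

theorem annBar_mem_deg (E : AdaptedBasis D d) (k : Fin d) {n : ℕ} {x : FockAlg V}
    (hx : x ∈ deg E (n + 1)) : annBar E k x ∈ deg E n := by
  rw [annBar_apply]
  exact Submodule.sum_mem _ fun j _ => Submodule.smul_mem _ _ (ann_mem_deg E j hx)

theorem annBar_mem_lowDeg (E : AdaptedBasis D d) (k : Fin d) {n : ℕ} {x : FockAlg V}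
    (hx : x ∈ lowDeg E (n + 1)) : annBar E k x ∈ lowDeg E n := by
  refine map_mem_of_mem_lowDeg E (annBar E k) (fun l hl => ?_) hx
  rcases l with _ | ⟨j, l⟩
  · rw [wordVec_nil, annBar_one]
    exact zero_mem _
  · refine deg_le_lowDeg E (Nat.lt_of_succ_lt_succ hl) (annBar_mem_deg E k ?_)
    exact wordVec_mem_deg E (j :: l)

theorem exists_mem_lowDeg (E : AdaptedBasis D d) (x : FockAlg V) : ∃ n, x ∈ lowDeg E n := by
  induction x using fock_induction E with
  | one => exact ⟨1, deg_le_lowDeg E zero_lt_one (one_mem_deg E)⟩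
  | cre k x ih =>
    obtain ⟨n, hn⟩ := ih
    exact ⟨n + 1, cre_mem_lowDeg E k hn⟩
  | add x y hx hy =>
    obtain ⟨n, hn⟩ := hx
    obtain ⟨m, hm⟩ := hy
    exact ⟨max n m, add_mem (lowDeg_mono E (le_max_left n m) hn)
      (lowDeg_mono E (le_max_right n m) hm)⟩
  | smul c x hx =>
    obtain ⟨n, hn⟩ := hx
    exact ⟨n, Submodule.smul_mem _ c hn⟩

/-- Every tensor is obtained from the vacuum by applying the operators `A_l`, since `A_l x` has the
leading term `e_l ⊗ x`. -/
theorem field_induction (E : AdaptedBasis D d) {p : FockAlg V → Prop} (one : p 1)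
    (field : ∀ l x, p x → p (fieldAlg E l x)) (add : ∀ x y, p x → p y → p (x + y))
    (smul : ∀ (c : ℂ) x, p x → p (c • x)) (x : FockAlg V) : p x := by
  have zero : p 0 := by simpa using smul 0 1 one
  have hword : ∀ n, ∀ x ∈ lowDeg E n, p x := by
    intro n
    induction n with
    | zero =>
      intro x hx
      simpa [lowDeg, (by simpa [lowDeg] using hx : x = 0)] using zero
    | succ n ih =>
      intro x hx
      refine Submodule.span_induction ?_ zero (fun x y _ _ => add x y) (fun c x _ => smul c x) hx
      rintro _ ⟨l, hl, rfl⟩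
      rcases l with _ | ⟨k, l⟩
      · rwa [wordVec_nil]
      · have hl' : l.length < n := Nat.lt_of_succ_lt_succ hl
        have hm : wordVec E l ∈ lowDeg E n := Submodule.subset_span ⟨l, hl', rfl⟩
        have h : wordVec E (k :: l) =
            fieldAlg E k (wordVec E l) + (-1 : ℂ) • annBar E k (wordVec E l) := by
          rw [fieldAlg_apply, wordVec_cons]
          module
        rw [h]
        exact add _ _ (field _ _ (ih _ hm)) (smul _ _ (ih _
          (annBar_mem_lowDeg E k (lowDeg_mono E n.le_succ hm))))
  obtain ⟨n, hn⟩ := exists_mem_lowDeg E x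
  exact hword n x hn

/-- The algebra homomorphism from the tensor algebra that maps `e_k` to the operator `A_k`,
restricted to the algebraic Fock space. -/
def fieldHom (E : AdaptedBasis D d) : FockAlg V →ₐ[ℂ] Module.End ℂ (FockAlg V) :=
  TensorAlgebra.lift ℂ (E.e.constr ℂ (fieldAlg E))

theorem fieldHom_cre (E : AdaptedBasis D d) (k : Fin d) (x y : FockAlg V) :
    fieldHom E (cre E k x) y = fieldAlg E k (fieldHom E x y) := by
  rw [cre_apply, map_mul, fieldHom, TensorAlgebra.lift_ι_apply, Module.Basis.constr_basis]
  rfl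

/-- The vector `p(A_1, …, A_d) Ω` of a noncommutative polynomial `p`. -/
def polyVec (E : AdaptedBasis D d) : Module.End ℂ (FockAlg V) :=
  (fieldHom E).toLinearMap.flip 1

@[simp] theorem polyVec_one (E : AdaptedBasis D d) : polyVec E 1 = 1 :=
  LinearMap.congr_fun (map_one (fieldHom E)) 1

theorem polyVec_cre (E : AdaptedBasis D d) (k : Fin d) (x : FockAlg V) :
    polyVec E (cre E k x) = fieldAlg E k (polyVec E x) := fieldHom_cre E k x 1

/-- The leading term of `p(A_1, …, A_d) Ω` is `p`. -/
theorem polyVec_sub_mem (E : AdaptedBasis D d) {n : ℕ} {x : FockAlg V}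
    (hx : x ∈ lowDeg E (n + 1)) : polyVec E x - x ∈ lowDeg E n := by
  refine map_mem_of_mem_lowDeg E (polyVec E - LinearMap.id) (fun l hl => ?_) hx
  refine lowDeg_mono E (Nat.le_of_lt_succ hl) ?_
  clear hl hx
  induction l with
  | nil => simp
  | cons k l ih =>
    have hl : wordVec E l ∈ lowDeg E (l.length + 1) :=
      Submodule.subset_span ⟨l, l.length.lt_succ_self, rfl⟩
    have h : (polyVec E - LinearMap.id : Module.End ℂ (FockAlg V)) (wordVec E (k :: l)) =
        cre E k ((polyVec E - LinearMap.id : Module.End ℂ (FockAlg V)) (wordVec E l)) +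
          annBar E k ((polyVec E - LinearMap.id : Module.End ℂ (FockAlg V)) (wordVec E l) +
            wordVec E l) := by
      simp only [LinearMap.sub_apply, LinearMap.id_apply, wordVec_cons, polyVec_cre,
        fieldAlg_apply, map_sub, sub_add_cancel]
      abel
    rw [h, List.length_cons]
    refine add_mem (cre_mem_lowDeg E k ih) (lowDeg_mono E l.length.le_succ
      (annBar_mem_lowDeg E k (add_mem (lowDeg_mono E l.length.le_succ ih) hl)))

theorem polyVec_injective (E : AdaptedBasis D d) : Function.Injective (polyVec E) := by
  refine (injective_iff_map_eq_zero _).mpr fun x hx => ?_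
  obtain ⟨n, hn⟩ := exists_mem_lowDeg E x
  induction n with
  | zero => simpa [lowDeg] using hn
  | succ n ih =>
    refine ih ?_
    have := polyVec_sub_mem E hn
    rwa [hx, zero_sub, neg_mem_iff] at this

/-- The algebra homomorphism from the tensor algebra that maps `e_k` to the operator `A_k`. -/
def polyHom (E : AdaptedBasis D d) : FockAlg V →ₐ[ℂ] awStar E :=
  TensorAlgebra.lift ℂ (E.e.constr ℂ fun k => (⟨fieldOp E k, fieldOp_mem E k⟩ : awStar E))

theorem polyHom_ι (E : AdaptedBasis D d) (k : Fin d) :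
    polyHom E (TensorAlgebra.ι ℂ (E.e k)) = ⟨fieldOp E k, fieldOp_mem E k⟩ := by
  rw [polyHom, TensorAlgebra.lift_ι_apply, Module.Basis.constr_basis]

theorem polyHom_cre (E : AdaptedBasis D d) (k : Fin d) (x : FockAlg V) :
    polyHom E (cre E k x) = ⟨fieldOp E k, fieldOp_mem E k⟩ * polyHom E x := by
  rw [cre_apply, map_mul, polyHom_ι]

theorem polyHom_vac (E : AdaptedBasis D d) (x : FockAlg V) :
    (polyHom E x : Fock E →L[ℂ] Fock E) (vac E) = emb E (polyVec E x) := by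
  induction x using fock_induction E with
  | one => rw [map_one, polyVec_one]; rfl
  | cre k x ih =>
    rw [polyHom_cre, polyVec_cre, ← fieldOp_emb, ← ih]
    rfl
  | add x y hx hy =>
    rw [map_add, map_add, map_add, ← hx, ← hy]
    rfl
  | smul c x hx =>
    rw [map_smul, map_smul, map_smul, ← hx]
    rfl

theorem polyHom_injective (E : AdaptedBasis D d) : Function.Injective (polyHom E) := by
  intro x y h
  refine polyVec_injective E (emb_injective E ?_)
  rw [← polyHom_vac, ← polyHom_vac, h]

theorem exists_polyHom_eq_star (E : AdaptedBasis D d) (x : FockAlg V) :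
    ∃ y, polyHom E y = star (polyHom E x) := by
  induction x using fock_induction E with
  | one => exact ⟨1, by rw [map_one, star_one]⟩
  | cre k x ih =>
    obtain ⟨y, hy⟩ := ih
    obtain ⟨c, hc⟩ := star_fieldOp E k
    refine ⟨y * ∑ j, c j • TensorAlgebra.ι ℂ (E.e j), ?_⟩
    rw [polyHom_cre, star_mul, map_mul, hy]
    congr 1
    refine Subtype.ext ?_
    simp only [map_sum, map_smul, polyHom_ι]
    refine Eq.trans ?_ hc.symm
    rw [AddSubmonoidClass.coe_finsetSum]
    rfl
  | add x y hx hy =>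
    obtain ⟨x', hx⟩ := hx
    obtain ⟨y', hy⟩ := hy
    exact ⟨x' + y', by rw [map_add, map_add, star_add, hx, hy]⟩
  | smul c x hx =>
    obtain ⟨x', hx⟩ := hx
    exact ⟨star c • x', by rw [map_smul, map_smul, star_smul, hx]⟩

theorem exists_polyHom_eq [FiniteDimensional ℝ V] (E : AdaptedBasis D d) {X : Fock E →L[ℂ] Fock E}
    (hX : X ∈ polyAlg E) :
    ∃ x, (polyHom E x : Fock E →L[ℂ] Fock E) = X := by
  refine StarAlgebra.adjoin_induction
    (p := fun X _ => ∃ x, (polyHom E x : Fock E →L[ℂ] Fock E) = X)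
    ?_ ?_ ?_ ?_ ?_ hX
  · rintro _ ⟨k, rfl⟩
    exact ⟨TensorAlgebra.ι ℂ (E.e k), by rw [polyHom_ι, gen_eq_fieldOp]⟩
  · intro r
    exact ⟨algebraMap ℂ _ r, by rw [AlgHom.commutes]; rfl⟩
  · rintro _ _ _ _ ⟨x, rfl⟩ ⟨y, rfl⟩
    exact ⟨x + y, by rw [map_add]; rfl⟩
  · rintro _ _ _ _ ⟨x, rfl⟩ ⟨y, rfl⟩
    exact ⟨x * y, by rw [map_mul]; rfl⟩
  · rintro _ _ ⟨x, rfl⟩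
    obtain ⟨y, hy⟩ := exists_polyHom_eq_star E x
    exact ⟨y, by rw [hy]; rfl⟩

/-- The elements of the algebra of the `A_k` are polynomials in the `A_k`, which depend linearly on
the element by `polyHom_injective`. -/
theorem exists_poly [FiniteDimensional ℝ V] (E : AdaptedBasis D d) :
    ∃ Q : polyAlg E →ₗ[ℂ] FockAlg V,
    ∀ X, polyHom E (Q X) = StarSubalgebra.inclusion (polyAlg_le E) X := by
  have hsurj : ∀ X : polyAlg E, (StarSubalgebra.inclusion (polyAlg_le E)).toAlgHom.toLinearMap X ∈
      LinearMap.range (polyHom E).toLinearMap := fun X => by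
    obtain ⟨x, hx⟩ := exists_polyHom_eq E X.2
    exact ⟨x, Subtype.ext hx⟩
  refine ⟨(LinearEquiv.ofInjective (polyHom E).toLinearMap
      (polyHom_injective E)).symm.toLinearMap ∘ₗ
    LinearMap.codRestrict _ _ hsurj, fun X => ?_⟩
  exact congrArg Subtype.val (LinearEquiv.apply_symm_apply
    (LinearEquiv.ofInjective (polyHom E).toLinearMap (polyHom_injective E)) ⟨_, hsurj X⟩)

/-! ### The difference quotients -/

section Abstract

variable {B H : Type*} [Ring B] [Algebra ℂ B] [AddCommGroup H] [Module ℂ H]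

/-- The values on words of `diffQuot`. -/
def diffQuotWord (E : AdaptedBasis D d) (P : FockAlg V →ₐ[ℂ] B) (α : Fin d) :
    List (Fin d) → B ⊗[ℂ] Bᵐᵒᵖ
  | [] => 0
  | k :: l => (P (TensorAlgebra.ι ℂ (E.e k)) ⊗ₜ[ℂ] 1) * diffQuotWord E P α l +
      conjMat E k α • (1 ⊗ₜ[ℂ] MulOpposite.op (P (wordVec E l)))

/-- The difference quotient of index `α` on noncommutative polynomials, with values in the tensor
product of an algebra `B`, where the polynomials are evaluated by `P`, with its opposite. -/
def diffQuot (E : AdaptedBasis D d) (P : FockAlg V →ₐ[ℂ] B) (α : Fin d) :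
    FockAlg V →ₗ[ℂ] B ⊗[ℂ] Bᵐᵒᵖ :=
  (wordVec E).constr ℂ (diffQuotWord E P α)

theorem diffQuot_one (E : AdaptedBasis D d) (P : FockAlg V →ₐ[ℂ] B) (α : Fin d) :
    diffQuot E P α 1 = 0 := by
  rw [← wordVec_nil E, diffQuot, Module.Basis.constr_basis, diffQuotWord]

theorem diffQuot_cre (E : AdaptedBasis D d) (P : FockAlg V →ₐ[ℂ] B) (α k : Fin d)
    (x : FockAlg V) :
    diffQuot E P α (cre E k x) = (P (TensorAlgebra.ι ℂ (E.e k)) ⊗ₜ[ℂ] 1) * diffQuot E P α x +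
      conjMat E k α • (1 ⊗ₜ[ℂ] MulOpposite.op (P x)) := by
  have : diffQuot E P α ∘ₗ cre E k =
      LinearMap.mulLeft ℂ (P (TensorAlgebra.ι ℂ (E.e k)) ⊗ₜ[ℂ] 1) ∘ₗ diffQuot E P α +
        conjMat E k α • (TensorProduct.mk ℂ B Bᵐᵒᵖ 1) ∘ₗ
          (MulOpposite.opLinearEquiv ℂ).toLinearMap ∘ₗ P.toLinearMap := by
    refine (wordVec E).ext fun l => ?_
    rw [LinearMap.comp_apply, ← wordVec_cons, diffQuot, Module.Basis.constr_basis, diffQuotWord,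
      LinearMap.add_apply, LinearMap.comp_apply, Module.Basis.constr_basis]
    rfl
  exact LinearMap.congr_fun this x

theorem diffQuot_mul (E : AdaptedBasis D d) (P : FockAlg V →ₐ[ℂ] B) (α : Fin d)
    (x y : FockAlg V) :
    diffQuot E P α (x * y) = (P x ⊗ₜ[ℂ] 1) * diffQuot E P α y +
      (1 ⊗ₜ[ℂ] MulOpposite.op (P y)) * diffQuot E P α x := by
  induction x using fock_induction E with
  | one =>
    rw [one_mul, map_one, diffQuot_one, mul_zero, add_zero, ← Algebra.TensorProduct.one_def,
      one_mul]
  | cre k x ih =>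
    rw [cre_apply, mul_assoc, ← cre_apply, ← cre_apply, diffQuot_cre, ih, diffQuot_cre, mul_add,
      mul_add, ← mul_assoc, ← mul_assoc, ← mul_assoc, mul_smul_comm, cre_apply, map_mul, map_mul]
    simp only [Algebra.TensorProduct.tmul_mul_tmul, one_mul, mul_one, MulOpposite.op_mul]
    abel
  | add x x' hx hx' =>
    rw [add_mul, map_add, hx, hx', map_add, map_add, TensorProduct.add_tmul, add_mul, mul_add]
    abel
  | smul c x hx =>
    rw [smul_mul_assoc, map_smul, hx, map_smul, map_smul, ← TensorProduct.smul_tmul',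
      smul_mul_assoc, mul_smul_comm, smul_add]

/-- The map `a ⊗ b^op ↦ φ(b) v(a)`. -/
def rightContract (φ : B →ₗ[ℂ] ℂ) (v : B →ₗ[ℂ] H) : B ⊗[ℂ] Bᵐᵒᵖ →ₗ[ℂ] H :=
  TensorProduct.lift (LinearMap.mk₂ ℂ (fun (a : B) (b : Bᵐᵒᵖ) => φ b.unop • v a)
    (fun a a' b => by rw [map_add, smul_add])
    (fun c a b => by rw [map_smul, smul_comm])
    (fun a b b' => by rw [MulOpposite.unop_add, map_add, add_smul])
    (fun c a b => by rw [MulOpposite.unop_smul, map_smul, smul_eq_mul, mul_smul]))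

theorem rightContract_tmul (φ : B →ₗ[ℂ] ℂ) (v : B →ₗ[ℂ] H) (a : B) (b : Bᵐᵒᵖ) :
    rightContract φ v (a ⊗ₜ[ℂ] b) = φ b.unop • v a := rfl

theorem rightContract_mul (φ : B →ₗ[ℂ] ℂ) (v : B →ₗ[ℂ] H) {a : B} {L : H →ₗ[ℂ] H}
    (h : ∀ b, v (a * b) = L (v b)) (u : B ⊗[ℂ] Bᵐᵒᵖ) :
    rightContract φ v ((a ⊗ₜ[ℂ] 1) * u) = L (rightContract φ v u) := by
  induction u using TensorProduct.induction_on with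
  | zero => simp
  | tmul b c =>
    rw [Algebra.TensorProduct.tmul_mul_tmul, one_mul, rightContract_tmul, rightContract_tmul,
      map_smul, h]
  | add u v hu hv => rw [mul_add, map_add, map_add, hu, hv, map_add]

theorem diffQuot_cre_one (E : AdaptedBasis D d) (P : FockAlg V →ₐ[ℂ] B) (α k : Fin d) :
    diffQuot E P α (cre E k 1) = conjMat E k α • (1 ⊗ₜ[ℂ] 1) := by
  rw [diffQuot_cre, diffQuot_one, mul_zero, zero_add, map_one, MulOpposite.op_one]

/-- The difference quotient and the dual operator satisfy the same recursion. -/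
theorem rightContract_diffQuot [FiniteDimensional ℝ V] (E : AdaptedBasis D d)
    (P : FockAlg V →ₐ[ℂ] B) (φ : B →ₗ[ℂ] ℂ)
    (v : B →ₗ[ℂ] Fock E)
    (hv : ∀ k b, v (P (TensorAlgebra.ι ℂ (E.e k)) * b) = fieldOp E k (v b)) (hv1 : v 1 = vac E)
    (hφ : ∀ x, φ (P x) = vacCoeff E (polyVec E x)) (α : Fin d) (x : FockAlg V) :
    rightContract φ v (diffQuot E P α x) = emb E (dual E α (polyVec E x)) := by
  induction x using fock_induction E with
  | one => rw [diffQuot_one, polyVec_one, dual_one, map_zero, map_zero]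
  | cre k x ih =>
    rw [diffQuot_cre, polyVec_cre, dual_fieldAlg, map_add, map_smul,
      rightContract_mul (L := (fieldOp E k).toLinearMap) _ _ (hv k), ih, rightContract_tmul,
      MulOpposite.unop_op, hφ, hv1, map_add, ContinuousLinearMap.coe_coe, fieldOp_emb, map_smul,
      map_smul]
    rfl
  | add x y hx hy => simp only [map_add, hx, hy]
  | smul c x hx => simp only [map_smul, hx]

end Abstract

theorem vacState_emb (E : AdaptedBasis D d) {X : Fock E →L[ℂ] Fock E} {x : FockAlg V}
    (h : X (vac E) = emb E x) : vacState E X = vacCoeff E x := by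
  change inner ℂ (vac E) (X (vac E)) = _
  rw [h, inner_vac_emb]

theorem vacState_gen_mul_gen [FiniteDimensional ℝ V] (E : AdaptedBasis D d) (l k : Fin d) :
    vacState E (gen E l * gen E k) = conjMat E l k := by
  rw [vacState_emb E (x := fieldAlg E l (fieldAlg E k 1))]
  · simp [fieldAlg_apply, annBar_cre]
  · rw [mul_apply_eq_comp, vac, gen_emb, gen_emb]

/-- The restriction of the vacuum state to the von Neumann algebra. -/
def awState (E : AdaptedBasis D d) : awStar E →ₗ[ℂ] ℂ :=
  vacState E ∘ₗ (awStar E).subtype.toLinearMap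

/-- The map `X ↦ X Ω` on the von Neumann algebra. -/
def evalVac (E : AdaptedBasis D d) : awStar E →ₗ[ℂ] Fock E :=
  (ContinuousLinearMap.apply ℂ (Fock E) (vac E)).toLinearMap ∘ₗ (awStar E).subtype.toLinearMap

theorem evalVac_one (E : AdaptedBasis D d) : evalVac E 1 = vac E := rfl

theorem evalVac_polyHom_mul (E : AdaptedBasis D d) (k : Fin d) (b : awStar E) :
    evalVac E (polyHom E (TensorAlgebra.ι ℂ (E.e k)) * b) = fieldOp E k (evalVac E b) := by
  rw [polyHom_ι]
  rfl

theorem awState_polyHom (E : AdaptedBasis D d) (x : FockAlg V) :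
    awState E (polyHom E x) = vacCoeff E (polyVec E x) := vacState_emb E (polyHom_vac E x)

theorem rightContract_diffQuot_polyHom [FiniteDimensional ℝ V] (E : AdaptedBasis D d) (α : Fin d)
    (x : FockAlg V) :
    rightContract (awState E) (evalVac E) (diffQuot E (polyHom E) α x) =
      emb E (dual E α (polyVec E x)) :=
  rightContract_diffQuot E (polyHom E) (awState E) (evalVac E) (evalVac_polyHom_mul E)
    (evalVac_one E) (awState_polyHom E) α x

theorem tensorState_eq (E : AdaptedBasis D d) (u : awTensor E) :
    tensorState E u = inner ℂ (vac E) (rightContract (awState E) (evalVac E) u) := by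
  refine LinearMap.congr_fun (f := tensorState E) (g := (innerSL ℂ (vac E)).toLinearMap ∘ₗ
    rightContract (awState E) (evalVac E)) (TensorProduct.ext' fun a b => ?_) u
  refine Eq.trans (mul_comm _ _) ?_
  exact (inner_smul_right (𝕜 := ℂ) (vac E) (evalVac E a) (awState E b.unop)).symm

theorem map_mul_of_polyHom_eq (E : AdaptedBasis D d) {Q : polyAlg E →ₗ[ℂ] FockAlg V}
    (hQ : ∀ X, polyHom E (Q X) = StarSubalgebra.inclusion (polyAlg_le E) X) (a b : polyAlg E) :
    Q (a * b) = Q a * Q b :=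
  polyHom_injective E <|
    (hQ (a * b)).trans <| (map_mul (StarSubalgebra.inclusion (polyAlg_le E)) a b).trans <|
      (congrArg₂ (fun s t => s * t) (hQ a) (hQ b)).symm.trans
        (map_mul (polyHom E) (Q a) (Q b)).symm

/-- The vector that represents the vacuum functional of `D_α` is the conjugate variable. -/
theorem isConjugateVariable [FiniteDimensional ℝ V] (E : AdaptedBasis D d) (α : Fin d) {ξ : Fock E}
    (hξ : ∀ x, inner ℂ ξ (emb E x) = vacCoeff E (dual E α x)) : IsConjugateVariable E α ξ := by
  obtain ⟨Q, hQ⟩ := exists_poly E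
  refine ⟨diffQuot E (polyHom E) α ∘ₗ Q, ⟨fun a b => ?_, fun l h => ?_⟩, fun X => ?_⟩
  · have := map_mul_of_polyHom_eq E hQ a b
    refine (congrArg (diffQuot E (polyHom E) α) this).trans ?_
    refine (diffQuot_mul E (polyHom E) α (Q a) (Q b)).trans ?_
    exact congrArg₂ (fun s t : awStar E => (s ⊗ₜ[ℂ] 1) * diffQuot E (polyHom E) α (Q b) +
      (1 ⊗ₜ[ℂ] MulOpposite.op t) * diffQuot E (polyHom E) α (Q a)) (hQ a) (hQ b)
  · have : Q ⟨gen E l, h⟩ = cre E l 1 := polyHom_injective E <| Subtype.ext <| by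
      rw [hQ, cre_apply, mul_one, polyHom_ι]
      exact gen_eq_fieldOp E l
    refine (congrArg (diffQuot E (polyHom E) α) this).trans ?_
    rw [vacState_gen_mul_gen]
    exact diffQuot_cre_one E (polyHom E) α l
  · have hX : (X : Fock E →L[ℂ] Fock E) (vac E) = emb E (polyVec E (Q X)) :=
      (congrArg (fun Y : awStar E => (Y : Fock E →L[ℂ] Fock E) (vac E)) (hQ X)).symm.trans
        (polyHom_vac E (Q X))
    rw [hX, hξ, LinearMap.comp_apply, tensorState_eq, ← inner_vac_emb]
    exact congrArg (inner ℂ (vac E)) (rightContract_diffQuot_polyHom E α (Q X)).symm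

/-! ### Dual systems -/

/-- The dual operator as an unbounded operator on the deformed Fock space. -/
def dualOp (E : AdaptedBasis D d) (α : Fin d) : Fock E →ₗ.[ℂ] Fock E where
  domain := LinearMap.range (emb E)
  toFun := emb E ∘ₗ dual E α ∘ₗ (LinearEquiv.ofInjective (emb E) (emb_injective E)).symm.toLinearMap

theorem dualOp_emb (E : AdaptedBasis D d) (α : Fin d) (x : FockAlg V)
    (h : emb E x ∈ (dualOp E α).domain) : dualOp E α ⟨emb E x, h⟩ = emb E (dual E α x) :=
  congrArg (fun y => emb E (dual E α y))
    (LinearEquiv.symm_apply_apply (LinearEquiv.ofInjective (emb E) (emb_injective E)) x)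

theorem dense_domain (E : AdaptedBasis D d) {T : Fock E →ₗ.[ℂ] Fock E}
    (h : ∀ x, emb E x ∈ T.domain) : Dense (T.domain : Set (Fock E)) :=
  (denseRange_emb E).mono (by rintro _ ⟨x, rfl⟩; exact h x)

theorem isDualSystem_dualOp [FiniteDimensional ℝ V] (E : AdaptedBasis D d) {ξ : Fin d → Fock E}
    (hξ : ∀ α x, inner ℂ (ξ α) (emb E x) = vacCoeff E (dual E α x)) :
    IsDualSystem E (dualOp E) where
  dom k x := ⟨x, rfl⟩
  vac_mem_adjoint k := by
    refine LinearPMap.mem_adjoint_domain_of_exists _ ⟨ξ k, ?_⟩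
    rintro ⟨_, x, rfl⟩
    refine (hξ k x).trans ?_
    rw [← inner_vac_emb, ← dualOp_emb E k x ⟨x, rfl⟩]
  vac_eq_zero k := by
    refine (dualOp_emb E k 1 _).trans ?_
    rw [dual_one, map_zero]
  commutator k l x := by
    have h : gen E l (emb E x) = emb E (fieldAlg E l x) := gen_emb E l x
    refine ⟨⟨_, h.symm⟩, ?_⟩
    have h1 : dualOp E k ⟨gen E l (emb E x), ⟨_, h.symm⟩⟩ = emb E (dual E k (fieldAlg E l x)) := by
      rw [← dualOp_emb E k _ ⟨_, rfl⟩]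
      congr 1
      exact Subtype.ext h
    have h2 : dualOp E k ⟨emb E x, ⟨x, rfl⟩⟩ = emb E (dual E k x) := dualOp_emb E k x _
    rw [h1]
    refine (congrArg (fun v => _ - gen E l v) h2).trans ?_
    rw [gen_emb, dual_fieldAlg, map_add, map_smul, map_smul, add_sub_cancel_left, inner_vac_emb]
    rfl

/-- The commutation relations determine a normalized dual system on the algebraic Fock space. -/
theorem IsDualSystem.apply_emb [FiniteDimensional ℝ V] {E : AdaptedBasis D d}
    {S : Fin d → (Fock E →ₗ.[ℂ] Fock E)}
    (hS : IsDualSystem E S) (k : Fin d) (x : FockAlg V) :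
    S k ⟨emb E x, hS.dom k x⟩ = emb E (dual E k x) := by
  induction x using field_induction E with
  | one =>
    rw [dual_one, map_zero]
    exact hS.vac_eq_zero k
  | field l x ih =>
    obtain ⟨h, hc⟩ := hS.commutator k l x
    have h1 : S k ⟨emb E (fieldAlg E l x), hS.dom k _⟩ = S k ⟨gen E l (emb E x), h⟩ := by
      congr 1
      exact Subtype.ext (gen_emb E l x).symm
    rw [h1, sub_eq_iff_eq_add.mp hc, ih, gen_emb, dual_fieldAlg, map_add, map_smul, map_smul,
      inner_vac_emb, add_comm]
    rfl
  | add x y hx hy =>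
    have : (⟨emb E (x + y), hS.dom k _⟩ : (S k).domain) =
        ⟨emb E x, hS.dom k x⟩ + ⟨emb E y, hS.dom k y⟩ := Subtype.ext (map_add _ _ _)
    rw [this, LinearPMap.map_add, hx, hy, map_add, map_add]
  | smul c x hx =>
    have : (⟨emb E (c • x), hS.dom k _⟩ : (S k).domain) = c • ⟨emb E x, hS.dom k x⟩ :=
      Subtype.ext (map_smul _ _ _)
    rw [this, LinearPMap.map_smul, hx, map_smul, map_smul]

/-- The vector that represents the vacuum functional of `D_α` is `D_α^* Ω` for every normalized dual
system. -/
theorem IsDualSystem.adjoint_vac [FiniteDimensional ℝ V] {E : AdaptedBasis D d}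
    {S : Fin d → (Fock E →ₗ.[ℂ] Fock E)}
    (hS : IsDualSystem E S) {α : Fin d} {ξ : Fock E}
    (hξ : ∀ x, inner ℂ ξ (emb E x) = vacCoeff E (dual E α x)) :
    (S α).adjoint ⟨vac E, hS.vac_mem_adjoint α⟩ = ξ := by
  refine (denseRange_emb E).eq_of_inner_left ℂ fun x => ?_
  rw [hξ, ← inner_vac_emb, ← hS.apply_emb]
  exact LinearPMap.adjoint_isFormalAdjoint (dense_domain E (hS.dom α))
    ⟨vac E, hS.vac_mem_adjoint α⟩ ⟨emb E x, hS.dom α x⟩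

end MixedArakiWoods

end

theorem corollary3p4 {V : Type*} [NormedAddCommGroup V] [InnerProductSpace ℝ V]
    [FiniteDimensional ℝ V] {N : Type*} [Finite N] (D : MixedArakiWoods.AWData V N) {d : ℕ}
    (E : MixedArakiWoods.AdaptedBasis D d) :
    -- the operators and Wick operators that occur below are well defined
    (∀ ξ : MixedArakiWoods.Cplx V,
      (∃ L, MixedArakiWoods.IsExtension E (MixedArakiWoods.freeAnn E ξ) L) ∧
      (∃ L, MixedArakiWoods.IsExtension E (MixedArakiWoods.annihilation E ξ) L) ∧
      (∃ L, MixedArakiWoods.IsExtension E (MixedArakiWoods.creation ξ) L)) ∧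
    (∀ x : MixedArakiWoods.FockAlg V, ∃! X : MixedArakiWoods.Fock E →L[ℂ] MixedArakiWoods.Fock E,
      X ∈ MixedArakiWoods.awAlgebra E ∧ X (MixedArakiWoods.vac E) = MixedArakiWoods.emb E x) ∧
    (∀ (n : ℕ) (α : Fin d), ∃ x, MixedArakiWoods.emb E x = MixedArakiWoods.xiTerm E n α) ∧
    -- there is a dual system
    (∃ S, MixedArakiWoods.IsDualSystem E S) ∧
    -- the conjugate variables
    ∃ ξ : Fin d → MixedArakiWoods.Fock E, ∀ α : Fin d,
      HasSum (fun n : ℕ => (-1 : ℂ) ^ n • MixedArakiWoods.xiTerm E n α) (ξ α) ∧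
      (∀ S, MixedArakiWoods.IsDualSystem E S →
        ∃ h : MixedArakiWoods.vac E ∈ (S α).adjoint.domain,
          (S α).adjoint ⟨MixedArakiWoods.vac E, h⟩ = ξ α) ∧
      MixedArakiWoods.IsConjugateVariable E α (ξ α) ∧
      ∃ X ∈ MixedArakiWoods.awAlgebra E,
        HasSum (fun n : ℕ =>
          (-1 : ℂ) ^ n • MixedArakiWoods.wick E (MixedArakiWoods.xiTerm E n α)) X ∧
        X (MixedArakiWoods.vac E) = ξ α := by
  choose X hX hwick hsum using MixedArakiWoods.exists_hasSum_wick E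
  have hξ := fun α => MixedArakiWoods.inner_eq_vacCoeff_dual E α (hsum α)
  refine ⟨fun ξ => ⟨MixedArakiWoods.extends_freeAnn E ξ, MixedArakiWoods.extends_annihilation E ξ,
    MixedArakiWoods.extends_creation E ξ⟩, MixedArakiWoods.existsUnique_wick E, fun n α => ?_,
    ⟨_, MixedArakiWoods.isDualSystem_dualOp E hξ⟩, fun α => X α (MixedArakiWoods.vac E),
    fun α => ⟨hsum α, fun S hS => ⟨hS.vac_mem_adjoint α, hS.adjoint_vac (hξ α)⟩,
      MixedArakiWoods.isConjugateVariable E α (hξ α), X α, hX α, hwick α, rfl⟩⟩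
  obtain ⟨q, S, R, -, -, -, h⟩ := MixedArakiWoods.exists_xiTerm_bound E α
  obtain ⟨z, -, hz, -⟩ := h n
  exact ⟨z, hz⟩
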